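/- Let $(M,g)$ be a simply connected (hence connected) smooth Riemannian manifold of dimension $n\ge 2$, with Levi-Civita connection $\nabla$ and Laplace-Beltrami operator $\Delta$. Let $\mathcal K$ be a linear space of Killing tensors of $(M,g)$, viewed as $g$-self-adjoint endomorphism fields $K$, with $g\in\mathcal K$ (i.e. $\mathrm{Id}\in\mathcal K$) and $\dim\mathcal K\ge 2n-1$, which is irreducible: at each $p\in M$ the only subspaces of $T_pM$ invariant under all $K\in\mathcal K$ are $0$ and $T_pM$. Let $\mathcal V\subset C^\infty(M)$ be a linear subspace with $d(K(dV))=0$ for all $K\in\mathcal K$, $V\in\mathcal V$. The quadruple $(M,g,\mathcal K,\mathcal V)$ is called a *non-degenerate system* if $\dim\mathcal V=n+2$. It is called a *generalized semi-degenerate system* if $\dim\mathcal V=n+1$ and there are a smooth tensor field $\hat T\in\Gamma(\mathrm{Sym}^2_\circ(T^*M)\otimes TM)$ (symmetric and trace-free in its covariant indices) and a smooth vector field $\hat s$ with $$\nabla^2V=\hat T(dV)+\tfrac1n\,g\,\Delta V,\qquad \Delta V=\hat s(dV)\qquad\text{for all }V\in\mathcal V .$$ For such a system put $\hat D=\hat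 T+\frac1n\,g\otimes\hat s$, $\nabla^{\pm\hat D}=\nabla\mp\hat D$, $s=\hat s^\flat$ and $t=\frac{n}{(n-1)(n+2)}\,\mathrm{tr}(\hat T)$, where $\mathrm{tr}(\hat T)(X)$ is the trace of $Y\mapsto\hat T(X,Y)$. The system is *weak* if there is $\mathcal V'\supseteq\mathcal V$ such that $(M,g,\mathcal K,\mathcal V')$ is non-degenerate. A smooth curve $\gamma:(-\varepsilon,\varepsilon)\to M$ is a *dual-geodesic* of an affine connection $\nabla'$ if $\nabla'_{\dot\gamma}\dot\gamma^\flat=q\,\dot\gamma^\flat$ for some function $q:(-\varepsilon,\varepsilon)\to\mathbb R$, where $\flat$ is taken with respect to $g$. The pair $(\nabla',g)$ is *semi-compatible via* a $1$-form $\alpha$ if $(\nabla'_Xg)(Y,Z)-(\nabla'_Yg)(X,Z)=\alpha(Y)g(X,Z)-\alpha(X)g(Y,Z)$ for all vector fields $X,Y,Z$. Theorem 2. Let $(M,g,\mathcal K,\mathcal V)$ be a generalized semi-degenerate system. (i) Suppose that the system is weak, and let $(M,g,\mathcal K,\mathcal V')$, $\mathcal V'\supseteq\mathcal V$, be a non-degenerate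 system extending it. Then there is exactly one smooth tensor field $\hat T'\in\Gamma(\mathrm{Sym}^2_\circ(T^*M)\otimes TM)$ with $\nabla^2V=\hat T'(dV)+\frac1n\,g\,\Delta V$ for all $V\in\mathcal V'$, and with $\nabla^{\pm\hat T'}=\nabla\mp\hat T'$ the connections $\nabla^{\hat D}$ and $\nabla^{\hat T'}$ share the same dual-geodesics. Likewise $\nabla^{-\hat D}$ and $\nabla^{-\hat T'}$ share the same dual-geodesics. (ii) The pair $(\nabla^{\hat D},g)$ is semi-compatible via $\beta=\frac1n\left(s-(n+2)\,t\right)$ if and only if the system is weak. Likewise $(\nabla^{-\hat D},g)$ is semi-compatible via $-\beta$ if and only if the system is weak. -/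

import Mathlib

open Bundle VectorField
open scoped Manifold ContDiff Topology
noncomputable section
namespace Superint

/-! ### The Levi-Civita connection -/

section
variable {E : Type*} [NormedAddCommGroup E] [NormedSpace ℝ E]
  {H : Type*} [TopologicalSpace H] {I : ModelWithCorners ℝ E H}
  {M : Type*} [TopologicalSpace M] [ChartedSpace H M]

instance tangentSpace_finiteDimensional [FiniteDimensional ℝ E] (x : M) :
    FiniteDimensional ℝ (TangentSpace I x) :=
  inferInstanceAs (FiniteDimensional ℝ E)

variable [RiemannianBundle (fun x : M => TangentSpace I x)]

instance tangentSpace_completeSpace [FiniteDimensional ℝ E] (x : M) :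
    CompleteSpace (TangentSpace I x) :=
  FiniteDimensional.complete ℝ _

/-- The musical isomorphism `♯ : T*ₓM → TₓM`. -/
def sharp [FiniteDimensional ℝ E] (x : M) : (TangentSpace I x →L[ℝ] ℝ) →L[ℝ] TangentSpace I x :=
  LinearMap.toContinuousLinearMap
    { toFun := fun a => (InnerProductSpace.toDual ℝ (TangentSpace I x)).symm a
      map_add' := fun a b => map_add _ a b
      map_smul' := fun c a => by simp }

theorem inner_sharp [FiniteDimensional ℝ E] (x : M) (a : TangentSpace I x →L[ℝ] ℝ) (v : TangentSpace I x) :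
    inner ℝ (sharp x a) v = a v :=
  InnerProductSpace.toDual_symm_apply (𝕜 := ℝ) (E := TangentSpace I x)

variable [IsManifold I ∞ M]

theorem ext_of_extend {x : M} {A B : TangentSpace I x →L[ℝ] TangentSpace I x}
    (h : ∀ X Z : Π x : M, TangentSpace I x, MDiffAt (T% X) x → MDiffAt (T% Z) x →
      inner ℝ (A (X x)) (Z x) = inner ℝ (B (X x)) (Z x)) : A = B := by
  ext v
  refine ext_inner_right ℝ fun w => ?_
  simpa using h (FiberBundle.extend E v) (FiberBundle.extend E w)
    (FiberBundle.mdifferentiableAt_extend ..) (FiberBundle.mdifferentiableAt_extend ..)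

/-- The right-hand side of the Koszul formula for `g(∇_X Y, Z)`. -/
def koszul (X Y Z : Π x : M, TangentSpace I x) (x : M) : ℝ :=
  (1 / 2 : ℝ) * (mvfderiv I (fun y => inner ℝ (Y y) (Z y)) x (X x)
    + mvfderiv I (fun y => inner ℝ (X y) (Z y)) x (Y x)
    - mvfderiv I (fun y => inner ℝ (X y) (Y y)) x (Z x)
    + inner ℝ (mlieBracket I X Y x) (Z x)
    - inner ℝ (mlieBracket I X Z x) (Y x)
    - inner ℝ (mlieBracket I Y Z x) (X x))

variable [IsContMDiffRiemannianBundle I ∞ E (fun x : M => TangentSpace I x)]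

theorem mdiffAt_inner {X Y : Π x : M, TangentSpace I x} {x : M}
    (hX : MDiffAt (T% X) x) (hY : MDiffAt (T% Y) x) :
    MDiffAt (fun y => inner ℝ (X y) (Y y)) x :=
  MDifferentiableAt.inner_bundle (E := fun x : M => TangentSpace I x) hX hY

variable [FiniteDimensional ℝ E]

theorem koszul_tensorialAt_right {X Y : Π x : M, TangentSpace I x} {x : M}
    (hX : MDiffAt (T% X) x) (hY : MDiffAt (T% Y) x) :
    TensorialAt I E (fun Z => koszul X Y Z x) x where
  smul {f Z} hf hZ := by
    have e1 := real_inner_comm (Z x) (Y x)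
    have e2 := real_inner_comm (Z x) (X x)
    simp [koszul, real_inner_smul_right, real_inner_smul_left, inner_add_left,
      mlieBracket_smul_right hf hZ,
      mvfderiv_fun_mul hf (mdiffAt_inner hY hZ), mvfderiv_fun_mul hf (mdiffAt_inner hX hZ)]
    rw [e1, e2]
    ring
  add {Z W} hZ hW := by
    simp [koszul, inner_add_right, inner_add_left, mlieBracket_add_right hZ hW,
      mvfderiv_fun_add (mdiffAt_inner hY hZ) (mdiffAt_inner hY hW),
      mvfderiv_fun_add (mdiffAt_inner hX hZ) (mdiffAt_inner hX hW)]
    ring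

theorem koszul_tensorialAt_left {Y Z : Π x : M, TangentSpace I x} {x : M}
    (hY : MDiffAt (T% Y) x) (hZ : MDiffAt (T% Z) x) :
    TensorialAt I E (fun X => koszul X Y Z x) x where
  smul {f X} hf hX := by
    simp [koszul, real_inner_smul_right, real_inner_smul_left, inner_add_left,
      mlieBracket_smul_left hf hX,
      mvfderiv_fun_mul hf (mdiffAt_inner hX hY), mvfderiv_fun_mul hf (mdiffAt_inner hX hZ)]
    ring
  add {X W} hX hW := by
    simp [koszul, inner_add_right, inner_add_left, mlieBracket_add_left hX hW,
      mvfderiv_fun_add (mdiffAt_inner hX hY) (mdiffAt_inner hW hY),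
      mvfderiv_fun_add (mdiffAt_inner hX hZ) (mdiffAt_inner hW hZ)]
    ring

theorem koszul_add {X Y W Z : Π x : M, TangentSpace I x} {x : M}
    (hX : MDiffAt (T% X) x) (hY : MDiffAt (T% Y) x) (hW : MDiffAt (T% W) x)
    (hZ : MDiffAt (T% Z) x) :
    koszul X (Y + W) Z x = koszul X Y Z x + koszul X W Z x := by
  simp [koszul, inner_add_right, inner_add_left, mlieBracket_add_right hY hW,
    mlieBracket_add_left hY hW,
    mvfderiv_fun_add (mdiffAt_inner hX hY) (mdiffAt_inner hX hW),
    mvfderiv_fun_add (mdiffAt_inner hY hZ) (mdiffAt_inner hW hZ)]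
  ring

theorem koszul_leibniz {X Y Z : Π x : M, TangentSpace I x} {f : M → ℝ} {x : M}
    (hX : MDiffAt (T% X) x) (hY : MDiffAt (T% Y) x) (hZ : MDiffAt (T% Z) x)
    (hf : MDiffAt f x) :
    koszul X (f • Y) Z x
      = f x * koszul X Y Z x + mvfderiv I f x (X x) * inner ℝ (Y x) (Z x) := by
  have e1 := real_inner_comm (X x) (Y x)
  simp [koszul, real_inner_smul_right, real_inner_smul_left, inner_add_left,
      mlieBracket_smul_left hf hY, mlieBracket_smul_right hf hY,
      mvfderiv_fun_mul hf (mdiffAt_inner hX hY), mvfderiv_fun_mul hf (mdiffAt_inner hY hZ)]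
  rw [e1]
  ring

open Classical in
/-- `∇Y`, at a point where `Y` is differentiable; the value elsewhere is irrelevant. -/
def leviCivitaFun (Y : Π x : M, TangentSpace I x) (x : M) :
    TangentSpace I x →L[ℝ] TangentSpace I x :=
  if hY : MDiffAt (T% Y) x then
    (sharp x).comp (TensorialAt.mkHom₂ (fun X Z => koszul X Y Z x) x
      (fun _ hZ => koszul_tensorialAt_left hY hZ) (fun _ hX => koszul_tensorialAt_right hX hY))
  else 0

theorem inner_leviCivitaFun {X Y Z : Π x : M, TangentSpace I x} {x : M}
    (hX : MDiffAt (T% X) x) (hY : MDiffAt (T% Y) x) (hZ : MDiffAt (T% Z) x) :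
    inner ℝ (leviCivitaFun Y x (X x)) (Z x) = koszul X Y Z x := by
  have h := TensorialAt.mkHom₂_apply (I := I) (F := E) (F' := E)
    (Φ := fun X Z => koszul X Y Z x)
    (fun _ hZ => koszul_tensorialAt_left hY hZ) (fun _ hX => koszul_tensorialAt_right hX hY) hX hZ
  simp only [leviCivitaFun, hY, dif_pos]
  rw [← h]
  exact inner_sharp ..

variable (I M) in
/-- The Levi-Civita connection `∇`: `leviCivita I M Y x (X x)` is `(∇_X Y)(x)`. -/
def leviCivita : CovariantDerivative I E (TangentSpace I : M → Type _) where
  toFun := leviCivitaFun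
  isCovariantDerivativeOnUniv :=
    { add := by
        intro Y W x hY hW _
        refine ext_of_extend fun X Z hX hZ => ?_
        rw [inner_leviCivitaFun hX (mdifferentiableAt_add_section hY hW) hZ,
          koszul_add hX hY hW hZ, ← inner_leviCivitaFun hX hY hZ, ← inner_leviCivitaFun hX hW hZ,
          ← inner_add_left]
        rfl
      leibniz := by
        intro Y f x hY hf _
        refine ext_of_extend fun X Z hX hZ => ?_
        rw [inner_leviCivitaFun hX (hf.smul_section hY) hZ, koszul_leibniz hX hY hZ hf,
          ← inner_leviCivitaFun hX hY hZ, ← real_inner_smul_left, ← real_inner_smul_left,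
          ← inner_add_left]
        rfl }

/-- The Koszul formula. -/
theorem inner_leviCivita {X Y Z : Π x : M, TangentSpace I x} {x : M}
    (hX : MDiffAt (T% X) x) (hY : MDiffAt (T% Y) x) (hZ : MDiffAt (T% Z) x) :
    inner ℝ (leviCivita I M Y x (X x)) (Z x) = koszul X Y Z x :=
  inner_leviCivitaFun hX hY hZ

/-- `(∇_X g)(Y, Z) = X(g(Y, Z)) - g(∇_X Y, Z) - g(Y, ∇_X Z)` for an affine connection `∇`. -/
def covDerivMetric (cov : CovariantDerivative I E (TangentSpace I : M → Type _))
    (X Y Z : Π x : M, TangentSpace I x) (x : M) : ℝ :=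
  mvfderiv I (fun y => inner ℝ (Y y) (Z y)) x (X x)
    - inner ℝ (cov Y x (X x)) (Z x) - inner ℝ (Y x) (cov Z x (X x))

theorem leviCivita_metric {X Y Z : Π x : M, TangentSpace I x} {x : M}
    (hX : MDiffAt (T% X) x) (hY : MDiffAt (T% Y) x) (hZ : MDiffAt (T% Z) x) :
    covDerivMetric (leviCivita I M) X Y Z x = 0 := by
  have h1 := inner_leviCivita hX hY hZ
  have h2 := inner_leviCivita hX hZ hY
  rw [covDerivMetric, h1, real_inner_comm, h2]
  simp only [koszul, mlieBracket_swap_apply (V := Z) (W := Y),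
    fun y : M => real_inner_comm (Y y) (Z y), inner_neg_left]
  ring

theorem leviCivita_torsion : (leviCivita I M).torsion = 0 := by
  rw [CovariantDerivative.torsion_eq_zero_iff]
  intro X Y x hX hY
  refine ext_inner_right ℝ fun w => ?_
  have hZ := FiberBundle.mdifferentiableAt_extend (I := I) E w
  have h1 := inner_leviCivita hX hY hZ
  have h2 := inner_leviCivita hY hX hZ
  rw [FiberBundle.extend_apply_self] at h1 h2
  rw [inner_sub_left, h1, h2]
  simp only [koszul, mlieBracket_swap_apply (V := Y) (W := X), fun y : M => real_inner_comm (X y) (Y y), inner_neg_left,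
    FiberBundle.extend_apply_self]
  ring

end

section
variable {n : ℕ} {M : Type*} [TopologicalSpace M] [ChartedSpace (EuclideanSpace ℝ (Fin n)) M]

/-! ### Fields on an `n`-dimensional manifold -/

variable (n M) in
/-- (Not necessarily smooth) vector fields. -/
abbrev VField : Type _ := Π x : M, TangentSpace (𝓡 n) x

variable (n M) in
/-- `1`-forms. -/
abbrev OneForm : Type _ := Π x : M, TangentSpace (𝓡 n) x →L[ℝ] ℝ

variable (n M) in
/-- Fields of endomorphisms of the tangent bundle. -/
abbrev EndField : Type _ := Π x : M, TangentSpace (𝓡 n) x →L[ℝ] TangentSpace (𝓡 n) x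

variable (n M) in
/-- Sections of `T*M ⊗ T*M ⊗ TM`. -/
abbrev BilinField : Type _ :=
  Π x : M, TangentSpace (𝓡 n) x →L[ℝ] TangentSpace (𝓡 n) x →L[ℝ] TangentSpace (𝓡 n) x

/-- Smoothness of a vector field, `X ∈ 𝔛(M)`. -/
def SmoothVField [IsManifold (𝓡 n) ∞ M] (X : VField n M) : Prop :=
  ContMDiff (𝓡 n) (𝓡 n).tangent ∞ (fun x => (⟨x, X x⟩ : TangentBundle (𝓡 n) M))

/-- The differential `dV` of a function. -/
def differential (V : M → ℝ) : OneForm n M := mvfderiv (𝓡 n) V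

variable [IsManifold (𝓡 n) ∞ M]

/-- A `1`-form `α` is closed: `X(α(Y)) - Y(α(X)) - α([X, Y]) = 0` for all `X, Y ∈ 𝔛(M)`. -/
def IsClosedOneForm (α : OneForm n M) : Prop :=
  ∀ X Y : VField n M, SmoothVField X → SmoothVField Y → ∀ x : M,
    mvfderiv (𝓡 n) (fun y => α y (Y y)) x (X x) - mvfderiv (𝓡 n) (fun y => α y (X y)) x (Y x)
      - α x (mlieBracket (𝓡 n) X Y x) = 0

variable [RiemannianBundle (fun x : M => TangentSpace (𝓡 n) x)]

/-- The `1`-form `X ↦ g(s, X)` of a vector field `s`. -/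
def flat (s : VField n M) : OneForm n M := fun x => innerSL ℝ (s x)

variable [IsContMDiffRiemannianBundle (𝓡 n) ∞ (EuclideanSpace ℝ (Fin n))
  (fun x : M => TangentSpace (𝓡 n) x)]

/-- A Killing tensor `K`, stored as the field of `g`-self-adjoint endomorphisms `K` with
`K♭(X, Y) = g(KX, Y)`. The last condition reads `(∇_X K♭)(X, X) = 0`. -/
structure IsKillingTensor (K : EndField n M) : Prop where
  smooth : ∀ X : VField n M, SmoothVField X → SmoothVField (fun x => K x (X x))
  symm : ∀ (x : M) (u v : TangentSpace (𝓡 n) x), inner ℝ (K x u) v = inner ℝ u (K x v)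
  killing : ∀ X : VField n M, SmoothVField X → ∀ x : M,
    mvfderiv (𝓡 n) (fun y => inner ℝ (K y (X y)) (X y)) x (X x)
      - inner ℝ (K x (leviCivita (𝓡 n) M X x (X x))) (X x)
      - inner ℝ (K x (X x)) (leviCivita (𝓡 n) M X x (X x)) = 0

/-- The Hessian `(∇²V)(u, v) = (∇_u dV)(v) = u(dV(Y)) - dV(∇_u Y)`, where `Y` is a (the choice
being irrelevant) local vector field, smooth near `x`, with `Y x = v`. -/
def hessian (V : M → ℝ) (x : M) (u v : TangentSpace (𝓡 n) x) : ℝ :=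
  mvfderiv (𝓡 n) (fun y => differential (n := n) V y
      (FiberBundle.extend (EuclideanSpace ℝ (Fin n)) v y)) x u
    - differential V x
      (leviCivita (𝓡 n) M (FiberBundle.extend (EuclideanSpace ℝ (Fin n)) v) x u)

/-- The metric trace `tr_g B = ∑ᵢ B(eᵢ, eᵢ)` (`eᵢ` an orthonormal basis of the tangent space). -/
def traceG {W : Type*} [AddCommMonoid W] (x : M)
    (B : TangentSpace (𝓡 n) x → TangentSpace (𝓡 n) x → W) : W :=
  ∑ i, B (stdOrthonormalBasis ℝ (TangentSpace (𝓡 n) x) i)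
    (stdOrthonormalBasis ℝ (TangentSpace (𝓡 n) x) i)

variable (n) in
/-- The Laplace-Beltrami operator `ΔV = tr_g ∇²V`. -/
def laplacian (V : M → ℝ) (x : M) : ℝ := traceG (n := n) x (hessian V x)

/-! ### Superintegrable systems -/

/-- The conditions on `(M, g, 𝒦, 𝒱)` common to non-degenerate (`N = n + 2`) and generalized
semi-degenerate (`N = n + 1`) systems. -/
structure IsIrreducibleSystem (𝒦 : Submodule ℝ (EndField n M))
    (𝒱 : Submodule ℝ C^∞⟮𝓡 n, M; ℝ⟯) (N : ℕ) : Prop where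
  killing : ∀ K ∈ 𝒦, IsKillingTensor K
  metric_mem : (fun x => ContinuousLinearMap.id ℝ (TangentSpace (𝓡 n) x)) ∈ 𝒦
  le_rank : ((2 * n - 1 : ℕ) : Cardinal) ≤ Module.rank ℝ 𝒦
  irreducible : ∀ (x : M) (W : Submodule ℝ (TangentSpace (𝓡 n) x)),
    (∀ K ∈ 𝒦, ∀ w ∈ W, K x w ∈ W) → W = ⊥ ∨ W = ⊤
  closed : ∀ K ∈ 𝒦, ∀ V ∈ 𝒱, IsClosedOneForm (fun x => (differential (n := n) V x).comp (K x))
  rank_eq : Module.rank ℝ 𝒱 = N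

/-- `T̂` is a structure tensor for the potentials `𝒱`: a smooth section of `Sym²_∘(T*M) ⊗ TM`,
trace-free in its covariant indices, with `∇²V = T̂(dV) + (1/n) g ΔV` for all `V ∈ 𝒱`. -/
structure IsStructureTensor (𝒱 : Submodule ℝ C^∞⟮𝓡 n, M; ℝ⟯) (T : BilinField n M) : Prop where
  smooth : ∀ X Y : VField n M, SmoothVField X → SmoothVField Y →
    SmoothVField (fun x => T x (X x) (Y x))
  symm : ∀ (x : M) (u v : TangentSpace (𝓡 n) x), T x u v = T x v u
  trace_free : ∀ x : M, traceG x (fun u v => T x u v) = 0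
  hessian_eq : ∀ V ∈ 𝒱, ∀ (x : M) (u v : TangentSpace (𝓡 n) x),
    hessian V x u v = differential V x (T x u v) + 1 / (n : ℝ) * inner ℝ u v * laplacian n V x

/-- `(M, g, 𝒦, 𝒱)` is a non-degenerate (`(n+2)`-parameter) system. -/
def IsNondegenerate (𝒦 : Submodule ℝ (EndField n M)) (𝒱 : Submodule ℝ C^∞⟮𝓡 n, M; ℝ⟯) : Prop :=
  IsIrreducibleSystem 𝒦 𝒱 (n + 2)

/-- `(M, g, 𝒦, 𝒱)` is a generalized semi-degenerate (`(n+1)`-parameter) system with structure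
tensor `T̂` and semi-degeneracy vector field `ŝ`. -/
structure IsGeneralizedSemidegenerate (𝒦 : Submodule ℝ (EndField n M))
    (𝒱 : Submodule ℝ C^∞⟮𝓡 n, M; ℝ⟯) (T : BilinField n M) (s : VField n M) : Prop where
  system : IsIrreducibleSystem 𝒦 𝒱 (n + 1)
  structureTensor : IsStructureTensor 𝒱 T
  smooth : SmoothVField s
  laplacian_eq : ∀ V ∈ 𝒱, ∀ x : M, laplacian n V x = differential V x (s x)

/-- A generalized semi-degenerate system is weak if its space of potentials extends to that of a
non-degenerate system (with the same Killing tensors). -/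
def IsWeak (𝒦 : Submodule ℝ (EndField n M)) (𝒱 : Submodule ℝ C^∞⟮𝓡 n, M; ℝ⟯) : Prop :=
  ∃ 𝒱' : Submodule ℝ C^∞⟮𝓡 n, M; ℝ⟯, 𝒱 ≤ 𝒱' ∧ IsNondegenerate 𝒦 𝒱'

/-- `D̂ = T̂ + (1/n) g ⊗ ŝ`. -/
def tensorD (T : BilinField n M) (s : VField n M) : BilinField n M := fun x =>
  (LinearMap.mk₂ ℝ (fun u v => T x u v + (1 / (n : ℝ) * inner ℝ u v) • s x)
    (fun u u' v => by simp only [map_add, add_apply, inner_add_left]; module)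
    (fun c u v => by simp only [map_smul, smul_apply, real_inner_smul_left]; module)
    (fun u v v' => by simp only [map_add, inner_add_right]; module)
    (fun c u v => by
      simp only [map_smul, real_inner_smul_right]; module)).toContinuousBilinearMap

/-- `t = n / ((n-1)(n+2)) tr(T̂)`, where `tr(T̂)(X)` is the trace of `Y ↦ T̂(X, Y)`. -/
def formT (T : BilinField n M) : OneForm n M := fun x =>
  LinearMap.toContinuousLinearMap
    (((n : ℝ) / (((n : ℝ) - 1) * ((n : ℝ) + 2))) •
      (LinearMap.trace ℝ (TangentSpace (𝓡 n) x) ∘ₗ ContinuousLinearMap.coeLM ℝ ∘ₗ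
        (T x : TangentSpace (𝓡 n) x →ₗ[ℝ] _)))

/-! ### Affine connections, dual-geodesics, semi-compatibility -/

variable (n M) in
/-- Affine connections on `M`; `cov Y x (X x)` is `(∇_X Y)(x)`. -/
abbrev AffineConnection : Type _ :=
  CovariantDerivative (𝓡 n) (EuclideanSpace ℝ (Fin n)) (TangentSpace (𝓡 n) : M → Type _)

/-- `∇^{Â} = ∇ - Â` for a symmetric `Â`; thus `∇^{-Â} = ∇ + Â` is `inducedConnection (-Â)`. -/
def inducedConnection (A : BilinField n M) : AffineConnection n M :=
  (leviCivita (𝓡 n) M).addOneForm (-A)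

/-- The velocity of a curve. -/
def velocity (γ : ℝ → M) (τ : ℝ) : TangentSpace (𝓡 n) (γ τ) :=
  mfderiv 𝓘(ℝ, ℝ) (𝓡 n) γ τ (1 : ℝ)

/-- `(∇_γ̇ γ̇♭)(Y)` at time `τ`, that is `(d/dτ) γ̇♭(Y) - γ̇♭(∇_γ̇ Y)`, for a vector field `Y`. -/
def covDerivVelocityFlat (cov : AffineConnection n M) (γ : ℝ → M) (Y : VField n M) (τ : ℝ) : ℝ :=
  deriv (fun σ => inner ℝ (velocity (n := n) γ σ) (Y (γ σ))) τ
    - inner ℝ (velocity (n := n) γ τ) (cov Y (γ τ) (velocity γ τ))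

/-- The smooth curve `γ : (-ε, ε) → M` is a dual-geodesic of `∇`: `∇_γ̇ γ̇♭ = q γ̇♭` for some
function `q`. -/
def IsDualGeodesic (cov : AffineConnection n M) (ε : ℝ) (γ : ℝ → M) : Prop :=
  ContMDiffOn 𝓘(ℝ, ℝ) (𝓡 n) ∞ γ (Set.Ioo (-ε) ε) ∧
    ∃ q : ℝ → ℝ, ∀ τ ∈ Set.Ioo (-ε) ε, ∀ Y : VField n M, SmoothVField Y →
      covDerivVelocityFlat cov γ Y τ = q τ * inner ℝ (velocity (n := n) γ τ) (Y (γ τ))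

/-- Two connections share the same dual-geodesics. -/
def ShareDualGeodesics (cov cov' : AffineConnection n M) : Prop :=
  ∀ ε : ℝ, 0 < ε → ∀ γ : ℝ → M, IsDualGeodesic cov ε γ ↔ IsDualGeodesic cov' ε γ

/-- `(∇', g)` is semi-compatible via `α`:
`(∇'_X g)(Y, Z) - (∇'_Y g)(X, Z) = α(Y) g(X, Z) - α(X) g(Y, Z)` for all `X, Y, Z ∈ 𝔛(M)`. -/
def SemiCompatible (cov : AffineConnection n M) (α : OneForm n M) : Prop :=
  ∀ X Y Z : VField n M, SmoothVField X → SmoothVField Y → SmoothVField Z → ∀ x : M,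
    covDerivMetric cov X Y Z x - covDerivMetric cov Y X Z x
      = α x (Y x) * inner ℝ (X x) (Z x) - α x (X x) * inner ℝ (Y x) (Z x)

end
end Superint
end

open Bundle VectorField
open scoped Manifold ContDiff Topology
noncomputable section
namespace Superint

/-! ### Analysis in a vector space -/

/-! Write `D` for `tensorD T s`. Every `V ∈ 𝒱` satisfies `∇²V = dV ∘ D`, a closed linear first-order
system for `dV`, so on a connected manifold `V` is determined by its value and differential at one
point. Since `𝒱` has dimension `n + 1`, every covector at every point is the differential of some
potential, and the constants lie in `𝒱` (`range_diffAt`, `const_mem`). Hence there are potentials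
`V₁, …, Vₙ` whose differentials form a global coframe. The dual frame `X₁, …, Xₙ` commutes, and
`∇_{Xᵢ} Xⱼ = -D(Xᵢ, Xⱼ)`, so it is parallel for `∇ + D` (`IsFlatFrame`). Almost all later
computations take place in this frame, with Gram matrix `gᵢⱼ = g(Xᵢ, Xⱼ)`.

Part (i). Given a potential `V` of the larger system and a point `x`, subtract some `W ∈ 𝒱` with the
same differential at `x`. At a critical point, closedness of `K(dU)` says that the Hessian of `U = V
- W` commutes with all Killing tensors, so by irreducibility it is a multiple of `g`. Thus the
structure tensor of `𝒱` also serves the larger space, and it is the only one. It differs from `D` by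
`g` times a vector field, which only changes the factor `q` in the dual-geodesic equation.

Part (ii). Semi-compatibility of `∇ - D` via `β` is the algebraic identity `HasSkewPart D β`, which
in the frame reads `Xₖ gᵢⱼ - Xᵢ gₖⱼ = βₖ gᵢⱼ - βᵢ gₖⱼ`; a trace shows that no other form than
`formBeta T s` is possible. If the system is weak, an additional potential `W` satisfies `Xᵢ Xⱼ W =
φ gᵢⱼ`. Commuting derivatives gives `dφ = -φ β` together with the identity multiplied by `φ`. A zero
of `φ` would make it vanish identically and put `W` in `𝒱`, so `φ` can be cancelled
(`hasSkewPart_of_isWeak`).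

Conversely, if `β` is closed, then `β = dh` by simple connectedness, and with `f = exp(-h)` the
functions `f gᵢⱼ` integrate twice to a potential `W` with `Xᵢ Xⱼ W = f gᵢⱼ` (`exists_potential`).
Self-adjointness of the Killing tensors makes all `K(dW)` closed, and `W ∉ 𝒱` because `f > 0`. The
closedness of `β` is the delicate point. For `n ≥ 3` it follows by differentiating the skew identity
(`cyclic_sum_eq_zero`). For `n = 2` that argument is empty; instead two Killing tensors that do not
commute at the point yield a function `Q`, nonzero there, with `dQ = β Q`
(`mvfderiv_form_comm_of_surface`).

The statements for `∇ + D` follow by changing the signs of `D` and `β` together. -/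

theorem contDiff_matrix_det {m : ℕ} :
    ContDiff ℝ ∞ (fun A : Fin m → Fin m → ℝ => (Matrix.of A).det) := by
  simp only [Matrix.det_apply, Matrix.of_apply]
  refine ContDiff.sum fun σ _ => ContDiff.const_smul _ (contDiff_prod fun i _ => ?_)
  fun_prop

theorem contDiffAt_matrix_inv {m : ℕ} (A : Fin m → Fin m → ℝ) (hA : (Matrix.of A).det ≠ 0)
    (i j : Fin m) :
    ContDiffAt ℝ ∞ (fun A : Fin m → Fin m → ℝ => (Matrix.of A)⁻¹ i j) A := by
  simp only [Matrix.inv_def, Ring.inverse_eq_inv', Matrix.smul_apply, smul_eq_mul,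
    Matrix.adjugate_apply]
  refine (contDiff_matrix_det.contDiffAt.inv hA).mul ?_
  have : (fun A : Fin m → Fin m → ℝ => ((Matrix.of A).updateRow j (Pi.single i 1)).det)
      = (fun A : Fin m → Fin m → ℝ => (Matrix.of A).det) ∘
        (fun A : Fin m → Fin m → ℝ => Function.update A j (Pi.single i 1)) := by
    ext A; rfl
  rw [this]
  refine (contDiff_matrix_det.comp ?_).contDiffAt
  refine contDiff_pi.2 fun k => ?_
  by_cases h : k = j
  · subst h; simpa using contDiff_const
  · simpa [Function.update_of_ne h] using contDiff_apply ..

/-- Grönwall's inequality along the segment from `x₀` to `y`, with zero initial value. -/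
theorem eq_zero_of_norm_fderiv_le {E F : Type*} [NormedAddCommGroup E] [NormedSpace ℝ E]
    [NormedAddCommGroup F] [NormedSpace ℝ F] {f : E → F} {x₀ : E} {r C : ℝ}
    (hf : ∀ x ∈ Metric.ball x₀ r, DifferentiableAt ℝ f x)
    (hC : ∀ x ∈ Metric.ball x₀ r, ∀ v, ‖fderiv ℝ f x v‖ ≤ C * ‖v‖ * ‖f x‖)
    (h0 : f x₀ = 0) {y : E} (hy : y ∈ Metric.ball x₀ r) : f y = 0 := by
  have hmem : ∀ t ∈ Set.Icc (0 : ℝ) 1, x₀ + t • (y - x₀) ∈ Metric.ball x₀ r := by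
    intro t ht
    rw [Metric.mem_ball, dist_eq_norm] at hy ⊢
    rw [add_sub_cancel_left, norm_smul, Real.norm_of_nonneg ht.1]
    exact (mul_le_of_le_one_left (norm_nonneg _) ht.2).trans_lt hy
  have hd : ∀ t ∈ Set.Icc (0 : ℝ) 1, HasDerivAt (fun t : ℝ => f (x₀ + t • (y - x₀)))
      (fderiv ℝ f (x₀ + t • (y - x₀)) (y - x₀)) t := by
    intro t ht
    have h1 : HasDerivAt (fun t : ℝ => x₀ + t • (y - x₀)) (y - x₀) t := by
      simpa using ((hasDerivAt_id t).smul_const (y - x₀)).const_add x₀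
    exact (hf _ (hmem t ht)).hasFDerivAt.comp_hasDerivAt t h1
  have := norm_le_gronwallBound_of_norm_deriv_right_le (δ := 0) (ε := 0)
    (K := C * ‖y - x₀‖) (a := 0) (b := 1)
    (fun t ht => (hd t ht).continuousAt.continuousWithinAt)
    (fun t ht => (hd t (Set.Ico_subset_Icc_self ht)).hasDerivWithinAt) (by simp [h0])
    (fun t ht => by simpa using hC _ (hmem t (Set.Ico_subset_Icc_self ht)) (y - x₀)) 1 (by simp)
  simpa [gronwallBound_ε0_δ0] using this

/-! ### Functions on a manifold, read in a chart -/

section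
variable {n : ℕ} {M : Type*} [TopologicalSpace M] [ChartedSpace (EuclideanSpace ℝ (Fin n)) M]

theorem contMDiffAt_matrix_inv {m : ℕ} {A : M → Matrix (Fin m) (Fin m) ℝ} {x : M}
    (h : ∀ i j, ContMDiffAt (𝓡 n) 𝓘(ℝ, ℝ) ∞ (fun y => A y i j) x) (hA : (A x).det ≠ 0)
    (i j : Fin m) :
    ContMDiffAt (𝓡 n) 𝓘(ℝ, ℝ) ∞ (fun y => (A y)⁻¹ i j) x :=
  (contDiffAt_matrix_inv (fun i j => A x i j) hA i j).contMDiffAt.comp (x := x)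
    (f := fun y => (fun i j => A y i j : Fin m → Fin m → ℝ))
    (contMDiffAt_pi_space.2 fun i => contMDiffAt_pi_space.2 fun j => h i j)

variable [IsManifold (𝓡 n) ∞ M]

theorem differentiableAt_comp_extChartAt_symm {h : M → ℝ} {p q : M}
    (hq : q ∈ (extChartAt (𝓡 n) p).source) (hh : MDifferentiableAt (𝓡 n) 𝓘(ℝ, ℝ) h q) :
    DifferentiableAt ℝ (h ∘ (extChartAt (𝓡 n) p).symm) (extChartAt (𝓡 n) p q) := by
  have h1 : MDifferentiableAt 𝓘(ℝ, EuclideanSpace ℝ (Fin n)) (𝓡 n) (extChartAt (𝓡 n) p).symm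
      (extChartAt (𝓡 n) p q) := by
    have := mdifferentiableWithinAt_extChartAt_symm (I := 𝓡 n) ((extChartAt (𝓡 n) p).map_source hq)
    rw [ModelWithCorners.range_eq_univ] at this
    exact mdifferentiableWithinAt_univ.1 this
  refine MDifferentiableAt.differentiableAt (MDifferentiableAt.comp _ ?_ h1)
  rwa [(extChartAt (𝓡 n) p).left_inv hq]

variable (n) in
/-- The differential at `q` of the chart at `p`, with values in the model space. -/
def chartDeriv (p q : M) : TangentSpace (𝓡 n) q →L[ℝ] EuclideanSpace ℝ (Fin n) :=
  mfderiv (𝓡 n) 𝓘(ℝ, EuclideanSpace ℝ (Fin n)) (extChartAt (𝓡 n) p) q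

theorem mvfderiv_eq_fderiv_chart {h : M → ℝ} {p q : M} (hq : q ∈ (extChartAt (𝓡 n) p).source)
    (hh : MDifferentiableAt (𝓡 n) 𝓘(ℝ, ℝ) h q) (v : TangentSpace (𝓡 n) q) :
    mvfderiv (𝓡 n) h q v = fderiv ℝ (h ∘ (extChartAt (𝓡 n) p).symm) (extChartAt (𝓡 n) p q)
      (chartDeriv n p q v) := by
  have hd := differentiableAt_comp_extChartAt_symm hq hh
  have he : h =ᶠ[𝓝 q] (h ∘ (extChartAt (𝓡 n) p).symm) ∘ extChartAt (𝓡 n) p := by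
    filter_upwards [extChartAt_source_mem_nhds' hq] with y hy
    rw [Function.comp_apply, Function.comp_apply, (extChartAt (𝓡 n) p).left_inv hy]
  have h2 : MDifferentiableAt (𝓡 n) 𝓘(ℝ, EuclideanSpace ℝ (Fin n)) (extChartAt (𝓡 n) p) q :=
    mdifferentiableAt_extChartAt (by simpa using hq)
  have h3 := (hd.hasFDerivAt.hasMFDerivAt.comp q h2.hasMFDerivAt).congr_of_eventuallyEq he
  rw [mvfderiv, h3.mfderiv]
  rfl

/-- A bump function cuts off the local extension. The Killing and closedness conditions are stated
for globally smooth fields, so local extensions alone cannot be inserted into them. -/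
theorem exists_smoothVField_eventuallyEq_extend [T2Space M] (p : M) (v : TangentSpace (𝓡 n) p) :
    ∃ X : VField n M, SmoothVField X ∧
      ∀ᶠ q in 𝓝 p, X q = FiberBundle.extend (EuclideanSpace ℝ (Fin n)) v q := by
  let f : SmoothBumpFunction (𝓡 n) p := Classical.arbitrary _
  let t := trivializationAt (EuclideanSpace ℝ (Fin n)) (TangentSpace (𝓡 n)) p
  have hs : ContMDiffOn (𝓡 n) (𝓡 n).tangent ∞
      (T% (FiberBundle.extend (EuclideanSpace ℝ (Fin n)) v)) t.baseSet := by
    intro x hx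
    rw [t.contMDiffWithinAt_section _ hx]
    have : ContMDiffOn (𝓡 n) 𝓘(ℝ, EuclideanSpace ℝ (Fin n)) ∞ (fun _ : M => (t ⟨p, v⟩).2)
      t.baseSet := contMDiffOn_const
    exact this.congr (fun x hx => by
      rw [FiberBundle.extend, Trivialization.apply_mk_symm _ hx]) x hx
  refine ⟨(f : M → ℝ) • FiberBundle.extend (EuclideanSpace ℝ (Fin n)) v, ?_, ?_⟩
  · refine ContMDiffOn.smul_section_of_tsupport f.contMDiff.contMDiffOn t.open_baseSet ?_ hs
    simpa [t] using f.tsupport_subset_chartAt_source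
  · filter_upwards [f.eventuallyEq_one] with q hq
    simp [hq]

theorem chartDeriv_eq_trivializationAt {p q : M}
    (hq : q ∈ (chartAt (EuclideanSpace ℝ (Fin n)) p).source) :
    chartDeriv n p q = (trivializationAt (EuclideanSpace ℝ (Fin n))
      (TangentSpace (𝓡 n)) p).continuousLinearMapAt ℝ q :=
  (TangentBundle.continuousLinearMapAt_trivializationAt hq).symm

/-- The extension is constant in the trivialization at `p`, which is the derivative of the chart at
`p`, and that derivative is the identity at `p` itself. -/
theorem chartDeriv_extend {p q : M} (hq : q ∈ (chartAt (EuclideanSpace ℝ (Fin n)) p).source)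
    (v : TangentSpace (𝓡 n) p) :
    chartDeriv n p q (FiberBundle.extend (EuclideanSpace ℝ (Fin n)) v q)
      = (v : EuclideanSpace ℝ (Fin n)) := by
  have hb : q ∈ (trivializationAt (EuclideanSpace ℝ (Fin n)) (TangentSpace (𝓡 n)) p).baseSet := by
    simpa using hq
  have hp := FiberBundle.mem_baseSet_trivializationAt' (F := EuclideanSpace ℝ (Fin n))
    (E := (TangentSpace (𝓡 n) : M → Type)) p
  have h2 : chartDeriv n p p = ContinuousLinearMap.id ℝ _ := mfderiv_extChartAt_self
  rw [chartDeriv_eq_trivializationAt hq, FiberBundle.extend,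
    ← Trivialization.symmL_apply (R := ℝ) _ hb, Trivialization.continuousLinearMapAt_symmL _ hb]
  have h3 := congrArg (fun L => L v) h2
  refine Eq.trans ?_ h3
  simp only [chartDeriv_eq_trivializationAt (mem_chart_source _ p),
    Trivialization.continuousLinearMapAt_apply]
  rw [Trivialization.linearMapAt_apply, if_pos hp]

/-- The vector field near `p` with constant coefficients in the chart at `p`. -/
theorem exists_smoothVField_chartDeriv_eq [T2Space M] (p : M) (w : EuclideanSpace ℝ (Fin n)) :
    ∃ X : VField n M, SmoothVField X ∧ ∀ᶠ q in 𝓝 p, chartDeriv n p q (X q) = w := by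
  obtain ⟨X, hX, h⟩ := exists_smoothVField_eventuallyEq_extend p (w : TangentSpace (𝓡 n) p)
  refine ⟨X, hX, ?_⟩
  filter_upwards [h, (chartAt (EuclideanSpace ℝ (Fin n)) p).open_source.mem_nhds
    (mem_chart_source _ p)] with q hq hs
  rw [hq]
  exact chartDeriv_extend hs _

theorem chartDeriv_injective {p q : M} (hq : q ∈ (chartAt (EuclideanSpace ℝ (Fin n)) p).source) :
    Function.Injective (chartDeriv n p q) := by
  have hb : q ∈ (trivializationAt (EuclideanSpace ℝ (Fin n)) (TangentSpace (𝓡 n)) p).baseSet := by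
    simpa using hq
  rw [chartDeriv_eq_trivializationAt hq]
  exact Function.LeftInverse.injective
    (fun v => Trivialization.symmL_continuousLinearMapAt _ hb v)

end
end Superint
end
-- Coordinate frames and linear first-order systems
noncomputable section
namespace Superint

section
variable {n : ℕ} {M : Type*} [TopologicalSpace M] [ChartedSpace (EuclideanSpace ℝ (Fin n)) M]
  [IsManifold (𝓡 n) ∞ M]

theorem exists_coordinate_frame [T2Space M] (p : M) :
    ∃ Y : Fin n → VField n M, (∀ i, SmoothVField (Y i)) ∧
      ∀ᶠ q in 𝓝 p, ∀ i, chartDeriv n p q (Y i q) = EuclideanSpace.single i (1 : ℝ) := by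
  choose Y hY h using fun i : Fin n =>
    exists_smoothVField_chartDeriv_eq p (EuclideanSpace.single i (1 : ℝ))
  exact ⟨Y, hY, Filter.eventually_all.2 h⟩

theorem eq_sum_of_chartDeriv {p q : M} (hq : q ∈ (chartAt (EuclideanSpace ℝ (Fin n)) p).source)
    {Y : Fin n → TangentSpace (𝓡 n) q}
    (hY : ∀ i, chartDeriv n p q (Y i) = EuclideanSpace.single i (1 : ℝ))
    (v : TangentSpace (𝓡 n) q) : v = ∑ i, (chartDeriv n p q v) i • Y i := by
  apply chartDeriv_injective hq
  rw [map_sum]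
  ext j
  simp [hY, Pi.single_apply]

theorem mvfderiv_coordinate {h : M → ℝ} {p q : M}
    (hq : q ∈ (chartAt (EuclideanSpace ℝ (Fin n)) p).source)
    (hh : MDifferentiableAt (𝓡 n) 𝓘(ℝ, ℝ) h q) {v : TangentSpace (𝓡 n) q}
    {w : EuclideanSpace ℝ (Fin n)} (hv : chartDeriv n p q v = w) :
    mvfderiv (𝓡 n) h q v
      = fderiv ℝ (h ∘ (extChartAt (𝓡 n) p).symm) (extChartAt (𝓡 n) p q) w := by
  rw [← hv, mvfderiv_eq_fderiv_chart (by simpa using hq) hh]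

/-- A neighbourhood of `p` contains the preimage of a ball under the chart at `p`. -/
theorem exists_ball_chart {p : M} {P : M → Prop} (hP : ∀ᶠ q in 𝓝 p, P q) :
    ∃ r > 0, Metric.ball (extChartAt (𝓡 n) p p) r ⊆ (extChartAt (𝓡 n) p).target ∧
      ∀ x ∈ Metric.ball (extChartAt (𝓡 n) p p) r, P ((extChartAt (𝓡 n) p).symm x) := by
  have h1 : ∀ᶠ x in 𝓝 (extChartAt (𝓡 n) p p), x ∈ (extChartAt (𝓡 n) p).target :=
    extChartAt_target_mem_nhds p
  have h2 : ∀ᶠ x in 𝓝 (extChartAt (𝓡 n) p p), P ((extChartAt (𝓡 n) p).symm x) := by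
    have := continuousAt_extChartAt_symm (I := 𝓡 n) p
    rw [ContinuousAt, extChartAt_to_inv] at this
    exact this.eventually hP
  obtain ⟨r, hr, h⟩ := Metric.eventually_nhds_iff_ball.1 (h1.and h2)
  exact ⟨r, hr, fun x hx => (h x hx).1, fun x hx => (h x hx).2⟩

theorem eventually_of_ball_chart {p : M} {r : ℝ} (hr : 0 < r) :
    ∀ᶠ q in 𝓝 p, q ∈ (extChartAt (𝓡 n) p).source ∧
      extChartAt (𝓡 n) p q ∈ Metric.ball (extChartAt (𝓡 n) p p) r := by
  filter_upwards [extChartAt_source_mem_nhds (I := 𝓡 n) p,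
    (continuousAt_extChartAt (I := 𝓡 n) p).eventually (Metric.ball_mem_nhds _ hr)] with q h1 h2
  exact ⟨h1, h2⟩

/-- Solutions of a linear first-order system which vanish at a point vanish nearby. -/
theorem eventually_eq_zero_of_linear_system {m : ℕ} {p : M} {u : Fin m → M → ℝ}
    (hu : ∀ k, ContMDiff (𝓡 n) 𝓘(ℝ, ℝ) ∞ (u k)) {Y : Fin n → VField n M}
    (hY : ∀ᶠ q in 𝓝 p, ∀ i, chartDeriv n p q (Y i q) = EuclideanSpace.single i (1 : ℝ))
    {A : Fin n → Fin m → Fin m → M → ℝ} (hA : ∀ j k l, ContinuousAt (A j k l) p)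
    (h : ∀ᶠ q in 𝓝 p, ∀ j k, mvfderiv (𝓡 n) (u k) q (Y j q) = ∑ l, A j k l q * u l q)
    (h0 : ∀ k, u k p = 0) : ∀ᶠ q in 𝓝 p, ∀ k, u k q = 0 := by
  have hb : ∀ j k l, ∀ᶠ q in 𝓝 p, |A j k l q| ≤ |A j k l p| + 1 := fun j k l => by
    filter_upwards [(hA j k l).abs.eventually (gt_mem_nhds (lt_add_one _))] with q hq using hq.le
  -- One constant bounding every row sum of the coefficients near `p`; being continuous at `p`, each
  -- coefficient stays below its value there plus one.
  set B : ℝ := ∑ j, ∑ k, ∑ l, (|A j k l p| + 1) with hB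
  have hnn : ∀ j k l, 0 ≤ |A j k l p| + 1 := fun j k l => by positivity
  have hle : ∀ j k, ∑ l, (|A j k l p| + 1) ≤ B := fun j k =>
    (Finset.single_le_sum (f := fun k => ∑ l, (|A j k l p| + 1))
      (fun k _ => Finset.sum_nonneg fun l _ => hnn j k l) (Finset.mem_univ k)).trans
    (Finset.single_le_sum (f := fun j => ∑ k, ∑ l, (|A j k l p| + 1))
      (fun j _ => Finset.sum_nonneg fun k _ => Finset.sum_nonneg fun l _ => hnn j k l)
      (Finset.mem_univ j))
  have hB0 : 0 ≤ B := Finset.sum_nonneg fun j _ => Finset.sum_nonneg fun k _ =>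
    Finset.sum_nonneg fun l _ => hnn j k l
  obtain ⟨r, hr, hrt, hrP⟩ := exists_ball_chart (n := n) ((hY.and h).and
    (Filter.eventually_all.2 fun j => Filter.eventually_all.2 fun k =>
      Filter.eventually_all.2 fun l => hb j k l))
  set φ := extChartAt (𝓡 n) p with hφ
  let f : EuclideanSpace ℝ (Fin n) → Fin m → ℝ := fun x k => (u k ∘ φ.symm) x
  have hsrc : ∀ x ∈ Metric.ball (φ p) r, φ.symm x ∈ φ.source := fun x hx => φ.map_target (hrt hx)
  have hmd : ∀ k q, MDifferentiableAt (𝓡 n) 𝓘(ℝ, ℝ) (u k) q := fun k q =>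
    (hu k).mdifferentiable (by simp) q
  have hdk : ∀ x ∈ Metric.ball (φ p) r, ∀ k, DifferentiableAt ℝ (u k ∘ φ.symm) x := by
    intro x hx k
    have := differentiableAt_comp_extChartAt_symm (hsrc x hx) (hmd k _)
    rwa [← hφ, φ.right_inv (hrt hx)] at this
  have hzero : ∀ x ∈ Metric.ball (φ p) r, f x = 0 := by
    intro x hx
    refine eq_zero_of_norm_fderiv_le (C := n * B) (f := f) (r := r) (x₀ := φ p)
      (fun x hx => differentiableAt_pi.2 (hdk x hx)) ?_ ?_ hx
    · intro x hx v
      obtain ⟨⟨hYx, hsys⟩, hbd⟩ := hrP x hx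
      rw [show f = fun x k => (u k ∘ φ.symm) x from rfl, fderiv_pi (hdk x hx), ContinuousLinearMap.coe_pi']
      refine (pi_norm_le_iff_of_nonneg (by positivity)).2 fun k => ?_
      have hv : v = ∑ j, v j • EuclideanSpace.single j (1 : ℝ) := by
        ext j; simp [Pi.single_apply]
      have hj : ∀ j, |fderiv ℝ (u k ∘ φ.symm) x (EuclideanSpace.single j (1 : ℝ))|
          ≤ B * ‖f x‖ := by
        intro j
        have h1 := mvfderiv_coordinate (by simpa [φ] using hsrc x hx) (hmd k _) (hYx j)
        rw [← hφ, φ.right_inv (hrt hx)] at h1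
        rw [← h1, hsys j k]
        calc |∑ l, A j k l (φ.symm x) * u l (φ.symm x)|
            ≤ ∑ l, |A j k l (φ.symm x) * u l (φ.symm x)| := Finset.abs_sum_le_sum_abs _ _
          _ ≤ ∑ l, (|A j k l p| + 1) * ‖f x‖ := by
              refine Finset.sum_le_sum fun l _ => ?_
              rw [abs_mul]
              exact mul_le_mul (hbd j k l) (norm_le_pi_norm (f x) l) (abs_nonneg _) (hnn j k l)
          _ ≤ B * ‖f x‖ := by
              rw [← Finset.sum_mul]
              exact mul_le_mul_of_nonneg_right (hle j k) (norm_nonneg _)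
      calc ‖fderiv ℝ (u k ∘ φ.symm) x v‖
          = |∑ j, v j * fderiv ℝ (u k ∘ φ.symm) x (EuclideanSpace.single j (1 : ℝ))| := by
            conv_lhs => rw [hv]
            simp only [map_sum, map_smul, smul_eq_mul, Real.norm_eq_abs]
        _ ≤ ∑ j : Fin n, ‖v‖ * (B * ‖f x‖) := by
            refine (Finset.abs_sum_le_sum_abs _ _).trans (Finset.sum_le_sum fun j _ => ?_)
            rw [abs_mul]
            exact mul_le_mul (PiLp.norm_apply_le v j) (hj j) (abs_nonneg _) (norm_nonneg _)
        _ = n * B * ‖v‖ * ‖f x‖ := by simp; ring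
    · ext k
      simp only [f, Function.comp_apply]
      rw [hφ, extChartAt_to_inv]
      exact h0 k
  filter_upwards [eventually_of_ball_chart (n := n) (p := p) hr] with q hq k
  have := congrFun (hzero _ hq.2) k
  simp only [f, φ, Function.comp_apply, (extChartAt (𝓡 n) p).left_inv hq.1] at this
  exact this

end
end Superint
end
-- Smooth vector fields, Gram matrices and the Hessian
noncomputable section
namespace Superint

section
variable {n : ℕ} {M : Type*} [TopologicalSpace M] [ChartedSpace (EuclideanSpace ℝ (Fin n)) M]
  [IsManifold (𝓡 n) ∞ M]

theorem SmoothVField.mdiffAt {X : Π x : M, TangentSpace (𝓡 n) x} (hX : SmoothVField X) (x : M) :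
    MDifferentiableAt (𝓡 n) (𝓡 n).tangent (T% X) x :=
  ContMDiff.mdifferentiable hX (by simp) x

theorem smooth_mvfderiv_apply {V : M → ℝ} (hV : ContMDiff (𝓡 n) 𝓘(ℝ, ℝ) ∞ V) {Y : VField n M}
    (hY : SmoothVField Y) :
    ContMDiff (𝓡 n) 𝓘(ℝ, ℝ) ∞ (fun x => mvfderiv (𝓡 n) V x (Y x)) := by
  have h1 := hV.contMDiff_tangentMap (m := ∞) (by simp)
  exact (contMDiff_snd_tangentBundle_modelSpace ℝ 𝓘(ℝ, ℝ)).comp (h1.comp hY)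

theorem contMDiffAt_chartDeriv_apply {Z : VField n M} (hZ : SmoothVField Z) (p : M) (i : Fin n) :
    ContMDiffAt (𝓡 n) 𝓘(ℝ, ℝ) ∞ (fun q => chartDeriv n p q (Z q) i) p := by
  have h := (contMDiffAt_section (IB := 𝓡 n) (F := EuclideanSpace ℝ (Fin n)) (s := Z) p).1 hZ.contMDiffAt
  have h2 : ContMDiffAt (𝓡 n) 𝓘(ℝ, EuclideanSpace ℝ (Fin n)) ∞
      (fun q => chartDeriv n p q (Z q)) p := by
    refine h.congr_of_eventuallyEq ?_
    filter_upwards [(chartAt (EuclideanSpace ℝ (Fin n)) p).open_source.mem_nhds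
      (mem_chart_source _ p)] with q hq
    have hb : q ∈ (trivializationAt (EuclideanSpace ℝ (Fin n)) (TangentSpace (𝓡 n)) p).baseSet := by
      simpa using hq
    rw [chartDeriv_eq_trivializationAt hq, Trivialization.continuousLinearMapAt_apply,
      Trivialization.linearMapAt_apply, if_pos hb]
  exact (EuclideanSpace.proj (𝕜 := ℝ) i).contDiff.contMDiff.contMDiffAt.comp p h2

theorem SmoothVField.smul {f : M → ℝ} (hf : ContMDiff (𝓡 n) 𝓘(ℝ, ℝ) ∞ f) {X : VField n M}
    (hX : SmoothVField X) : SmoothVField (fun x => f x • X x) :=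
  ContMDiff.smul_section hf hX

theorem SmoothVField.const_smul (a : ℝ) {X : VField n M}
    (hX : SmoothVField X) : SmoothVField (fun x => a • X x) :=
  ContMDiff.const_smul_section hX

theorem SmoothVField.add {X Y : VField n M} (hX : SmoothVField X) (hY : SmoothVField Y) :
    SmoothVField (fun x => X x + Y x) :=
  ContMDiff.add_section hX hY

theorem SmoothVField.sum {ι : Type*} {s : Finset ι} {X : ι → VField n M}
    (hX : ∀ i, SmoothVField (X i)) : SmoothVField (fun x => ∑ i ∈ s, X i x) :=
  ContMDiff.sum_section fun i _ => hX i

theorem exists_smoothVField_eq [T2Space M] (p : M) (v : TangentSpace (𝓡 n) p) :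
    ∃ X : VField n M, SmoothVField X ∧ X p = v := by
  obtain ⟨X, hX, h⟩ := exists_smoothVField_eventuallyEq_extend p v
  exact ⟨X, hX, by simpa using h.self_of_nhds⟩

variable [RiemannianBundle (fun x : M => TangentSpace (𝓡 n) x)]
  [IsContMDiffRiemannianBundle (𝓡 n) ∞ (EuclideanSpace ℝ (Fin n))
  (fun x : M => TangentSpace (𝓡 n) x)]

theorem SmoothVField.contMDiff_inner {X Y : VField n M} (hX : SmoothVField X) (hY : SmoothVField Y) :
    ContMDiff (𝓡 n) 𝓘(ℝ, ℝ) ∞ (fun x => inner ℝ (X x) (Y x)) :=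
  ContMDiff.inner_bundle (E := fun x : M => TangentSpace (𝓡 n) x) hX hY

theorem gram_det_ne_zero {m : ℕ} {x : M} {Y : Fin m → TangentSpace (𝓡 n) x}
    (hY : LinearIndependent ℝ Y) :
    (Matrix.of fun i j => inner ℝ (Y i) (Y j) : Matrix (Fin m) (Fin m) ℝ).det ≠ 0 := by
  intro h
  obtain ⟨c, hc, hcm⟩ := Matrix.exists_mulVec_eq_zero_iff.2 h
  -- A vector in the kernel of the Gram matrix gives a combination of the `Y j` that is orthogonal
  -- to itself.
  have h1 : ∑ j, c j • Y j = 0 := by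
    rw [← inner_self_eq_zero (𝕜 := ℝ)]
    conv_lhs => rw [sum_inner]
    refine Finset.sum_eq_zero fun i _ => ?_
    have := congrFun hcm i
    simp only [Matrix.mulVec, dotProduct, Matrix.of_apply, Pi.zero_apply] at this
    rw [real_inner_smul_left, inner_sum]
    simp only [real_inner_smul_right]
    rw [show ∑ j, c j * inner ℝ (Y i) (Y j) = ∑ j, inner ℝ (Y i) (Y j) * c j from
      Finset.sum_congr rfl fun j _ => mul_comm _ _, this, mul_zero]
  exact hc (funext (Fintype.linearIndependent_iff.1 hY c h1))

/-- The coefficients of `v` in a basis, from the inverse of the Gram matrix. -/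
theorem eq_sum_gram_inv {m : ℕ} {x : M} {Y : Fin m → TangentSpace (𝓡 n) x}
    (hY : LinearIndependent ℝ Y) {v : TangentSpace (𝓡 n) x} (hv : v ∈ Submodule.span ℝ (Set.range Y)) :
    v = ∑ k, (∑ l, (Matrix.of fun i j => inner ℝ (Y i) (Y j) : Matrix (Fin m) (Fin m) ℝ)⁻¹ k l
      * inner ℝ v (Y l)) • Y k := by
  obtain ⟨c, rfl⟩ := (Submodule.mem_span_range_iff_exists_fun ℝ).1 hv
  set G := (Matrix.of fun i j => inner ℝ (Y i) (Y j) : Matrix (Fin m) (Fin m) ℝ) with hG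
  refine Finset.sum_congr rfl fun k _ => ?_
  congr 1
  have h1 : G⁻¹ * G = 1 := Matrix.nonsing_inv_mul _ (Ne.isUnit (gram_det_ne_zero hY))
  have h2 : ∀ l, inner ℝ (∑ i, c i • Y i) (Y l) = (G.mulVec c) l := by
    intro l
    simp only [Matrix.mulVec, dotProduct, hG, Matrix.of_apply, sum_inner, real_inner_smul_left]
    exact Finset.sum_congr rfl fun i _ => by rw [real_inner_comm, mul_comm]
  simp only [h2]
  change c k = (G⁻¹.mulVec (G.mulVec c)) k
  rw [Matrix.mulVec_mulVec, h1, Matrix.one_mulVec]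

theorem linearIndependent_of_chartDeriv {p q : M} {Y : Fin n → TangentSpace (𝓡 n) q}
    (hY : ∀ i, chartDeriv n p q (Y i) = EuclideanSpace.single i (1 : ℝ)) :
    LinearIndependent ℝ Y := by
  refine LinearIndependent.of_comp (chartDeriv n p q).toLinearMap ?_
  have := (EuclideanSpace.basisFun (Fin n) ℝ).toBasis.linearIndependent
  convert! this using 1
  ext i : 1
  simp [hY]

/-- A vector field is smooth if its inner products with smooth vector fields are. -/
theorem smoothVField_of_inner [T2Space M] {Z : VField n M}
    (h : ∀ Y : VField n M, SmoothVField Y →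
      ContMDiff (𝓡 n) 𝓘(ℝ, ℝ) ∞ (fun x => inner ℝ (Z x) (Y x))) : SmoothVField Z := by
  intro p
  obtain ⟨Y, hY, hYp⟩ := exists_coordinate_frame (n := n) p
  let G : M → Matrix (Fin n) (Fin n) ℝ := fun q => Matrix.of fun i j => inner ℝ (Y i q) (Y j q)
  have hG : ∀ i j, ContMDiffAt (𝓡 n) 𝓘(ℝ, ℝ) ∞ (fun y => G y i j) p := fun i j =>
    ((hY i).contMDiff_inner (hY j)).contMDiffAt
  have hdet : (G p).det ≠ 0 :=
    gram_det_ne_zero (linearIndependent_of_chartDeriv hYp.self_of_nhds)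
  have hs : ContMDiffAt (𝓡 n) (𝓡 n).tangent ∞
      (T% (fun q => ∑ k, (∑ l, (G q)⁻¹ k l * inner ℝ (Z q) (Y l q)) • Y k q)) p := by
    refine ContMDiffAt.sum_section (s := Finset.univ)
      (t := fun k q => (∑ l, (G q)⁻¹ k l * inner ℝ (Z q) (Y l q)) • Y k q) fun k _ => ?_
    refine ContMDiffAt.smul_section (f := fun q => ∑ l, (G q)⁻¹ k l * inner ℝ (Z q) (Y l q))
      ?_ (hY k).contMDiffAt
    exact ContMDiffAt.sum fun l _ => (contMDiffAt_matrix_inv hG hdet k l).mul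
      (h _ (hY l)).contMDiffAt
  refine hs.congr_of_eventuallyEq ?_
  filter_upwards [hYp, (chartAt (EuclideanSpace ℝ (Fin n)) p).open_source.mem_nhds
      (mem_chart_source _ p)] with q hq hqs
  have := eq_sum_gram_inv (linearIndependent_of_chartDeriv hq) (v := Z q) (by
    rw [eq_sum_of_chartDeriv hqs hq (Z q)]
    exact Submodule.sum_mem _ fun i _ => Submodule.smul_mem _ _ (Submodule.subset_span ⟨i, rfl⟩))
  rw [TotalSpace.mk_inj]
  exact this

/-- The gradient. -/
def grad (V : M → ℝ) : VField n M := fun x => sharp x (mvfderiv (𝓡 n) V x)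

theorem inner_grad (V : M → ℝ) (x : M) (v : TangentSpace (𝓡 n) x) :
    inner ℝ (grad V x) v = mvfderiv (𝓡 n) V x v := inner_sharp ..

theorem smoothVField_grad [T2Space M] {V : M → ℝ} (hV : ContMDiff (𝓡 n) 𝓘(ℝ, ℝ) ∞ V) :
    SmoothVField (grad (n := n) V) :=
  smoothVField_of_inner fun Y hY => by
    simp only [inner_grad]
    exact smooth_mvfderiv_apply hV hY

theorem SmoothVField.bracket {X Y : VField n M} (hX : SmoothVField X) (hY : SmoothVField Y) :
    SmoothVField (mlieBracket (𝓡 n) X Y) := fun x => by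
  have : IsManifold (𝓡 n) (minSmoothness ℝ 2) M := by
    rw [minSmoothness_of_isRCLikeNormedField]
    infer_instance
  have : IsManifold (𝓡 n) ((⊤ : ℕ∞) + 1) M := by simpa
  exact ContMDiffAt.mlieBracket_vectorField (m := ⊤) (n := ⊤) hX.contMDiffAt hY.contMDiffAt (by simp)

theorem SmoothVField.leviCivita_apply [T2Space M] {X Y : VField n M} (hX : SmoothVField X)
    (hY : SmoothVField Y) : SmoothVField (fun x => leviCivita (𝓡 n) M Y x (X x)) := by
  refine smoothVField_of_inner fun Z hZ => ?_
  have : (fun x => inner ℝ (Superint.leviCivita (𝓡 n) M Y x (X x)) (Z x)) = koszul X Y Z := by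
    ext x
    exact inner_leviCivita (hX.mdiffAt x) (hY.mdiffAt x) (hZ.mdiffAt x)
  rw [this]
  unfold koszul
  exact contMDiff_const.mul ((((((smooth_mvfderiv_apply (hY.contMDiff_inner hZ) hX).add
    (smooth_mvfderiv_apply (hX.contMDiff_inner hZ) hY)).sub (smooth_mvfderiv_apply (hX.contMDiff_inner hY) hZ)).add
    ((hX.bracket hY).contMDiff_inner hZ)).sub ((hX.bracket hZ).contMDiff_inner hY)).sub
    ((hY.bracket hZ).contMDiff_inner hX))

theorem mdiffAt_mvfderiv_apply [T2Space M] {V : M → ℝ} (hV : ContMDiff (𝓡 n) 𝓘(ℝ, ℝ) ∞ V)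
    {Y : Π x : M, TangentSpace (𝓡 n) x} {x : M} (hY : MDifferentiableAt (𝓡 n) (𝓡 n).tangent (T% Y) x) :
    MDifferentiableAt (𝓡 n) 𝓘(ℝ, ℝ) (fun y => mvfderiv (𝓡 n) V y (Y y)) x := by
  have := mdiffAt_inner ((smoothVField_grad hV).mdiffAt x) hY
  simpa only [inner_grad] using this

/-- The Hessian is defined through one particular extension of `v`. The right-hand side is tensorial
in `Y`, the derivative terms of the two Leibniz rules cancelling, so any field differentiable at `x`
may be used. -/
theorem hessian_apply [T2Space M] {V : M → ℝ} (hV : ContMDiff (𝓡 n) 𝓘(ℝ, ℝ) ∞ V)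
    {Y : Π x : M, TangentSpace (𝓡 n) x} {x : M} (hY : MDifferentiableAt (𝓡 n) (𝓡 n).tangent (T% Y) x) (u : TangentSpace (𝓡 n) x) :
    hessian V x u (Y x) = mvfderiv (𝓡 n) (fun y => mvfderiv (𝓡 n) V y (Y y)) x u
      - mvfderiv (𝓡 n) V x (leviCivita (𝓡 n) M Y x u) := by
  have ht : TensorialAt (𝓡 n) (EuclideanSpace ℝ (Fin n)) (fun Y : VField n M =>
      mvfderiv (𝓡 n) (fun y => mvfderiv (𝓡 n) V y (Y y)) x u
      - mvfderiv (𝓡 n) V x (leviCivita (𝓡 n) M Y x u)) x :=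
    { smul := by
        intro f Z hf hZ
        have h1 := (leviCivita (𝓡 n) M).isCovariantDerivativeOnUniv.leibniz hZ hf (Set.mem_univ x)
        have h2 := mvfderiv_fun_mul hf (mdiffAt_mvfderiv_apply hV hZ)
        have e1 : (fun y => mvfderiv (𝓡 n) V y ((f • Z) y))
            = fun y => f y * mvfderiv (𝓡 n) V y (Z y) := by
          ext y; simp
        have e2 := congrArg (fun L => L u) h1
        rw [e1, h2]
        refine (congrArg (fun w => _ - mvfderiv (𝓡 n) V x w) e2).trans ?_
        simp
        ring
      add := by
        intro Z W hZ hW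
        have h1 := (leviCivita (𝓡 n) M).isCovariantDerivativeOnUniv.add hZ hW (Set.mem_univ x)
        have h2 := mvfderiv_fun_add (mdiffAt_mvfderiv_apply hV hZ) (mdiffAt_mvfderiv_apply hV hW)
        have e1 : (fun y => mvfderiv (𝓡 n) V y ((Z + W) y))
            = fun y => mvfderiv (𝓡 n) V y (Z y) + mvfderiv (𝓡 n) V y (W y) := by
          ext y; simp
        have e2 := congrArg (fun L => L u) h1
        rw [e1, h2]
        refine (congrArg (fun w => _ - mvfderiv (𝓡 n) V x w) e2).trans ?_
        simp
        ring }
  exact ht.pointwise (FiberBundle.mdifferentiableAt_extend ..) hY (by simp)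

end
end Superint
end
-- Unique continuation
noncomputable section
namespace Superint

section
variable {n : ℕ} {M : Type*} [TopologicalSpace M] [ChartedSpace (EuclideanSpace ℝ (Fin n)) M]
  [IsManifold (𝓡 n) ∞ M]

theorem _root_.ContMDiff.mdiffAt_real {h : M → ℝ} (hh : ContMDiff (𝓡 n) 𝓘(ℝ, ℝ) ∞ h) (x : M) :
    MDifferentiableAt (𝓡 n) 𝓘(ℝ, ℝ) h x :=
  hh.mdifferentiable (by simp) x

theorem eventually_mem_chart_source (p : M) :
    ∀ᶠ q in 𝓝 p, q ∈ (chartAt (EuclideanSpace ℝ (Fin n)) p).source :=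
  (chartAt (EuclideanSpace ℝ (Fin n)) p).open_source.mem_nhds (mem_chart_source _ p)

/-- The zero set is closed by continuity and open by uniqueness for the linear system with the
single unknown `φ`. -/
theorem eq_zero_of_mvfderiv_eq_mul [T2Space M] [PreconnectedSpace M] {φ : M → ℝ}
    (hφ : ContMDiff (𝓡 n) 𝓘(ℝ, ℝ) ∞ φ) {β : OneForm n M}
    (hβ : ∀ Y : VField n M, SmoothVField Y → Continuous fun x => β x (Y x))
    (h : ∀ (x : M) (v : TangentSpace (𝓡 n) x), mvfderiv (𝓡 n) φ x v = β x v * φ x)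
    {p : M} (hp : φ p = 0) (q : M) : φ q = 0 := by
  have ho : IsOpen {q | φ q = 0} := by
    refine isOpen_iff_mem_nhds.2 fun x hx => ?_
    obtain ⟨Y, hY, hYx⟩ := exists_coordinate_frame (n := n) x
    have := eventually_eq_zero_of_linear_system (n := n) (m := 1) (p := x) (u := fun _ => φ)
      (fun _ => hφ) hYx (A := fun j _ _ q => β q (Y j q))
      (fun j _ _ => (hβ _ (hY j)).continuousAt)
      (Filter.Eventually.of_forall fun y j k => by simpa using h y (Y j y)) (fun _ => hx)
    filter_upwards [this] with y hy using hy 0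
  have hc : IsClosed {q | φ q = 0} := isClosed_eq hφ.continuous continuous_const
  have := IsClopen.eq_univ ⟨hc, ho⟩ ⟨p, hp⟩
  exact Set.eq_univ_iff_forall.1 this q

theorem eq_of_mvfderiv_eq_zero [T2Space M] [PreconnectedSpace M] {φ : M → ℝ}
    (hφ : ContMDiff (𝓡 n) 𝓘(ℝ, ℝ) ∞ φ) (h : ∀ x : M, mvfderiv (𝓡 n) φ x = 0) (p q : M) :
    φ q = φ p := by
  have := eq_zero_of_mvfderiv_eq_mul (φ := fun x => φ x - φ p) (hφ.sub contMDiff_const) (β := 0)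
    (fun Y hY => by simpa using continuous_const) (fun x v => by
      rw [mvfderiv_fun_sub (hφ.mdiffAt_real x) mdifferentiableAt_const, h x, mvfderiv_const]
      simp) (p := p) (by simp) q
  linarith

variable [RiemannianBundle (fun x : M => TangentSpace (𝓡 n) x)]
  [IsContMDiffRiemannianBundle (𝓡 n) ∞ (EuclideanSpace ℝ (Fin n))
  (fun x : M => TangentSpace (𝓡 n) x)]

/-- A function whose Hessian is linear in its differential is constant once its differential
vanishes at a point. -/
theorem mvfderiv_eq_zero_of_hessian_eq [T2Space M] [PreconnectedSpace M] {V : M → ℝ}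
    (hV : ContMDiff (𝓡 n) 𝓘(ℝ, ℝ) ∞ V) {D : BilinField n M}
    (hD : ∀ X Y : VField n M, SmoothVField X → SmoothVField Y →
      SmoothVField (fun x => D x (X x) (Y x)))
    (h : ∀ (x : M) (u v : TangentSpace (𝓡 n) x), hessian V x u v = mvfderiv (𝓡 n) V x (D x u v))
    {p : M} (hp : mvfderiv (𝓡 n) V p = 0) (q : M) : mvfderiv (𝓡 n) V q = 0 := by
  have ho : IsOpen {q | mvfderiv (𝓡 n) V q = 0} := by
    refine isOpen_iff_mem_nhds.2 fun x hx => ?_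
    obtain ⟨Y, hY, hYx⟩ := exists_coordinate_frame (n := n) x
    -- The hypothesis on the Hessian becomes `Yⱼ(dV(Yₖ)) = dV(Zⱼₖ)`; expanding `Zⱼₖ` in the frame
    -- `Y` gives a linear system for the components of `dV`.
    let Z : Fin n → Fin n → VField n M := fun j k y =>
      D y (Y j y) (Y k y) + leviCivita (𝓡 n) M (Y k) y (Y j y)
    have hZ : ∀ j k, SmoothVField (Z j k) := fun j k =>
      (hD _ _ (hY j) (hY k)).add ((hY j).leviCivita_apply (hY k))
    have hsys : ∀ᶠ y in 𝓝 x, ∀ j k, mvfderiv (𝓡 n) (fun y => mvfderiv (𝓡 n) V y (Y k y)) y (Y j y)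
        = ∑ l, chartDeriv n x y (Z j k y) l * mvfderiv (𝓡 n) V y (Y l y) := by
      filter_upwards [hYx, eventually_mem_chart_source (n := n) x] with y hy hys j k
      have h1 := hessian_apply hV ((hY k).mdiffAt y) (Y j y)
      rw [h] at h1
      have h2 := congrArg (mvfderiv (𝓡 n) V y) (eq_sum_of_chartDeriv hys hy (Z j k y))
      rw [map_sum] at h2
      simp only [map_smul, smul_eq_mul] at h2
      rw [← h2]
      simp only [Z, map_add]
      linarith
    have := eventually_eq_zero_of_linear_system (n := n) (m := n) (p := x)
      (u := fun k y => mvfderiv (𝓡 n) V y (Y k y)) (fun k => smooth_mvfderiv_apply hV (hY k)) hYx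
      (A := fun j k l y => chartDeriv n x y (Z j k y) l)
      (fun j k l => (contMDiffAt_chartDeriv_apply (hZ j k) x l).continuousAt) hsys
      (fun k => by
        have hx' : mvfderiv (𝓡 n) V x = 0 := hx
        rw [hx']; rfl)
    filter_upwards [this, hYx, eventually_mem_chart_source (n := n) x] with y hy hyY hys
    ext v
    rw [eq_sum_of_chartDeriv hys hyY v, map_sum]
    simp [hy]
  have hc : IsOpen {q | mvfderiv (𝓡 n) V q = 0}ᶜ := by
    refine isOpen_iff_mem_nhds.2 fun x hx => ?_
    have hx' : mvfderiv (𝓡 n) V x ≠ 0 := hx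
    obtain ⟨v, hv⟩ : ∃ v, mvfderiv (𝓡 n) V x v ≠ 0 := by
      by_contra! hcon
      exact hx' (ContinuousLinearMap.ext hcon)
    obtain ⟨Y, hY, rfl⟩ := exists_smoothVField_eq x v
    filter_upwards [(smooth_mvfderiv_apply hV hY).continuous.continuousAt.eventually_ne hv]
      with y hy h0
    have h0' : mvfderiv (𝓡 n) V y = 0 := h0
    exact hy (by rw [h0']; rfl)
  have := IsClopen.eq_univ ⟨isOpen_compl_iff.1 hc, ho⟩ ⟨p, hp⟩
  exact Set.eq_univ_iff_forall.1 this q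

end
end Superint
end
noncomputable section
namespace Superint

/-! ### Gluing local primitives on a simply connected space -/

/-- The real numbers with the discrete topology. -/
@[ext]
structure DiscreteReal where
  /-- The underlying real number. -/
  val : ℝ

instance : TopologicalSpace DiscreteReal := ⊥

instance : DiscreteTopology DiscreteReal := ⟨rfl⟩

/-- The covering space of germs `h p + c`, given functions `h p` on open sets `U p` whose
differences are locally constant. -/
def germBundleCore {X : Type*} [TopologicalSpace X] (U : X → Set X) (hU : ∀ p, IsOpen (U p))
    (hmem : ∀ p, p ∈ U p) (h : X → X → ℝ)
    (hloc : ∀ p p' x, x ∈ U p → x ∈ U p' → ∀ᶠ y in 𝓝 x, h p y - h p' y = h p x - h p' x) :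
    FiberBundleCore X X DiscreteReal where
  baseSet := U
  isOpen_baseSet := hU
  indexAt := id
  mem_baseSet_at := hmem
  coordChange p p' x c := ⟨c.val + (h p x - h p' x)⟩
  coordChange_self p x _ c := by
    ext
    simp
  continuousOn_coordChange p p' := by
    rintro ⟨x, c⟩ ⟨⟨hx, hx'⟩, -⟩
    refine ContinuousAt.continuousWithinAt ?_
    refine (continuousAt_const (y := DiscreteReal.mk (c.val + (h p x - h p' x)))).congr ?_
    have h1 : ∀ᶠ z : X × DiscreteReal in 𝓝 (x, c), h p z.1 - h p' z.1 = h p x - h p' x :=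
      (hloc p p' x hx hx').prod_inl_nhds c
    have h2 : ∀ᶠ z : X × DiscreteReal in 𝓝 (x, c), z.2 = c :=
      by
      have : ∀ᶠ d : DiscreteReal in 𝓝 c, d = c := (isOpen_discrete {c}).mem_nhds rfl
      exact this.prod_inr_nhds x
    filter_upwards [h1, h2] with z hz1 hz2
    rw [hz1, hz2]
  coordChange_comp p p' p'' x _ c := by
    ext
    simp only
    ring

/-- The germs of the functions `h p + c` form a covering space of `X`. Over a simply connected base
it has a continuous section, and this section is the global function. -/
theorem exists_global_of_local {X : Type*} [TopologicalSpace X] [SimplyConnectedSpace X]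
    [LocallyPathConnectedSpace X] (U : X → Set X) (hU : ∀ p, IsOpen (U p))
    (hmem : ∀ p, p ∈ U p) (h : X → X → ℝ)
    (hloc : ∀ p p' x, x ∈ U p → x ∈ U p' → ∀ᶠ y in 𝓝 x, h p y - h p' y = h p x - h p' x) :
    ∃ H : X → ℝ, ∀ p x, x ∈ U p → ∀ᶠ y in 𝓝 x, H y - h p y = H x - h p x := by
  let Z := germBundleCore U hU hmem h hloc
  have hcov : IsCoveringMap (π DiscreteReal Z.Fiber) := FiberBundle.isCoveringMap
  obtain ⟨x₀⟩ : Nonempty X := inferInstance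
  -- The section is the lift of the identity map; its fibre coordinate at `x` is the constant to be
  -- added to `h x x`.
  obtain ⟨F, ⟨-, hF⟩, -⟩ := hcov.existsUnique_continuousMap_lifts (ContinuousMap.id X) x₀
    (⟨x₀, (⟨0⟩ : DiscreteReal)⟩ : TotalSpace DiscreteReal Z.Fiber) rfl
  have hproj : ∀ x, (F x).proj = x := fun x => congrFun hF x
  let s : X → ℝ := fun x => DiscreteReal.val (F x).snd
  refine ⟨fun x => s x + h x x, fun p x hx => ?_⟩
  have h1 : ContinuousAt (fun y => (Z.localTriv p (F y)).2) x := by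
    have hsrc : F x ∈ (Z.localTriv p).source := by
      rw [Z.mem_localTriv_source, hproj]
      exact hx
    exact continuousAt_snd.comp (((Z.localTriv p).continuousAt hsrc).comp F.continuous.continuousAt)
  have h2 : ∀ᶠ y in 𝓝 x, (Z.localTriv p (F y)).2 = (Z.localTriv p (F x)).2 :=
    h1.eventually ((isOpen_discrete {(Z.localTriv p (F x)).2}).mem_nhds rfl)
  have h3 : ∀ y, (Z.localTriv p (F y)).2.val = s y + (h y y - h p y) := by
    intro y
    rw [Z.localTriv_apply]
    change s y + (h (F y).proj (F y).proj - h p (F y).proj) = _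
    rw [hproj]
  filter_upwards [h2] with y hy
  have hy' := congrArg DiscreteReal.val hy
  rw [h3, h3] at hy'
  linarith

section
variable {n : ℕ} {M : Type*} [TopologicalSpace M] [ChartedSpace (EuclideanSpace ℝ (Fin n)) M]
  [IsManifold (𝓡 n) ∞ M]

theorem chartDeriv_surjective {p q : M} (hq : q ∈ (chartAt (EuclideanSpace ℝ (Fin n)) p).source) :
    Function.Surjective (chartDeriv n p q) := by
  have hb : q ∈ (trivializationAt (EuclideanSpace ℝ (Fin n)) (TangentSpace (𝓡 n)) p).baseSet := by
    simpa using hq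
  rw [chartDeriv_eq_trivializationAt hq]
  exact fun w => ⟨_, Trivialization.continuousLinearMapAt_symmL _ hb w⟩

theorem eventually_eq_of_mvfderiv_eq_zero {ψ : M → ℝ} {p : M}
    (hψ : ∀ᶠ q in 𝓝 p, MDifferentiableAt (𝓡 n) 𝓘(ℝ, ℝ) ψ q ∧
      ∀ v, mvfderiv (𝓡 n) ψ q v = 0) : ∀ᶠ q in 𝓝 p, ψ q = ψ p := by
  obtain ⟨r, hr, hrt, hrP⟩ := exists_ball_chart (n := n) hψ
  have hsrc : ∀ x ∈ Metric.ball (extChartAt (𝓡 n) p p) r,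
      (extChartAt (𝓡 n) p).symm x ∈ (extChartAt (𝓡 n) p).source :=
    fun x hx => (extChartAt (𝓡 n) p).map_target (hrt hx)
  have hd : ∀ x ∈ Metric.ball (extChartAt (𝓡 n) p p) r,
      DifferentiableAt ℝ (ψ ∘ (extChartAt (𝓡 n) p).symm) x := by
    intro x hx
    have := differentiableAt_comp_extChartAt_symm (hsrc x hx) (hrP x hx).1
    rwa [(extChartAt (𝓡 n) p).right_inv (hrt hx)] at this
  have key : ∀ x ∈ Metric.ball (extChartAt (𝓡 n) p p) r,
      (ψ ∘ (extChartAt (𝓡 n) p).symm) x - ψ p = 0 := by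
    intro x hx
    refine eq_zero_of_norm_fderiv_le (C := 0)
      (f := fun x => (ψ ∘ (extChartAt (𝓡 n) p).symm) x - ψ p)
      (fun x hx => (hd x hx).sub_const _) (fun x hx v => ?_) ?_ hx
    · rw [fderiv_sub_const]
      obtain ⟨w, rfl⟩ := chartDeriv_surjective (n := n) (p := p)
        (q := (extChartAt (𝓡 n) p).symm x)
        (by simpa using hsrc x hx) v
      have := mvfderiv_eq_fderiv_chart (hsrc x hx) (hrP x hx).1 w
      rw [(hrP x hx).2, (extChartAt (𝓡 n) p).right_inv (hrt hx)] at this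
      rw [← this]
      simp
    · simp only [Function.comp_apply, extChartAt_to_inv, sub_self]
  filter_upwards [eventually_of_ball_chart (n := n) (p := p) hr] with q hq
  have := key _ hq.2
  rw [Function.comp_apply, (extChartAt (𝓡 n) p).left_inv hq.1] at this
  linarith

theorem contDiffOn_comp_extChartAt_symm {h : M → ℝ} (hh : ContMDiff (𝓡 n) 𝓘(ℝ, ℝ) ∞ h) (p : M) :
    ContDiffOn ℝ ∞ (h ∘ (extChartAt (𝓡 n) p).symm) (extChartAt (𝓡 n) p).target :=
  (hh.comp_contMDiffOn (contMDiffOn_extChartAt_symm p)).contDiffOn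

/-- The Poincaré lemma for a form `∑ aᵢ dVᵢ` with `daᵢ = ∑ bᵢⱼ dVⱼ`, `bᵢⱼ` symmetric. -/
theorem exists_local_primitive {m : ℕ} {V a : Fin m → M → ℝ}
    (hV : ∀ i, ContMDiff (𝓡 n) 𝓘(ℝ, ℝ) ∞ (V i)) (ha : ∀ i, ContMDiff (𝓡 n) 𝓘(ℝ, ℝ) ∞ (a i))
    {b : M → Fin m → Fin m → ℝ} (hb : ∀ x i j, b x i j = b x j i)
    (hab : ∀ i x (v : TangentSpace (𝓡 n) x),
      mvfderiv (𝓡 n) (a i) x v = ∑ j, b x i j * mvfderiv (𝓡 n) (V j) x v) (p : M) :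
    ∃ U : Set M, IsOpen U ∧ p ∈ U ∧ ∃ h : M → ℝ, ∀ q ∈ U, ContMDiffAt (𝓡 n) 𝓘(ℝ, ℝ) ∞ h q ∧
      ∀ v, mvfderiv (𝓡 n) h q v = ∑ i, a i q * mvfderiv (𝓡 n) (V i) q v := by
  obtain ⟨r, hr, hrt, -⟩ := exists_ball_chart (n := n) (p := p) (P := fun _ => True)
    (Filter.Eventually.of_forall fun _ => trivial)
  set φ := extChartAt (𝓡 n) p with hφ
  set B := Metric.ball (φ p) r with hBdef
  have hBo : IsOpen B := Metric.isOpen_ball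
  have hsrc : ∀ x ∈ B, φ.symm x ∈ φ.source := fun x hx => φ.map_target (hrt hx)
  have hVc : ∀ i, ContDiffOn ℝ ∞ (V i ∘ φ.symm) B := fun i =>
    (contDiffOn_comp_extChartAt_symm (hV i) p).mono hrt
  have hac : ∀ i, ContDiffOn ℝ ∞ (a i ∘ φ.symm) B := fun i =>
    (contDiffOn_comp_extChartAt_symm (ha i) p).mono hrt
  let α : EuclideanSpace ℝ (Fin n) → EuclideanSpace ℝ (Fin n) →L[ℝ] ℝ := fun x =>
    ∑ i, (a i ∘ φ.symm) x • fderiv ℝ (V i ∘ φ.symm) x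
  have hVd : ∀ i, ContDiffOn ℝ ∞ (fderiv ℝ (V i ∘ φ.symm)) B := fun i =>
    ((contDiffOn_infty_iff_fderiv_of_isOpen hBo).1 (hVc i)).2
  have hα : ContDiffOn ℝ ∞ α B := ContDiffOn.sum fun i _ => (hac i).smul (hVd i)
  have hchart : ∀ {h : M → ℝ}, ContMDiff (𝓡 n) 𝓘(ℝ, ℝ) ∞ h → ∀ x ∈ B, ∀ v,
      mvfderiv (𝓡 n) h (φ.symm x) v = fderiv ℝ (h ∘ φ.symm) x (chartDeriv n p (φ.symm x) v) := by
    intro h hh x hx v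
    have := mvfderiv_eq_fderiv_chart (hsrc x hx) (hh.mdiffAt_real _) v
    rwa [← hφ, φ.right_inv (hrt hx)] at this
  have hda : ∀ i, ∀ x ∈ B, ∀ w, fderiv ℝ (a i ∘ φ.symm) x w
      = ∑ j, b (φ.symm x) i j * fderiv ℝ (V j ∘ φ.symm) x w := by
    intro i x hx w
    obtain ⟨v, rfl⟩ := chartDeriv_surjective (n := n) (p := p) (q := φ.symm x)
      (by simpa [φ] using hsrc x hx) w
    simp only [← hchart (ha i) x hx, ← hchart (hV _) x hx, hab]
  have hdiff : ∀ {g : EuclideanSpace ℝ (Fin n) → ℝ}, ContDiffOn ℝ ∞ g B → ∀ x ∈ B,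
      DifferentiableAt ℝ g x := fun hg x hx =>
    (hg.differentiableOn (by simp) x hx).differentiableAt (hBo.mem_nhds hx)
  -- The derivative of `α` is `∑ aᵢ ∇²Vᵢ + ∑ bᵢⱼ dVⱼ ⊗ dVᵢ`. The first sum is symmetric as second
  -- derivatives commute, the second by the symmetry of `b`.
  have hsymm : ∀ x ∈ B, ∀ u v, fderiv ℝ α x u v = fderiv ℝ α x v u := by
    intro x hx u v
    have hder : HasFDerivAt α (∑ i, ((a i ∘ φ.symm) x • fderiv ℝ (fderiv ℝ (V i ∘ φ.symm)) x
        + (fderiv ℝ (a i ∘ φ.symm) x).smulRight (fderiv ℝ (V i ∘ φ.symm) x))) x := by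
      refine HasFDerivAt.fun_sum fun i _ => ?_
      exact (hdiff (hac i) x hx).hasFDerivAt.smul
        (((hVd i).differentiableOn (by simp) x hx).differentiableAt (hBo.mem_nhds hx)).hasFDerivAt
    have hs : ∀ i, fderiv ℝ (fderiv ℝ (V i ∘ φ.symm)) x u v
        = fderiv ℝ (fderiv ℝ (V i ∘ φ.symm)) x v u := fun i =>
      (((hVc i).contDiffAt (hBo.mem_nhds hx)).isSymmSndFDerivAt
        (by rw [minSmoothness_of_isRCLikeNormedField]; exact ENat.LEInfty.out)).eq u v
    rw [hder.fderiv]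
    simp only [sum_apply, add_apply,
      smul_apply, ContinuousLinearMap.smulRight_apply, smul_eq_mul,
      Finset.sum_add_distrib, hs, hda _ x hx]
    congr 1
    simp only [Finset.sum_mul]
    rw [Finset.sum_comm]
    refine Finset.sum_congr rfl fun i _ => Finset.sum_congr rfl fun j _ => ?_
    rw [hb _ j i]
    ring
  obtain ⟨f, hf⟩ := (convex_ball (φ p) r).exists_forall_hasFDerivAt_of_fderiv_symmetric hBo
    (hα.differentiableOn (by simp)) hsymm
  have hfs : ContDiffOn ℝ ∞ f B := by
    rw [contDiffOn_infty_iff_fderiv_of_isOpen hBo]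
    exact ⟨fun x hx => (hf x hx).differentiableAt.differentiableWithinAt,
      hα.congr fun x hx => (hf x hx).fderiv⟩
  refine ⟨φ.source ∩ φ ⁻¹' B, ?_, ⟨mem_extChartAt_source p, Metric.mem_ball_self hr⟩, f ∘ φ, ?_⟩
  · exact (continuousOn_extChartAt p).isOpen_inter_preimage (isOpen_extChartAt_source p) hBo
  · rintro q ⟨hqs, hqB⟩
    have hqc : q ∈ (chartAt (EuclideanSpace ℝ (Fin n)) p).source := by simpa [φ] using hqs
    have hsm : ContMDiffAt (𝓡 n) 𝓘(ℝ, ℝ) ∞ (f ∘ φ) q :=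
      (hfs.contDiffAt (hBo.mem_nhds hqB)).contMDiffAt.comp q (contMDiffAt_extChartAt' hqc)
    refine ⟨hsm, fun v => ?_⟩
    have h1 := mvfderiv_eq_fderiv_chart hqs (hsm.mdifferentiableAt (by simp)) v
    have h2 : (f ∘ φ) ∘ φ.symm =ᶠ[𝓝 (φ q)] f := by
      filter_upwards [hBo.mem_nhds hqB] with x hx
      rw [Function.comp_apply, Function.comp_apply, φ.right_inv (hrt hx)]
    rw [h1, ← hφ, h2.fderiv_eq, (hf _ hqB).fderiv]
    simp only [α, sum_apply, smul_apply, smul_eq_mul,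
      Function.comp_apply]
    refine Finset.sum_congr rfl fun i _ => ?_
    have h3 := hchart (hV i) (φ q) hqB
    rw [φ.left_inv hqs] at h3 ⊢
    rw [h3]

/-- Local primitives have equal differentials where they overlap, so they differ by locally constant
functions and can be glued. -/
theorem exists_primitive [SimplyConnectedSpace M] {m : ℕ} {V a : Fin m → M → ℝ}
    (hV : ∀ i, ContMDiff (𝓡 n) 𝓘(ℝ, ℝ) ∞ (V i)) (ha : ∀ i, ContMDiff (𝓡 n) 𝓘(ℝ, ℝ) ∞ (a i))
    {b : M → Fin m → Fin m → ℝ} (hb : ∀ x i j, b x i j = b x j i)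
    (hab : ∀ i x (v : TangentSpace (𝓡 n) x),
      mvfderiv (𝓡 n) (a i) x v = ∑ j, b x i j * mvfderiv (𝓡 n) (V j) x v) :
    ∃ h : M → ℝ, ContMDiff (𝓡 n) 𝓘(ℝ, ℝ) ∞ h ∧ ∀ x (v : TangentSpace (𝓡 n) x),
      mvfderiv (𝓡 n) h x v = ∑ i, a i x * mvfderiv (𝓡 n) (V i) x v := by
  choose U hU hmem h hh using exists_local_primitive hV ha hb hab
  have hLPC : LocallyPathConnectedSpace M :=
    ChartedSpace.locallyPathConnectedSpace (EuclideanSpace ℝ (Fin n)) M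
  obtain ⟨H, hH⟩ := exists_global_of_local U hU hmem h (by
    intro p p' x hx hx'
    refine eventually_eq_of_mvfderiv_eq_zero (n := n) (ψ := fun y => h p y - h p' y) ?_
    filter_upwards [(hU p).mem_nhds hx, (hU p').mem_nhds hx'] with y hy hy'
    have h1 := (hh p y hy).1.mdifferentiableAt (by simp)
    have h2 := (hh p' y hy').1.mdifferentiableAt (by simp)
    refine ⟨h1.sub h2, fun v => ?_⟩
    rw [mvfderiv_fun_sub h1 h2]
    change mvfderiv (𝓡 n) (h p) y v - mvfderiv (𝓡 n) (h p') y v = 0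
    rw [(hh p y hy).2, (hh p' y hy').2, sub_self])
  have key : ∀ x, H =ᶠ[𝓝 x] fun y => h x y + (H x - h x x) := by
    intro x
    filter_upwards [hH x x (hmem x)] with y hy
    linarith
  refine ⟨H, fun x => ?_, fun x v => ?_⟩
  · exact ((hh x x (hmem x)).1.add contMDiffAt_const).congr_of_eventuallyEq (key x)
  · have h1 := (hh x x (hmem x)).1.mdifferentiableAt (by simp)
    have h2 : mvfderiv (𝓡 n) H x = mvfderiv (𝓡 n) (fun y => h x y + (H x - h x x)) x := by
      rw [mvfderiv, mvfderiv, (key x).mfderiv_eq]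
      rfl
    rw [h2, mvfderiv_fun_add h1 mdifferentiableAt_const, mvfderiv_const, add_zero,
      (hh x x (hmem x)).2]

end
end Superint
end
-- Flat frames and the space of potentials
noncomputable section
namespace Superint

section
variable {n : ℕ} {M : Type*} [TopologicalSpace M] [ChartedSpace (EuclideanSpace ℝ (Fin n)) M]
  [IsManifold (𝓡 n) ∞ M]

theorem finrank_tangentSpace (x : M) : Module.finrank ℝ (TangentSpace (𝓡 n) x) = n := by
  change Module.finrank ℝ (EuclideanSpace ℝ (Fin n)) = n
  simp

theorem finrank_cotangentSpace (x : M) :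
    Module.finrank ℝ (TangentSpace (𝓡 n) x →L[ℝ] ℝ) = n := by
  change Module.finrank ℝ (EuclideanSpace ℝ (Fin n) →L[ℝ] ℝ) = n
  rw [← (LinearMap.toContinuousLinearMap (𝕜 := ℝ) (E := EuclideanSpace ℝ (Fin n))
    (F' := ℝ)).finrank_eq]
  exact Subspace.dual_finrank_eq.trans (by simp)

instance finiteDimensional_cotangentSpace (x : M) :
    FiniteDimensional ℝ (TangentSpace (𝓡 n) x →L[ℝ] ℝ) :=
  inferInstanceAs (FiniteDimensional ℝ (EuclideanSpace ℝ (Fin n) →L[ℝ] ℝ))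

/-- The differential at `x`, as a linear map on smooth functions. -/
def diffAt (x : M) : C^∞⟮𝓡 n, M; ℝ⟯ →ₗ[ℝ] TangentSpace (𝓡 n) x →L[ℝ] ℝ where
  toFun V := mvfderiv (𝓡 n) V x
  map_add' V W := mvfderiv_add (V.contMDiff.mdiffAt_real x) (W.contMDiff.mdiffAt_real x)
  map_smul' c V := by
    have h := mvfderiv_fun_mul (I := 𝓡 n) (f := fun _ : M => c) (g := V) (x := x)
      mdifferentiableAt_const (V.contMDiff.mdiffAt_real x)
    rw [mvfderiv_const] at h
    ext v
    have h2 := congrArg (fun L => L v) h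
    simp at h2
    exact h2

@[simp]
theorem diffAt_apply (x : M) (V : C^∞⟮𝓡 n, M; ℝ⟯) : diffAt x V = mvfderiv (𝓡 n) V x := rfl

variable [RiemannianBundle (fun x : M => TangentSpace (𝓡 n) x)]
  [IsContMDiffRiemannianBundle (𝓡 n) ∞ (EuclideanSpace ℝ (Fin n))
  (fun x : M => TangentSpace (𝓡 n) x)]

/-- Functions `V i` with Hessian `dVᵢ ∘ D` whose differentials form a global coframe, with the
dual frame `X`. -/
structure IsFlatFrame (D : BilinField n M) (V : Fin n → C^∞⟮𝓡 n, M; ℝ⟯) (X : Fin n → VField n M) :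
    Prop where
  smooth : ∀ i, SmoothVField (X i)
  dual : ∀ x i j, mvfderiv (𝓡 n) (V i) x (X j x) = if i = j then 1 else 0
  hessian_eq : ∀ i x (u v : TangentSpace (𝓡 n) x),
    hessian (V i) x u v = mvfderiv (𝓡 n) (V i) x (D x u v)

theorem IsFlatFrame.eq_sum {D : BilinField n M} {V : Fin n → C^∞⟮𝓡 n, M; ℝ⟯}
    {X : Fin n → VField n M} (h : IsFlatFrame D V X) {x : M} (v : TangentSpace (𝓡 n) x) :
    v = ∑ i, mvfderiv (𝓡 n) (V i) x v • X i x := by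
  have hli : LinearIndependent ℝ (fun i => X i x) := by
    rw [Fintype.linearIndependent_iff]
    intro c hc i
    have := congrArg (mvfderiv (𝓡 n) (V i) x) hc
    simpa [map_sum, h.dual] using this
  have hspan : Submodule.span ℝ (Set.range fun i => X i x) = ⊤ :=
    hli.span_eq_top_of_card_eq_finrank' (by rw [finrank_tangentSpace]; simp)
  have hv : v ∈ Submodule.span ℝ (Set.range fun i => X i x) := by rw [hspan]; trivial
  obtain ⟨c, rfl⟩ := (Submodule.mem_span_range_iff_exists_fun ℝ).1 hv
  refine Finset.sum_congr rfl fun i _ => ?_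
  simp [map_sum, h.dual]

/-- The dual frame is obtained by applying the inverse of the Gram matrix of the gradients to the
gradients, which makes its smoothness visible. -/
theorem exists_isFlatFrame [T2Space M] [PreconnectedSpace M] {D : BilinField n M}
    {V : Fin n → C^∞⟮𝓡 n, M; ℝ⟯}
    (hV : ∀ i x (u v : TangentSpace (𝓡 n) x),
      hessian (V i) x u v = mvfderiv (𝓡 n) (V i) x (D x u v))
    (hli : ∀ x, LinearIndependent ℝ fun i => diffAt (n := n) x (V i)) :
    ∃ X : Fin n → VField n M, IsFlatFrame D V X := by
  let G : M → Matrix (Fin n) (Fin n) ℝ := fun x =>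
    Matrix.of fun i j => inner ℝ (grad (n := n) (V i) x) (grad (V j) x)
  have hG : ∀ x, (G x).det ≠ 0 := fun x => by
    refine gram_det_ne_zero (Y := fun i => grad (n := n) (V i) x) ?_
    rw [Fintype.linearIndependent_iff]
    intro c hc
    refine Fintype.linearIndependent_iff.1 (hli x) c ?_
    ext v
    have := congrArg (fun w => inner ℝ w v) hc
    simpa [sum_inner, real_inner_smul_left, inner_grad] using this
  refine ⟨fun i x => ∑ j, (G x)⁻¹ i j • grad (V j) x, ?_, ?_, hV⟩
  · intro i
    refine SmoothVField.sum fun j => SmoothVField.smul ?_ (smoothVField_grad (V j).contMDiff)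
    intro x
    exact contMDiffAt_matrix_inv (fun i j => ((smoothVField_grad (V i).contMDiff).contMDiff_inner
      (smoothVField_grad (V j).contMDiff)).contMDiffAt) (hG x) i j
  · intro x k i
    have h1 : (G x)⁻¹ * G x = 1 := Matrix.nonsing_inv_mul _ (Ne.isUnit (hG x))
    have h2 := congrFun (congrFun h1 i) k
    rw [Matrix.mul_apply, Matrix.one_apply] at h2
    simp only [map_sum, map_smul, smul_eq_mul, ← inner_grad]
    simp only [G, Matrix.of_apply] at h2
    simp only [eq_comm (a := k), ← h2]
    exact Finset.sum_congr rfl fun j _ => by rw [real_inner_comm]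

theorem tensorD_apply (T : BilinField n M) (s : VField n M) (x : M) (u v : TangentSpace (𝓡 n) x) :
    tensorD T s x u v = T x u v + (1 / (n : ℝ) * inner ℝ u v) • s x := rfl

theorem smooth_tensorD {T : BilinField n M} {s : VField n M}
    (hT : ∀ X Y : VField n M, SmoothVField X → SmoothVField Y →
      SmoothVField (fun x => T x (X x) (Y x))) (hs : SmoothVField s) (X Y : VField n M)
    (hX : SmoothVField X) (hY : SmoothVField Y) :
    SmoothVField (fun x => tensorD T s x (X x) (Y x)) :=
  (hT X Y hX hY).add (hs.smul (contMDiff_const.mul (hX.contMDiff_inner hY)))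

section system
variable {𝒦 : Submodule ℝ (EndField n M)} {𝒱 : Submodule ℝ C^∞⟮𝓡 n, M; ℝ⟯}
  {T : BilinField n M} {s : VField n M}

theorem IsGeneralizedSemidegenerate.hessian_eq (h : IsGeneralizedSemidegenerate 𝒦 𝒱 T s)
    {V : C^∞⟮𝓡 n, M; ℝ⟯} (hV : V ∈ 𝒱) (x : M) (u v : TangentSpace (𝓡 n) x) :
    hessian V x u v = mvfderiv (𝓡 n) V x (tensorD T s x u v) := by
  rw [h.structureTensor.hessian_eq V hV, h.laplacian_eq V hV, tensorD_apply]
  simp [differential]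

theorem IsGeneralizedSemidegenerate.mvfderiv_eq_zero [T2Space M] [PreconnectedSpace M]
    (h : IsGeneralizedSemidegenerate 𝒦 𝒱 T s) {V : C^∞⟮𝓡 n, M; ℝ⟯} (hV : V ∈ 𝒱) {p : M}
    (hp : mvfderiv (𝓡 n) V p = 0) (q : M) : mvfderiv (𝓡 n) V q = 0 :=
  mvfderiv_eq_zero_of_hessian_eq V.contMDiff (smooth_tensorD h.structureTensor.smooth h.smooth)
    (h.hessian_eq hV) hp q

/-- Rank-nullity for `V ↦ dV(p)` on `𝒱`. By unique continuation the kernel consists of constants, so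
its dimension is at most `1`. The range has dimension at most `n`, and the sum `n + 1` forces
equality in both bounds. -/
theorem IsGeneralizedSemidegenerate.range_diffAt [T2Space M] [PreconnectedSpace M]
    (h : IsGeneralizedSemidegenerate 𝒦 𝒱 T s) (p : M) :
    (∀ α : TangentSpace (𝓡 n) p →L[ℝ] ℝ, ∃ V ∈ 𝒱, mvfderiv (𝓡 n) V p = α) ∧
      (∃ V ∈ 𝒱, V ≠ 0 ∧ mvfderiv (𝓡 n) V p = 0) := by
  have hr : Module.finrank ℝ 𝒱 = n + 1 := by
    have := h.system.rank_eq
    exact Module.finrank_eq_of_rank_eq (by exact_mod_cast this)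
  have : FiniteDimensional ℝ 𝒱 := Module.finite_of_finrank_pos (by omega)
  let ev : 𝒱 →ₗ[ℝ] TangentSpace (𝓡 n) p →L[ℝ] ℝ := (diffAt (n := n) p).domRestrict 𝒱
  have hrn := ev.finrank_range_add_finrank_ker
  -- Evaluation at `p` is injective on the kernel, whose elements are constant functions.
  let e0 : LinearMap.ker ev →ₗ[ℝ] ℝ :=
    { toFun := fun V => (V : 𝒱).1 p
      map_add' := fun V W => rfl
      map_smul' := fun c V => rfl }
  have he0 : Function.Injective e0 := by
    intro V W hVW
    have h1 : mvfderiv (𝓡 n) ((V : 𝒱).1 - (W : 𝒱).1 : C^∞⟮𝓡 n, M; ℝ⟯) p = 0 := by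
      rw [← diffAt_apply, map_sub]
      exact (congrArg₂ (· - ·) V.2 W.2).trans (sub_zero 0)
    have h2 := eq_of_mvfderiv_eq_zero (n := n) ((V : 𝒱).1 - (W : 𝒱).1).contMDiff
      (h.mvfderiv_eq_zero (𝒱.sub_mem (V : 𝒱).2 (W : 𝒱).2) h1) p
    refine Subtype.ext (Subtype.ext (ContMDiffMap.ext fun q => sub_eq_zero.1 ((h2 q).trans ?_)))
    exact sub_eq_zero.2 hVW
  have hker : Module.finrank ℝ (LinearMap.ker ev) ≤ 1 := by
    simpa using LinearMap.finrank_le_finrank_of_injective he0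
  have hle : Module.finrank ℝ (LinearMap.range ev) ≤ n :=
    (Submodule.finrank_le _).trans (finrank_cotangentSpace p).le
  constructor
  · have htop : LinearMap.range ev = ⊤ :=
      Submodule.eq_top_of_finrank_eq (by rw [finrank_cotangentSpace]; omega)
    intro α
    obtain ⟨V, hV⟩ := LinearMap.range_eq_top.1 htop α
    exact ⟨V.1, V.2, hV⟩
  · have : Nontrivial (LinearMap.ker ev) := Module.nontrivial_of_finrank_pos (R := ℝ) (by omega)
    obtain ⟨V, hV⟩ := exists_ne (0 : LinearMap.ker ev)
    exact ⟨V.1.1, V.1.2, fun h0 => hV (Subtype.ext (Subtype.ext h0)), V.2⟩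

theorem IsGeneralizedSemidegenerate.const_mem [T2Space M] [PreconnectedSpace M] [Nonempty M]
    (h : IsGeneralizedSemidegenerate 𝒦 𝒱 T s) {U : C^∞⟮𝓡 n, M; ℝ⟯}
    (hU : ∀ x : M, mvfderiv (𝓡 n) U x = 0) : U ∈ 𝒱 := by
  obtain ⟨p⟩ := ‹Nonempty M›
  obtain ⟨V, hV, hV0, hp⟩ := (h.range_diffAt p).2
  have h1 := eq_of_mvfderiv_eq_zero (n := n) V.contMDiff (h.mvfderiv_eq_zero hV hp) p
  have h2 := eq_of_mvfderiv_eq_zero (n := n) U.contMDiff hU p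
  have hVp : V p ≠ 0 := fun h0 => hV0 (ContMDiffMap.ext fun q => (h1 q).trans h0)
  have : U = (U p / V p) • V := by
    ext q
    change U q = U p / V p * V q
    rw [h1 q, h2 q]
    exact (div_mul_cancel₀ _ hVp).symm
  rw [this]
  exact 𝒱.smul_mem _ hV

/-- Potentials whose differentials form a basis at one point `p` have independent differentials
everywhere: a combination critical at `q` is critical at `p` as well. -/
theorem IsGeneralizedSemidegenerate.exists_isFlatFrame [T2Space M] [PreconnectedSpace M]
    [Nonempty M] (h : IsGeneralizedSemidegenerate 𝒦 𝒱 T s) :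
    ∃ (V : Fin n → C^∞⟮𝓡 n, M; ℝ⟯) (X : Fin n → VField n M),
      (∀ i, V i ∈ 𝒱) ∧ IsFlatFrame (tensorD T s) V X := by
  obtain ⟨p⟩ := ‹Nonempty M›
  let b := (stdOrthonormalBasis ℝ (TangentSpace (𝓡 n) p)).reindex
    (finCongr (finrank_tangentSpace p))
  choose V hV hVp using fun i : Fin n => (h.range_diffAt p).1 (innerSL ℝ (b i))
  obtain ⟨X, hX⟩ := Superint.exists_isFlatFrame (fun i => h.hessian_eq (hV i)) (V := V) (by
    intro q
    rw [Fintype.linearIndependent_iff]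
    intro c hc i
    have h0 : mvfderiv (𝓡 n) (∑ i, c i • V i : C^∞⟮𝓡 n, M; ℝ⟯) q = 0 := by
      rw [← diffAt_apply, map_sum]
      simpa only [map_smul] using hc
    have h1 := h.mvfderiv_eq_zero (Submodule.sum_mem _ fun i _ => 𝒱.smul_mem (c i) (hV i)) h0 p
    rw [← diffAt_apply, map_sum] at h1
    have h2 := congrArg (fun L => L (b i)) h1
    simpa [hVp, b.inner_eq_ite] using h2)
  exact ⟨V, X, hV, hX⟩

end system
end
end Superint
end
noncomputable section
namespace Superint

section
variable {n : ℕ} {M : Type*} [TopologicalSpace M] [ChartedSpace (EuclideanSpace ℝ (Fin n)) M]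
  [IsManifold (𝓡 n) ∞ M] [RiemannianBundle (fun x : M => TangentSpace (𝓡 n) x)]
  [IsContMDiffRiemannianBundle (𝓡 n) ∞ (EuclideanSpace ℝ (Fin n))
  (fun x : M => TangentSpace (𝓡 n) x)]

/-! ### Dual-geodesics -/

theorem inducedConnection_apply (A : BilinField n M) (Y : VField n M) (x : M)
    (v : TangentSpace (𝓡 n) x) :
    inducedConnection A Y x v = leviCivita (𝓡 n) M Y x v - A x (Y x) v := by
  rw [sub_eq_add_neg]
  rfl

/-- The extra term contributes `g(Y, γ̇) g(γ̇, w)`, which is again a multiple of `γ̇♭(Y)`; hence `q`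
is shifted by `g(γ̇, w)`. -/
theorem IsDualGeodesic.of_eq_add {A A' : BilinField n M} {w : VField n M}
    (h : ∀ (x : M) (u v : TangentSpace (𝓡 n) x), A x u v = A' x u v + (inner ℝ u v : ℝ) • w x)
    {ε : ℝ} {γ : ℝ → M} (hγ : IsDualGeodesic (inducedConnection A') ε γ) :
    IsDualGeodesic (inducedConnection A) ε γ := by
  obtain ⟨hs, q, hq⟩ := hγ
  refine ⟨hs, fun τ => q τ + inner ℝ (velocity (n := n) γ τ) (w (γ τ)), fun τ hτ Y hY => ?_⟩
  have h1 := hq τ hτ Y hY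
  rw [covDerivVelocityFlat, inducedConnection_apply] at h1 ⊢
  rw [h, inner_sub_right] at *
  rw [inner_add_right, real_inner_smul_right, real_inner_comm (velocity γ τ) (Y (γ τ))]
  linarith

theorem shareDualGeodesics_of_eq_add {A A' : BilinField n M} {w : VField n M}
    (h : ∀ (x : M) (u v : TangentSpace (𝓡 n) x), A x u v = A' x u v + (inner ℝ u v : ℝ) • w x) :
    ShareDualGeodesics (inducedConnection A) (inducedConnection A') := fun ε _ γ =>
  ⟨IsDualGeodesic.of_eq_add (w := -w) fun x u v => by rw [h]; simp,
    IsDualGeodesic.of_eq_add h⟩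

/-! ### The Hessian at a critical point -/

variable [T2Space M]

theorem hessian_add_left (V : M → ℝ) (x : M) (u u' v : TangentSpace (𝓡 n) x) :
    hessian V x (u + u') v = hessian V x u v + hessian V x u' v := by
  simp only [hessian, map_add]
  ring

theorem hessian_smul_left (V : M → ℝ) (x : M) (c : ℝ) (u v : TangentSpace (𝓡 n) x) :
    hessian V x (c • u) v = c * hessian V x u v := by
  simp only [hessian, map_smul, smul_eq_mul]
  ring

theorem hessian_sub (V W : C^∞⟮𝓡 n, M; ℝ⟯) (x : M) (u v : TangentSpace (𝓡 n) x) :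
    hessian (V - W : C^∞⟮𝓡 n, M; ℝ⟯) x u v = hessian V x u v - hessian W x u v := by
  obtain ⟨Y, hY, rfl⟩ := exists_smoothVField_eq x v
  rw [hessian_apply (V - W : C^∞⟮𝓡 n, M; ℝ⟯).contMDiff (hY.mdiffAt x),
    hessian_apply V.contMDiff (hY.mdiffAt x), hessian_apply W.contMDiff (hY.mdiffAt x)]
  have h1 : ∀ y, mvfderiv (𝓡 n) (V - W : C^∞⟮𝓡 n, M; ℝ⟯) y
      = mvfderiv (𝓡 n) V y - mvfderiv (𝓡 n) W y := fun y => (diffAt (n := n) y).map_sub V W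
  have h2 : (fun y => mvfderiv (𝓡 n) (V - W : C^∞⟮𝓡 n, M; ℝ⟯) y (Y y))
      = fun y => mvfderiv (𝓡 n) V y (Y y) - mvfderiv (𝓡 n) W y (Y y) := by
    ext y
    rw [h1]
    rfl
  rw [h1, h2, mvfderiv_fun_sub (mdiffAt_mvfderiv_apply V.contMDiff (hY.mdiffAt x))
    (mdiffAt_mvfderiv_apply W.contMDiff (hY.mdiffAt x))]
  simp only [sub_apply]
  ring

theorem laplacian_sub (V W : C^∞⟮𝓡 n, M; ℝ⟯) (x : M) :
    laplacian n (V - W : C^∞⟮𝓡 n, M; ℝ⟯) x = laplacian n V x - laplacian n W x := by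
  simp only [laplacian, traceG, hessian_sub, Finset.sum_sub_distrib]

theorem traceG_smul_inner (x : M) (c : ℝ) :
    traceG (n := n) x (fun u v => c * inner ℝ u v) = c * n := by
  simp [traceG, finrank_tangentSpace, mul_comm]

/-- A symmetric bilinear form commuting with an irreducible family of self-adjoint operators is a
multiple of the inner product. -/
theorem exists_eq_mul_inner_of_irreducible {F : Type*} [NormedAddCommGroup F]
    [InnerProductSpace ℝ F] [FiniteDimensional ℝ F] [Nontrivial F] {S : Set (F →L[ℝ] F)}
    (hS : ∀ K ∈ S, ∀ u v, inner ℝ (K u) v = inner ℝ u (K v))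
    (hirr : ∀ W : Submodule ℝ F, (∀ K ∈ S, ∀ w ∈ W, K w ∈ W) → W = ⊥ ∨ W = ⊤)
    {φ : F → F → ℝ} (hsymm : ∀ u v, φ u v = φ v u)
    (hadd : ∀ u u' v, φ (u + u') v = φ u v + φ u' v) (hsmul : ∀ (c : ℝ) u v, φ (c • u) v = c * φ u v)
    (hcomm : ∀ K ∈ S, ∀ u v, φ u (K v) = φ v (K u)) :
    ∃ μ : ℝ, ∀ u v, φ u v = μ * inner ℝ u v := by
  let b : F →ₗ[ℝ] F →ₗ[ℝ] ℝ := LinearMap.mk₂ ℝ φ hadd hsmul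
    (fun u v w => by rw [hsymm, hadd, hsymm v, hsymm w])
    (fun c u v => by rw [hsymm, hsmul, hsymm v, smul_eq_mul])
  let B : F →ₗ[ℝ] F := (InnerProductSpace.toDual ℝ F).symm.toLinearEquiv.toLinearMap ∘ₗ
    LinearMap.toContinuousLinearMap.toLinearMap ∘ₗ b
  have hB : ∀ u v, inner ℝ (B u) v = φ u v := fun u v =>
    InnerProductSpace.toDual_symm_apply (𝕜 := ℝ) (E := F)
  have hBs : B.IsSymmetric := fun u v => by
    rw [hB, real_inner_comm, hB, hsymm]
  -- The operator `B` representing `φ` is symmetric, so it has a real eigenvalue. It commutes with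
  -- every `K ∈ S`, so the eigenspace is invariant and, being nonzero, is the whole space.
  obtain ⟨μ, hμ⟩ : ∃ μ : ℝ, Module.End.HasEigenvalue B μ :=
    ⟨_, hBs.hasEigenvalue_iSup_of_finiteDimensional⟩
  have htop := (hirr (Module.End.eigenspace B μ) fun K hK w hw => by
    rw [Module.End.mem_eigenspace_iff] at hw ⊢
    rw [← map_smul K, ← hw]
    refine ext_inner_right ℝ fun z => ?_
    rw [hB, hS K hK, hB, hcomm K hK, ← hcomm K hK, hsymm, hcomm K hK]).resolve_left hμ
  refine ⟨μ, fun u v => ?_⟩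
  have hu : u ∈ Module.End.eigenspace B μ := htop ▸ Submodule.mem_top
  rw [← hB, Module.End.mem_eigenspace_iff.1 hu, real_inner_smul_left]

/-- At a critical point the Hessian of a potential commutes with the Killing tensors. -/
theorem hessian_comm_of_closed {U : M → ℝ} (hU : ContMDiff (𝓡 n) 𝓘(ℝ, ℝ) ∞ U) {x : M}
    (hx : mvfderiv (𝓡 n) U x = 0) {K : EndField n M} (hK : IsKillingTensor K)
    (hc : IsClosedOneForm (fun x => (differential (n := n) U x).comp (K x)))
    (u v : TangentSpace (𝓡 n) x) : hessian U x u (K x v) = hessian U x v (K x u) := by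
  obtain ⟨X, hX, rfl⟩ := exists_smoothVField_eq x u
  obtain ⟨Y, hY, rfl⟩ := exists_smoothVField_eq x v
  have h1 := hessian_apply hU ((hK.smooth Y hY).mdiffAt x) (X x)
  have h2 := hessian_apply hU ((hK.smooth X hX).mdiffAt x) (Y x)
  have h3 := hc X Y hX hY x
  -- Since `dU` vanishes at `x`, the Hessian there is a bare second derivative, and the bracket term
  -- in the closedness condition drops out.
  rw [hx] at h1 h2
  simp only [ContinuousLinearMap.comp_apply, differential, hx] at h3
  simp only [zero_apply, sub_zero] at h1 h2 h3
  rw [h1, h2]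
  linarith

theorem hessian_eq_smul_of_critical (hn : 0 < n) {𝒦 : Submodule ℝ (EndField n M)}
    {𝒱 : Submodule ℝ C^∞⟮𝓡 n, M; ℝ⟯} {N : ℕ} (h : IsIrreducibleSystem 𝒦 𝒱 N)
    {U : C^∞⟮𝓡 n, M; ℝ⟯} (hU : U ∈ 𝒱) {x : M} (hx : mvfderiv (𝓡 n) U x = 0)
    (u v : TangentSpace (𝓡 n) x) :
    hessian U x u v = 1 / (n : ℝ) * inner ℝ u v * laplacian n U x := by
  have hcomm : ∀ K ∈ 𝒦, ∀ u v, hessian U x u (K x v) = hessian U x v (K x u) := fun K hK =>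
    hessian_comm_of_closed U.contMDiff hx (h.killing K hK) (h.closed K hK U hU)
  -- Symmetry of the Hessian is the commutation relation for `K = Id`.
  have hsymm : ∀ u v, hessian U x u v = hessian U x v u := fun u v =>
    hcomm (fun x => ContinuousLinearMap.id ℝ (TangentSpace (𝓡 n) x)) h.metric_mem u v
  have hnt : Nontrivial (TangentSpace (𝓡 n) x) :=
    Module.nontrivial_of_finrank_pos (R := ℝ) (by rw [finrank_tangentSpace]; exact hn)
  obtain ⟨μ, hess⟩ := exists_eq_mul_inner_of_irreducible (F := TangentSpace (𝓡 n) x)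
    (S := (fun K => K x) '' (𝒦 : Set (EndField n M)))
    (by rintro _ ⟨K, hK, rfl⟩; exact (h.killing K hK).symm x)
    (fun W hW => h.irreducible x W fun K hK => hW _ ⟨K, hK, rfl⟩)
    (φ := hessian U x) hsymm (hessian_add_left (n := n) U x) (hessian_smul_left (n := n) U x)
    (by rintro _ ⟨K, hK, rfl⟩; exact hcomm K hK)
  have hlap : laplacian n U x = μ * n := by
    rw [laplacian, ← traceG_smul_inner x μ]
    congr 1
    ext u v
    exact hess u v
  rw [hess, hlap]
  have hn0 : (n : ℝ) ≠ 0 := by positivity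
  field_simp

section system
variable [PreconnectedSpace M] {𝒦 : Submodule ℝ (EndField n M)}
  {𝒱 𝒱' : Submodule ℝ C^∞⟮𝓡 n, M; ℝ⟯} {T : BilinField n M} {s : VField n M}

/-- Only the Hessian equation is new. At `x`, split `V` into some `W ∈ 𝒱` with the same differential
and a remainder critical at `x`, whose Hessian is pure trace. -/
theorem IsGeneralizedSemidegenerate.isStructureTensor_of_le (hn : 0 < n)
    (h : IsGeneralizedSemidegenerate 𝒦 𝒱 T s) (hle : 𝒱 ≤ 𝒱') {N : ℕ}
    (h' : IsIrreducibleSystem 𝒦 𝒱' N) : IsStructureTensor 𝒱' T where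
  smooth := h.structureTensor.smooth
  symm := h.structureTensor.symm
  trace_free := h.structureTensor.trace_free
  hessian_eq V hV x u v := by
    obtain ⟨W, hW, hWx⟩ := (h.range_diffAt x).1 (mvfderiv (𝓡 n) V x)
    have hU : mvfderiv (𝓡 n) (V - W : C^∞⟮𝓡 n, M; ℝ⟯) x = 0 := by
      rw [← diffAt_apply, map_sub, diffAt_apply, diffAt_apply, hWx, sub_self]
    have h1 := hessian_eq_smul_of_critical hn h' (𝒱'.sub_mem hV (hle hW)) hU u v
    rw [hessian_sub, laplacian_sub, h.structureTensor.hessian_eq W hW] at h1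
    have h2 : differential (n := n) W x (T x u v) = differential V x (T x u v) :=
      congrArg (fun L => L (T x u v)) hWx
    rw [h2] at h1
    linarith

/-- The potentials in `𝒱` already realize every covector at `x`, so the two Hessian equations can be
compared against all covectors. -/
theorem IsGeneralizedSemidegenerate.eq_of_isStructureTensor
    (h : IsGeneralizedSemidegenerate 𝒦 𝒱 T s) (hle : 𝒱 ≤ 𝒱') {T' : BilinField n M}
    (hT' : IsStructureTensor 𝒱' T') : T' = T := by
  funext x
  ext u v
  refine ext_inner_left ℝ fun w => ?_
  obtain ⟨W, hW, hWx⟩ := (h.range_diffAt x).1 (innerSL ℝ w)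
  have h1 := hT'.hessian_eq W (hle hW) x u v
  have h2 := h.structureTensor.hessian_eq W hW x u v
  have h3 : ∀ z, differential (n := n) W x z = inner ℝ w z := fun z =>
    congrArg (fun L => L z) hWx
  rw [h3] at h1 h2
  linarith

end system
end
end Superint
end
noncomputable section
namespace Superint

section
variable {n : ℕ} {M : Type*} [TopologicalSpace M] [ChartedSpace (EuclideanSpace ℝ (Fin n)) M]
  [IsManifold (𝓡 n) ∞ M]

/-! ### Symmetry of second derivatives -/

/-- In the chart the fields `Y i` are constant, so both sides are entries of the second derivative
of `h` read in the chart. -/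
theorem mvfderiv_mvfderiv_comm_of_chartDeriv {h : M → ℝ} (hh : ContMDiff (𝓡 n) 𝓘(ℝ, ℝ) ∞ h) {p : M}
    {Y : Fin n → VField n M}
    (hY : ∀ᶠ q in 𝓝 p, ∀ i, chartDeriv n p q (Y i q) = EuclideanSpace.single i (1 : ℝ))
    (hd : ∀ i, MDifferentiableAt (𝓡 n) 𝓘(ℝ, ℝ) (fun q => mvfderiv (𝓡 n) h q (Y i q)) p)
    (i j : Fin n) :
    mvfderiv (𝓡 n) (fun q => mvfderiv (𝓡 n) h q (Y j q)) p (Y i p)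
      = mvfderiv (𝓡 n) (fun q => mvfderiv (𝓡 n) h q (Y i q)) p (Y j p) := by
  set f := h ∘ (extChartAt (𝓡 n) p).symm with hf
  have hfs : ContDiffAt ℝ ∞ f (extChartAt (𝓡 n) p p) :=
    (contDiffOn_comp_extChartAt_symm hh p).contDiffAt (extChartAt_target_mem_nhds p)
  have hfd : DifferentiableAt ℝ (fderiv ℝ f) (extChartAt (𝓡 n) p p) :=
    (hfs.fderiv_right (m := 1) (by exact_mod_cast ENat.LEInfty.out)).differentiableAt one_ne_zero
  have key : ∀ i j : Fin n, mvfderiv (𝓡 n) (fun q => mvfderiv (𝓡 n) h q (Y j q)) p (Y i p)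
      = fderiv ℝ (fderiv ℝ f) (extChartAt (𝓡 n) p p) (EuclideanSpace.single i 1)
        (EuclideanSpace.single j 1) := by
    intro i j
    rw [mvfderiv_coordinate (mem_chart_source _ p) (hd j) (hY.self_of_nhds i)]
    have he : (fun q => mvfderiv (𝓡 n) h q (Y j q)) ∘ (extChartAt (𝓡 n) p).symm
        =ᶠ[𝓝 (extChartAt (𝓡 n) p p)] fun y => fderiv ℝ f y (EuclideanSpace.single j 1) := by
      obtain ⟨r, hr, hrt, hrP⟩ := exists_ball_chart (n := n)
        (hY.and (eventually_mem_chart_source (n := n) p))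
      filter_upwards [Metric.ball_mem_nhds _ hr] with y hy
      obtain ⟨h1, h2⟩ := hrP y hy
      rw [Function.comp_apply, mvfderiv_coordinate h2 (hh.mdiffAt_real _) (h1 j),
        (extChartAt (𝓡 n) p).right_inv (hrt hy)]
    rw [he.fderiv_eq, fderiv_clm_apply hfd (differentiableAt_const _)]
    simp
  have hsymm : IsSymmSndFDerivAt ℝ f (extChartAt (𝓡 n) p p) :=
    hfs.isSymmSndFDerivAt (by simpa using ENat.LEInfty.out)
  rw [key, key, hsymm.eq]


theorem mvfderiv_congr {f g : M → ℝ} {x : M} (he : f =ᶠ[𝓝 x] g) :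
    mvfderiv (𝓡 n) f x = mvfderiv (𝓡 n) g x := by
  ext v
  exact congrArg (fun L : TangentSpace (𝓡 n) x →L[ℝ] ℝ => L v) he.mfderiv_eq

theorem mvfderiv_finset_sum {ι : Type*} (s : Finset ι) {f : ι → M → ℝ} {x : M}
    (hf : ∀ i, MDifferentiableAt (𝓡 n) 𝓘(ℝ, ℝ) (f i) x) :
    MDifferentiableAt (𝓡 n) 𝓘(ℝ, ℝ) (fun y => ∑ i ∈ s, f i y) x ∧
      ∀ v, mvfderiv (𝓡 n) (fun y => ∑ i ∈ s, f i y) x v = ∑ i ∈ s, mvfderiv (𝓡 n) (f i) x v := by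
  classical
  induction s using Finset.induction_on with
  | empty => exact ⟨by simpa using mdifferentiableAt_const, by simp [mvfderiv_const]⟩
  | insert i s hi ih =>
    simp only [Finset.sum_insert hi]
    exact ⟨(hf i).add ih.1, fun v => by rw [mvfderiv_fun_add (hf i) ih.1, add_apply, ih.2]⟩

/-- The commutator of two derivations has first order: when both fields are expanded in a coordinate
frame, the second derivatives of `h` cancel. -/
theorem exists_bracket [T2Space M] {X Z : VField n M} (hX : SmoothVField X) (hZ : SmoothVField Z)
    (p : M) : ∃ w : TangentSpace (𝓡 n) p, ∀ h : M → ℝ, ContMDiff (𝓡 n) 𝓘(ℝ, ℝ) ∞ h →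
      mvfderiv (𝓡 n) (fun q => mvfderiv (𝓡 n) h q (Z q)) p (X p)
        - mvfderiv (𝓡 n) (fun q => mvfderiv (𝓡 n) h q (X q)) p (Z p)
        = mvfderiv (𝓡 n) h p w := by
  obtain ⟨Y, hY, hYp⟩ := exists_coordinate_frame (n := n) p
  have hc : ∀ {Z : VField n M}, SmoothVField Z → ∀ k, MDifferentiableAt (𝓡 n) 𝓘(ℝ, ℝ)
      (fun q => chartDeriv n p q (Z q) k) p := fun hZ k =>
    (contMDiffAt_chartDeriv_apply hZ p k).mdifferentiableAt (by simp)
  have hsum : ∀ (Z : VField n M) (h : M → ℝ), ∀ᶠ q in 𝓝 p, mvfderiv (𝓡 n) h q (Z q)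
      = ∑ k, chartDeriv n p q (Z q) k * mvfderiv (𝓡 n) h q (Y k q) := by
    intro Z h
    filter_upwards [hYp, eventually_mem_chart_source (n := n) p] with q hq hqs
    conv_lhs => rw [eq_sum_of_chartDeriv hqs hq (Z q)]
    simp only [map_sum, map_smul, smul_eq_mul]
  have key : ∀ {Z : VField n M} (u : TangentSpace (𝓡 n) p) {h : M → ℝ}, SmoothVField Z →
      ContMDiff (𝓡 n) 𝓘(ℝ, ℝ) ∞ h →
      mvfderiv (𝓡 n) (fun q => mvfderiv (𝓡 n) h q (Z q)) p u
        = ∑ k, (mvfderiv (𝓡 n) (fun q => chartDeriv n p q (Z q) k) p u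
            * mvfderiv (𝓡 n) h p (Y k p) + chartDeriv n p p (Z p) k
            * mvfderiv (𝓡 n) (fun q => mvfderiv (𝓡 n) h q (Y k q)) p u) := by
    intro Z u h hZ hh
    have hm : ∀ k, MDifferentiableAt (𝓡 n) 𝓘(ℝ, ℝ) (fun q => mvfderiv (𝓡 n) h q (Y k q)) p :=
      fun k => (smooth_mvfderiv_apply hh (hY k)).mdiffAt_real p
    have e : mvfderiv (𝓡 n) (fun q => mvfderiv (𝓡 n) h q (Z q)) p = _ := mvfderiv_congr (hsum Z h)
    rw [e, (mvfderiv_finset_sum Finset.univ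
      (f := fun k q => chartDeriv n p q (Z q) k * mvfderiv (𝓡 n) h q (Y k q))
      fun k => (hc hZ k).mul (hm k)).2]
    refine Finset.sum_congr rfl fun k _ => ?_
    rw [mvfderiv_fun_mul (hc hZ k) (hm k)]
    simp
    ring
  refine ⟨∑ k, (mvfderiv (𝓡 n) (fun q => chartDeriv n p q (Z q) k) p (X p)
    - mvfderiv (𝓡 n) (fun q => chartDeriv n p q (X q) k) p (Z p)) • Y k p, fun h hh => ?_⟩
  have hX' := eq_sum_of_chartDeriv (mem_chart_source _ p) hYp.self_of_nhds (X p)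
  have hZ' := eq_sum_of_chartDeriv (mem_chart_source _ p) hYp.self_of_nhds (Z p)
  have hcomm := mvfderiv_mvfderiv_comm_of_chartDeriv hh hYp
    (fun i => (smooth_mvfderiv_apply hh (hY i)).mdiffAt_real p)
  have e1 : ∀ k, mvfderiv (𝓡 n) (fun q => mvfderiv (𝓡 n) h q (Y k q)) p (X p)
      = ∑ l, chartDeriv n p p (X p) l *
        mvfderiv (𝓡 n) (fun q => mvfderiv (𝓡 n) h q (Y k q)) p (Y l p) := fun k => by
    conv_lhs => rw [hX']
    simp only [map_sum, map_smul, smul_eq_mul]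
  have e2 : ∀ k, mvfderiv (𝓡 n) (fun q => mvfderiv (𝓡 n) h q (Y k q)) p (Z p)
      = ∑ l, chartDeriv n p p (Z p) l *
        mvfderiv (𝓡 n) (fun q => mvfderiv (𝓡 n) h q (Y k q)) p (Y l p) := fun k => by
    conv_lhs => rw [hZ']
    simp only [map_sum, map_smul, smul_eq_mul]
  have e3 : ∑ k, chartDeriv n p p (Z p) k * ∑ l, chartDeriv n p p (X p) l *
        mvfderiv (𝓡 n) (fun q => mvfderiv (𝓡 n) h q (Y k q)) p (Y l p)
      = ∑ k, chartDeriv n p p (X p) k * ∑ l, chartDeriv n p p (Z p) l *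
        mvfderiv (𝓡 n) (fun q => mvfderiv (𝓡 n) h q (Y k q)) p (Y l p) := by
    simp only [Finset.mul_sum]
    rw [Finset.sum_comm]
    refine Finset.sum_congr rfl fun k _ => Finset.sum_congr rfl fun l _ => ?_
    rw [hcomm k l]
    ring
  rw [key _ hZ hh, key _ hX hh]
  simp only [e1, e2, Finset.sum_add_distrib, e3, map_sum, map_smul, smul_eq_mul, sub_mul,
    Finset.sum_sub_distrib]
  ring

variable [RiemannianBundle (fun x : M => TangentSpace (𝓡 n) x)]
  [IsContMDiffRiemannianBundle (𝓡 n) ∞ (EuclideanSpace ℝ (Fin n))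
  (fun x : M => TangentSpace (𝓡 n) x)]

/-! ### Calculus in a flat frame -/

namespace IsFlatFrame
variable {D : BilinField n M} {V : Fin n → C^∞⟮𝓡 n, M; ℝ⟯} {X : Fin n → VField n M}

/-- The bracket of `Xᵢ` and `Xⱼ` is annihilated by every `dVₖ`, because the functions `dVₖ(Xⱼ)` are
constant. -/
theorem mvfderiv_comm [T2Space M] (hF : IsFlatFrame D V X) {h : M → ℝ}
    (hh : ContMDiff (𝓡 n) 𝓘(ℝ, ℝ) ∞ h) (p : M) (i j : Fin n) :
    mvfderiv (𝓡 n) (fun q => mvfderiv (𝓡 n) h q (X j q)) p (X i p)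
      = mvfderiv (𝓡 n) (fun q => mvfderiv (𝓡 n) h q (X i q)) p (X j p) := by
  obtain ⟨w, hw⟩ := exists_bracket (hF.smooth i) (hF.smooth j) p
  have h0 : w = 0 := by
    rw [hF.eq_sum w]
    refine Finset.sum_eq_zero fun k _ => ?_
    rw [← hw (V k) (V k).contMDiff]
    simp [hF.dual, mvfderiv_const]
  have := hw h hh
  rw [h0, map_zero] at this
  linarith

theorem mvfderiv_eq_sum (hF : IsFlatFrame D V X) (h : M → ℝ) (x : M)
    (v : TangentSpace (𝓡 n) x) :
    mvfderiv (𝓡 n) h x v = ∑ i, mvfderiv (𝓡 n) h x (X i x) * mvfderiv (𝓡 n) (V i) x v := by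
  conv_lhs => rw [hF.eq_sum v]
  simp [mul_comm]

theorem eq_of_mvfderiv_eq (hF : IsFlatFrame D V X) {x : M} {u v : TangentSpace (𝓡 n) x}
    (h : ∀ i, mvfderiv (𝓡 n) (V i) x u = mvfderiv (𝓡 n) (V i) x v) : u = v := by
  rw [hF.eq_sum u, hF.eq_sum v]
  simp only [h]

/-- As `dVₖ(Xⱼ)` is constant, `∇²Vₖ(Xᵢ, Xⱼ)` reduces to `-dVₖ(∇_{Xᵢ} Xⱼ)`; compare with `dVₖ(D(Xᵢ,
Xⱼ))`. -/
theorem leviCivita_eq [T2Space M] (hF : IsFlatFrame D V X) (x : M) (i j : Fin n) :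
    leviCivita (𝓡 n) M (X j) x (X i x) = -D x (X i x) (X j x) := by
  refine hF.eq_of_mvfderiv_eq fun k => ?_
  have h1 := hessian_apply (V k).contMDiff ((hF.smooth j).mdiffAt x) (X i x)
  rw [hF.hessian_eq] at h1
  simp only [hF.dual, mvfderiv_const, zero_apply, zero_sub] at h1
  rw [map_neg, h1, neg_neg]

theorem mvfderiv_inner [T2Space M] (hF : IsFlatFrame D V X) (x : M) (i j k : Fin n) :
    mvfderiv (𝓡 n) (fun y => inner ℝ (X i y) (X j y)) x (X k x)
      = -(inner ℝ (D x (X k x) (X i x)) (X j x)) - inner ℝ (X i x) (D x (X k x) (X j x)) := by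
  have h := leviCivita_metric ((hF.smooth k).mdiffAt x) ((hF.smooth i).mdiffAt x)
    ((hF.smooth j).mdiffAt x)
  rw [covDerivMetric, hF.leviCivita_eq, hF.leviCivita_eq, inner_neg_left, inner_neg_right] at h
  linarith

end IsFlatFrame

end
end Superint
end
noncomputable section
namespace Superint

section
variable {n : ℕ} {M : Type*} [TopologicalSpace M] [ChartedSpace (EuclideanSpace ℝ (Fin n)) M]
  [IsManifold (𝓡 n) ∞ M] [RiemannianBundle (fun x : M => TangentSpace (𝓡 n) x)]
  [IsContMDiffRiemannianBundle (𝓡 n) ∞ (EuclideanSpace ℝ (Fin n))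
  (fun x : M => TangentSpace (𝓡 n) x)]

/-! ### Semi-compatibility -/

/-- The skew part of `g(Y, A(X, Z))` in `X, Y` is `α(Y) g(X, Z) - α(X) g(Y, Z)` at `x`. -/
def HasSkewPart (A : BilinField n M) (α : OneForm n M) (x : M) : Prop :=
  ∀ u v w : TangentSpace (𝓡 n) x, (inner ℝ v (A x u w) : ℝ) - inner ℝ u (A x v w)
    = α x v * inner ℝ u w - α x u * inner ℝ v w

theorem covDerivMetric_inducedConnection {A : BilinField n M} {X Y Z : VField n M}
    (hX : SmoothVField X) (hY : SmoothVField Y) (hZ : SmoothVField Z) (x : M) :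
    covDerivMetric (inducedConnection A) X Y Z x
      = inner ℝ (A x (Y x) (X x)) (Z x) + inner ℝ (Y x) (A x (Z x) (X x)) := by
  have h := leviCivita_metric (hX.mdiffAt x) (hY.mdiffAt x) (hZ.mdiffAt x)
  rw [covDerivMetric] at h ⊢
  rw [inducedConnection_apply, inducedConnection_apply, inner_sub_left, inner_sub_right]
  linarith

/-- For `∇ - A` one has `(∇'_X g)(Y, Z) = g(A(Y, X), Z) + g(Y, A(Z, X))`. The first term is
symmetric in `X, Y` and cancels, leaving a pointwise condition. -/
theorem semiCompatible_inducedConnection_iff [T2Space M] {A : BilinField n M} {α : OneForm n M}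
    (hA : ∀ (x : M) (u v : TangentSpace (𝓡 n) x), A x u v = A x v u) :
    SemiCompatible (inducedConnection A) α ↔ ∀ x, HasSkewPart A α x := by
  have key : ∀ {X Y Z : VField n M}, SmoothVField X → SmoothVField Y → SmoothVField Z → ∀ x : M,
      covDerivMetric (inducedConnection A) X Y Z x - covDerivMetric (inducedConnection A) Y X Z x
      = inner ℝ (Y x) (A x (X x) (Z x)) - inner ℝ (X x) (A x (Y x) (Z x)) := by
    intro X Y Z hX hY hZ x
    rw [covDerivMetric_inducedConnection hX hY hZ, covDerivMetric_inducedConnection hY hX hZ,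
      hA x (Z x) (X x), hA x (Z x) (Y x), hA x (Y x) (X x)]
    ring
  constructor
  · intro h x u v w
    obtain ⟨X, hX, rfl⟩ := exists_smoothVField_eq x u
    obtain ⟨Y, hY, rfl⟩ := exists_smoothVField_eq x v
    obtain ⟨Z, hZ, rfl⟩ := exists_smoothVField_eq x w
    rw [← key hX hY hZ, h X Y Z hX hY hZ]
  · intro h X Y Z hX hY hZ x
    rw [key hX hY hZ, h x]

theorem hasSkewPart_neg_iff {A : BilinField n M} {α : OneForm n M} {x : M} :
    HasSkewPart (-A) (-α) x ↔ HasSkewPart A α x := by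
  refine forall_congr' fun u => forall_congr' fun v => forall_congr' fun w => ?_
  have h1 : ∀ u v, (-A) x u v = -A x u v := fun u v => rfl
  have h2 : ∀ u, (-α) x u = -α x u := fun u => rfl
  rw [h1, h1, h2, h2, inner_neg_right, inner_neg_right]
  constructor <;> intro h <;> linarith

theorem tensorD_symm {T : BilinField n M} {s : VField n M}
    (hT : ∀ (x : M) (u v : TangentSpace (𝓡 n) x), T x u v = T x v u) (x : M)
    (u v : TangentSpace (𝓡 n) x) : tensorD T s x u v = tensorD T s x v u := by
  rw [tensorD_apply, tensorD_apply, hT, real_inner_comm]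

/-- The form `β = (s - (n + 2) t) / n`. -/
def formBeta (T : BilinField n M) (s : VField n M) : OneForm n M :=
  (1 / (n : ℝ)) • (flat s - ((n : ℝ) + 2) • formT T)

theorem formBeta_apply (hn : 2 ≤ n) (T : BilinField n M) (s : VField n M) (x : M)
    (v : TangentSpace (𝓡 n) x) : formBeta T s x v = 1 / (n : ℝ) * inner ℝ (s x) v
      - 1 / ((n : ℝ) - 1) * traceG x (fun e e' => (inner ℝ e (T x v e') : ℝ)) := by
  have h2 : (2 : ℝ) ≤ n := by exact_mod_cast hn
  have h1 : (n : ℝ) - 1 ≠ 0 := by linarith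
  have h3 : (n : ℝ) + 2 ≠ 0 := by linarith
  have h0 : (n : ℝ) ≠ 0 := by linarith
  have e : formBeta T s x v = 1 / (n : ℝ) * (inner ℝ (s x) v - ((n : ℝ) + 2) *
      ((n : ℝ) / (((n : ℝ) - 1) * ((n : ℝ) + 2)) *
        LinearMap.trace ℝ (TangentSpace (𝓡 n) x) (T x v : TangentSpace (𝓡 n) x →ₗ[ℝ] _))) := rfl
  rw [e, LinearMap.trace_eq_sum_inner _ (stdOrthonormalBasis ℝ (TangentSpace (𝓡 n) x)), traceG]
  simp only [ContinuousLinearMap.coe_coe]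
  field_simp

/-- Trace the identity over `v = w = eᵢ`. The right side becomes `(1 - n) α`; on the left `∑ T(eᵢ,
eᵢ)` vanishes, leaving `c` times `tr T - ((n - 1)/n) s`. So the form is forced. -/
theorem eq_smul_formBeta (hn : 2 ≤ n) {T : BilinField n M} {s : VField n M} {x : M}
    (hT : traceG x (fun u v => T x u v) = 0) {c : ℝ} {α : TangentSpace (𝓡 n) x →L[ℝ] ℝ}
    (h : ∀ u v w : TangentSpace (𝓡 n) x,
      c * ((inner ℝ v (tensorD T s x u w) : ℝ) - inner ℝ u (tensorD T s x v w))
        = α v * inner ℝ u w - α u * inner ℝ v w) : α = c • formBeta T s x := by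
  have h2 : (2 : ℝ) ≤ n := by exact_mod_cast hn
  have h1 : (n : ℝ) - 1 ≠ 0 := by linarith
  have h0 : (n : ℝ) ≠ 0 := by linarith
  ext v
  rw [smul_apply, smul_eq_mul, formBeta_apply hn]
  set e := stdOrthonormalBasis ℝ (TangentSpace (𝓡 n) x) with he
  have hs := Finset.sum_congr (rfl : Finset.univ = Finset.univ) fun i _ => h v (e i) (e i)
  have hα : ∑ i, α (e i) * inner ℝ v (e i) = α v := by
    conv_rhs => rw [← e.sum_repr' v]
    simp only [map_sum, map_smul, smul_eq_mul, real_inner_comm v]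
    exact Finset.sum_congr rfl fun i _ => mul_comm _ _
  have hsv : ∑ i, (inner ℝ v (e i) : ℝ) * inner ℝ (e i) (s x) = inner ℝ (s x) v := by
    rw [e.sum_inner_mul_inner, real_inner_comm]
  have hT' : ∑ i, (inner ℝ v (T x (e i) (e i)) : ℝ) = 0 := by
    rw [← inner_sum]
    exact (congrArg (fun w => inner ℝ v w) hT).trans (inner_zero_right v)
  have hcard : Fintype.card (Fin (Module.finrank ℝ (TangentSpace (𝓡 n) x))) = n := by
    rw [Fintype.card_fin, finrank_tangentSpace]
  simp only [← Finset.mul_sum, tensorD_apply, inner_add_right, real_inner_smul_right, Finset.sum_sub_distrib,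
    Finset.sum_add_distrib, hα, hT', mul_assoc, ← Finset.mul_sum, hsv,
    real_inner_self_eq_norm_sq, e.norm_eq_one] at hs
  simp only [one_pow, one_mul, mul_one, Finset.sum_const, Finset.card_univ, nsmul_eq_mul,
    hcard, real_inner_comm v (s x)] at hs
  rw [traceG, ← he]
  rw [real_inner_comm (s x) v] at *
  field_simp
  field_simp at hs
  linarith

end
end Superint
end
-- From weakness to semi-compatibility
noncomputable section
namespace Superint

section
variable {n : ℕ} {M : Type*} [TopologicalSpace M] [ChartedSpace (EuclideanSpace ℝ (Fin n)) M]
  [IsManifold (𝓡 n) ∞ M] [RiemannianBundle (fun x : M => TangentSpace (𝓡 n) x)]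
  [IsContMDiffRiemannianBundle (𝓡 n) ∞ (EuclideanSpace ℝ (Fin n))
  (fun x : M => TangentSpace (𝓡 n) x)]

namespace IsFlatFrame
variable {D : BilinField n M} {V : Fin n → C^∞⟮𝓡 n, M; ℝ⟯} {X : Fin n → VField n M}

theorem induction (hF : IsFlatFrame D V X) {x : M} {P : TangentSpace (𝓡 n) x → Prop} (h0 : P 0)
    (hadd : ∀ u v, P u → P v → P (u + v)) (hsmul : ∀ (c : ℝ) v, P v → P (c • v))
    (hX : ∀ i, P (X i x)) (v : TangentSpace (𝓡 n) x) : P v := by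
  rw [hF.eq_sum v]
  exact Finset.sum_induction _ P hadd h0 fun i _ => hsmul _ _ (hX i)

theorem ext_mvfderiv (hF : IsFlatFrame D V X) {x : M} {α α' : TangentSpace (𝓡 n) x →L[ℝ] ℝ}
    (h : ∀ i, α (X i x) = α' (X i x)) : α = α' := by
  ext v
  rw [hF.eq_sum v]
  simp only [map_sum, map_smul, h]

theorem inner_self_pos (hF : IsFlatFrame D V X) (x : M) (i : Fin n) :
    0 < (inner ℝ (X i x) (X i x) : ℝ) := by
  rw [real_inner_self_pos]
  intro h
  have h1 := hF.dual x i i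
  rw [h, map_zero] at h1
  simp at h1

/-- The orthonormal bases in `traceG` are chosen point by point; rewriting the trace in the smooth
frame is what gives the smoothness of `formBeta`. -/
theorem trace_eq_sum (hF : IsFlatFrame D V X) (x : M)
    (B : TangentSpace (𝓡 n) x →L[ℝ] TangentSpace (𝓡 n) x) :
    traceG x (fun e e' => (inner ℝ e (B e') : ℝ)) = ∑ i, mvfderiv (𝓡 n) (V i) x (B (X i x)) := by
  set e := stdOrthonormalBasis ℝ (TangentSpace (𝓡 n) x) with he
  have h1 : ∀ k, (inner ℝ (e k) (B (e k)) : ℝ)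
      = ∑ i, mvfderiv (𝓡 n) (V i) x (inner ℝ (e k) (B (X i x)) • e k) := fun k => by
    have hB : B (e k) = ∑ i, mvfderiv (𝓡 n) (V i) x (e k) • B (X i x) := by
      conv_lhs => rw [hF.eq_sum (e k)]
      simp only [map_sum, map_smul]
    rw [hB, inner_sum]
    simp only [real_inner_smul_right, map_smul, smul_eq_mul]
    exact Finset.sum_congr rfl fun i _ => mul_comm _ _
  rw [traceG, ← he]
  simp only [h1]
  rw [Finset.sum_comm]
  refine Finset.sum_congr rfl fun i _ => ?_
  rw [← map_sum, e.sum_repr']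

theorem smooth_formBeta (hF : IsFlatFrame D V X) (hn : 2 ≤ n) {T : BilinField n M} {s : VField n M}
    (hT : ∀ X Y : VField n M, SmoothVField X → SmoothVField Y →
      SmoothVField (fun x => T x (X x) (Y x))) (hs : SmoothVField s) {Y : VField n M}
    (hY : SmoothVField Y) : ContMDiff (𝓡 n) 𝓘(ℝ, ℝ) ∞ fun x => formBeta T s x (Y x) := by
  simp only [formBeta_apply hn, hF.trace_eq_sum]
  exact (contMDiff_const.mul (hs.contMDiff_inner hY)).sub (contMDiff_const.mul
    (ContMDiff.sum fun i _ => smooth_mvfderiv_apply (V i).contMDiff (hT _ _ hY (hF.smooth i))))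

/-- The derivatives of the Gram matrix of a flat frame. -/
theorem mvfderiv_inner_sub [T2Space M] (hF : IsFlatFrame D V X)
    (hD : ∀ (x : M) (u v : TangentSpace (𝓡 n) x), D x u v = D x v u) (x : M) (i j k : Fin n) :
    mvfderiv (𝓡 n) (fun y => inner ℝ (X i y) (X j y)) x (X k x)
      - mvfderiv (𝓡 n) (fun y => inner ℝ (X k y) (X j y)) x (X i x)
      = (inner ℝ (X k x) (D x (X i x) (X j x)) : ℝ) - inner ℝ (X i x) (D x (X k x) (X j x)) := by
  rw [hF.mvfderiv_inner, hF.mvfderiv_inner, hD x (X k x) (X i x)]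
  ring

/-- Integrability of the system `Xᵢ aⱼ = φ g(Xᵢ, Xⱼ)`. -/
theorem mul_skewPart_eq [T2Space M] (hF : IsFlatFrame D V X)
    (hD : ∀ (x : M) (u v : TangentSpace (𝓡 n) x), D x u v = D x v u)
    {φ : M → ℝ} (hφ : ContMDiff (𝓡 n) 𝓘(ℝ, ℝ) ∞ φ) {a : Fin n → M → ℝ}
    (ha : ∀ j, ContMDiff (𝓡 n) 𝓘(ℝ, ℝ) ∞ (a j))
    (haφ : ∀ x i j, mvfderiv (𝓡 n) (a j) x (X i x) = φ x * inner ℝ (X i x) (X j x))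
    (x : M) (u v w : TangentSpace (𝓡 n) x) :
    φ x * ((inner ℝ v (D x u w) : ℝ) - inner ℝ u (D x v w))
      = (-mvfderiv (𝓡 n) φ x) v * inner ℝ u w - (-mvfderiv (𝓡 n) φ x) u * inner ℝ v w := by
  have key : ∀ i j k, φ x * ((inner ℝ (X k x) (D x (X i x) (X j x)) : ℝ)
      - inner ℝ (X i x) (D x (X k x) (X j x)))
      = (-mvfderiv (𝓡 n) φ x) (X k x) * inner ℝ (X i x) (X j x)
        - (-mvfderiv (𝓡 n) φ x) (X i x) * inner ℝ (X k x) (X j x) := by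
    intro i j k
    have h1 := hF.mvfderiv_comm (ha j) x k i
    have hg : ∀ i, MDifferentiableAt (𝓡 n) 𝓘(ℝ, ℝ)
        (fun y => (inner ℝ (X i y) (X j y) : ℝ)) x := fun i =>
      ((hF.smooth i).contMDiff_inner (hF.smooth j)).mdiffAt_real x
    simp only [haφ] at h1
    rw [mvfderiv_fun_mul (hφ.mdiffAt_real x) (hg i),
      mvfderiv_fun_mul (hφ.mdiffAt_real x) (hg k)] at h1
    simp only [add_apply, smul_apply, smul_eq_mul] at h1
    rw [← hF.mvfderiv_inner_sub hD, neg_apply, neg_apply]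
    linarith
  -- Both sides are linear in each argument, so the identity on the frame, `key`, extends to all
  -- vectors.
  revert u v w
  refine hF.induction (by simp) (fun u u' h h' v w => ?_) (fun c u h v w => ?_) fun i => ?_
  · have e := congrArg₂ (· + ·) (h v w) (h' v w)
    simp only [map_add, add_apply, inner_add_left, inner_add_right] at e ⊢
    linarith
  · have e := congrArg (c * ·) (h v w)
    simp only [map_smul, smul_apply, real_inner_smul_left, real_inner_smul_right, smul_eq_mul]
      at e ⊢
    linarith
  refine hF.induction (by simp) (fun v v' h h' w => ?_) (fun c v h w => ?_) fun k => ?_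
  · have e := congrArg₂ (· + ·) (h w) (h' w)
    simp only [map_add, add_apply, inner_add_left, inner_add_right] at e ⊢
    linarith
  · have e := congrArg (c * ·) (h w)
    simp only [map_smul, smul_apply, real_inner_smul_left, real_inner_smul_right, smul_eq_mul]
      at e ⊢
    linarith
  refine hF.induction (by simp) (fun w w' h h' => ?_) (fun c w h => ?_) fun j => key i j k
  · have e := congrArg₂ (· + ·) h h'
    simp only [map_add, inner_add_right] at e ⊢
    linarith
  · have e := congrArg (c * ·) h
    simp only [map_smul, real_inner_smul_right] at e ⊢
    linarith

end IsFlatFrame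

section system
variable [T2Space M] [PreconnectedSpace M] [Nonempty M] {𝒦 : Submodule ℝ (EndField n M)}
  {𝒱 : Submodule ℝ C^∞⟮𝓡 n, M; ℝ⟯} {T : BilinField n M} {s : VField n M}

/-- An additional potential satisfies `Xᵢ Xⱼ W = φ gᵢⱼ`. The integrability conditions give the skew
identity multiplied by `φ`, and `φ` has no zeros. -/
theorem IsGeneralizedSemidegenerate.hasSkewPart_of_isWeak (hn : 2 ≤ n)
    (h : IsGeneralizedSemidegenerate 𝒦 𝒱 T s) (hw : IsWeak 𝒦 𝒱) (x : M) :
    HasSkewPart (tensorD T s) (formBeta T s) x := by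
  obtain ⟨𝒱', hle, h'⟩ := hw
  have hT := h.isStructureTensor_of_le (by omega) hle h'
  obtain ⟨W, hW, hW𝒱⟩ : ∃ W ∈ 𝒱', W ∉ 𝒱 := by
    by_contra! hc
    have h1 := h.system.rank_eq
    rw [le_antisymm hle hc, h'.rank_eq] at h1
    norm_cast at h1
    omega
  obtain ⟨V, X, hV, hF⟩ := h.exists_isFlatFrame
  have hD := tensorD_symm (s := s) h.structureTensor.symm
  -- The failure of `W` to satisfy the semi-degeneracy equation `ΔW = dW(s)`, divided by `n`.
  let φ : M → ℝ := fun y => 1 / (n : ℝ) * (laplacian n W y - mvfderiv (𝓡 n) W y (s y))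
  have ha : ∀ j, ContMDiff (𝓡 n) 𝓘(ℝ, ℝ) ∞ fun y => mvfderiv (𝓡 n) W y (X j y) := fun j =>
    smooth_mvfderiv_apply W.contMDiff (hF.smooth j)
  have haφ : ∀ y i j, mvfderiv (𝓡 n) (fun y => mvfderiv (𝓡 n) W y (X j y)) y (X i y)
      = φ y * inner ℝ (X i y) (X j y) := by
    intro y i j
    have h1 := hessian_apply W.contMDiff ((hF.smooth j).mdiffAt y) (X i y)
    rw [hF.leviCivita_eq, map_neg, hT.hessian_eq W hW, tensorD_apply, map_add, map_smul,
      smul_eq_mul, differential] at h1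
    simp only [φ]
    linarith
  have hφ : ContMDiff (𝓡 n) 𝓘(ℝ, ℝ) ∞ φ := by
    -- Smoothness of `φ` is read off from `φ = Xᵢ Xᵢ W / gᵢᵢ` for one index, which avoids the
    -- Laplacian.
    let i : Fin n := ⟨0, by omega⟩
    have e : φ = fun y => mvfderiv (𝓡 n) (fun y => mvfderiv (𝓡 n) W y (X i y)) y (X i y)
        / inner ℝ (X i y) (X i y) := by
      ext y
      rw [haφ, mul_div_cancel_right₀ _ (hF.inner_self_pos y i).ne']
    rw [e]
    exact (smooth_mvfderiv_apply (ha i) (hF.smooth i)).div₀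
      ((hF.smooth i).contMDiff_inner (hF.smooth i)) fun y => (hF.inner_self_pos y i).ne'
  have hskew := hF.mul_skewPart_eq hD hφ ha haφ
  have hdφ : ∀ y, -mvfderiv (𝓡 n) φ y = φ y • formBeta T s y := fun y =>
    eq_smul_formBeta hn (h.structureTensor.trace_free y) (hskew y)
  have hφ0 : φ x ≠ 0 := by
    intro hx
    -- By `dφ = -φ β` a single zero spreads everywhere. Then all `Xⱼ W` are constant, so `W` is a
    -- constant-coefficient combination of the `Vⱼ` plus a constant and lies in `𝒱`.
    have hφ0 : ∀ y, φ y = 0 := eq_zero_of_mvfderiv_eq_mul hφ (β := -formBeta T s)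
      (fun Y hY => (hF.smooth_formBeta hn h.structureTensor.smooth h.smooth hY).continuous.neg)
      (fun y v => by
        have := congrArg (fun L => L v) (hdφ y)
        simp only [neg_apply, smul_apply, smul_eq_mul] at this
        change _ = -(formBeta T s y v) * φ y
        linarith) hx
    have hconst := fun j => eq_of_mvfderiv_eq_zero (n := n) (ha j) (fun y =>
      hF.ext_mvfderiv fun i => by rw [haφ, hφ0, zero_mul, zero_apply]) x
    refine hW𝒱 ?_
    have hU : W - ∑ j, mvfderiv (𝓡 n) W x (X j x) • V j ∈ 𝒱 := h.const_mem fun y => by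
      rw [← diffAt_apply, map_sub, map_sum]
      ext v
      simp only [map_smul, diffAt_apply, sub_apply, sum_apply, smul_apply, zero_apply, smul_eq_mul]
      rw [hF.mvfderiv_eq_sum W y v, sub_eq_zero]
      exact Finset.sum_congr rfl fun j _ => by rw [hconst j y]
    exact (𝒱.sub_mem_iff_left (𝒱.sum_mem fun j _ => 𝒱.smul_mem _ (hV j))).1 hU
  intro u v w
  have h1 := hskew x u v w
  rw [hdφ] at h1
  simp only [smul_apply, smul_eq_mul] at h1
  refine mul_left_cancel₀ hφ0 ?_
  linarith

end system
end
end Superint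
end
noncomputable section
namespace Superint

section
variable {n : ℕ} {M : Type*} [TopologicalSpace M] [ChartedSpace (EuclideanSpace ℝ (Fin n)) M]
  [IsManifold (𝓡 n) ∞ M] [RiemannianBundle (fun x : M => TangentSpace (𝓡 n) x)]
  [IsContMDiffRiemannianBundle (𝓡 n) ∞ (EuclideanSpace ℝ (Fin n))
  (fun x : M => TangentSpace (𝓡 n) x)]

namespace IsFlatFrame
variable {D : BilinField n M} {V : Fin n → C^∞⟮𝓡 n, M; ℝ⟯} {X : Fin n → VField n M}
  [T2Space M]

/-! ### Closedness of the form of semi-compatibility -/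

theorem skew_mvfderiv_inner (hF : IsFlatFrame D V X)
    (hD : ∀ (x : M) (u v : TangentSpace (𝓡 n) x), D x u v = D x v u) {β : OneForm n M}
    (hs : ∀ x, HasSkewPart D β x) (x : M) (i j k : Fin n) :
    mvfderiv (𝓡 n) (fun y => inner ℝ (X i y) (X j y)) x (X k x)
      - mvfderiv (𝓡 n) (fun y => inner ℝ (X k y) (X j y)) x (X i x)
      = β x (X k x) * inner ℝ (X i x) (X j x) - β x (X i x) * inner ℝ (X k x) (X j x) := by
  rw [hF.mvfderiv_inner_sub hD, hs]

/-- Differentiate the skew identity for the Gram matrix in the third direction and sum cyclically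
over `i, k, l`. The second derivatives cancel because the frame commutes, and the first derivatives
of `g` by the skew identity itself. What remains is the vanishing of the inner product with each
`Xⱼ`; here `b` holds the components of `dβ`. -/
theorem cyclic_sum_eq_zero (hF : IsFlatFrame D V X)
    (hD : ∀ (x : M) (u v : TangentSpace (𝓡 n) x), D x u v = D x v u) {β : OneForm n M}
    (hβ : ∀ i, ContMDiff (𝓡 n) 𝓘(ℝ, ℝ) ∞ fun x => β x (X i x))
    (hs : ∀ x, HasSkewPart D β x) {b : M → Fin n → Fin n → ℝ}
    (hb : ∀ x i j, b x i j = mvfderiv (𝓡 n) (fun y => β y (X j y)) x (X i x)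
      - mvfderiv (𝓡 n) (fun y => β y (X i y)) x (X j x)) (x : M) (i k l : Fin n) :
    b x l k • X i x + b x k i • X l x + b x i l • X k x = 0 := by
  have hg : ∀ i j, ContMDiff (𝓡 n) 𝓘(ℝ, ℝ) ∞ fun y => (inner ℝ (X i y) (X j y) : ℝ) := fun i j =>
    (hF.smooth i).contMDiff_inner (hF.smooth j)
  have hmul : ∀ (k i j : Fin n) (u : TangentSpace (𝓡 n) x),
      mvfderiv (𝓡 n) (fun y => β y (X k y) * inner ℝ (X i y) (X j y)) x u
        = β x (X k x) * mvfderiv (𝓡 n) (fun y => inner ℝ (X i y) (X j y)) x u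
          + inner ℝ (X i x) (X j x) * mvfderiv (𝓡 n) (fun y => β y (X k y)) x u := by
    intro k i j u
    rw [mvfderiv_fun_mul ((hβ k).mdiffAt_real x) ((hg i j).mdiffAt_real x)]
    rfl
  have hd : ∀ (i j k : Fin n) (u : TangentSpace (𝓡 n) x),
      mvfderiv (𝓡 n) (fun y => mvfderiv (𝓡 n) (fun z => inner ℝ (X i z) (X j z)) y (X k y)) x u
        - mvfderiv (𝓡 n) (fun y => mvfderiv (𝓡 n) (fun z => inner ℝ (X k z) (X j z)) y (X i y)) x u
      = mvfderiv (𝓡 n) (fun y => β y (X k y) * inner ℝ (X i y) (X j y)) x u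
        - mvfderiv (𝓡 n) (fun y => β y (X i y) * inner ℝ (X k y) (X j y)) x u := by
    intro i j k u
    have hm : ∀ i j k, MDifferentiableAt (𝓡 n) 𝓘(ℝ, ℝ)
        (fun y => β y (X k y) * (inner ℝ (X i y) (X j y) : ℝ)) x := fun i j k =>
      ((hβ k).mul (hg i j)).mdiffAt_real x
    rw [← sub_apply, ← sub_apply,
      ← mvfderiv_fun_sub ((smooth_mvfderiv_apply (hg i j) (hF.smooth k)).mdiffAt_real x)
        ((smooth_mvfderiv_apply (hg k j) (hF.smooth i)).mdiffAt_real x),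
      ← mvfderiv_fun_sub (hm i j k) (hm k j i)]
    simp only [hF.skew_mvfderiv_inner hD hs]
  refine ext_inner_right ℝ fun w => ?_
  rw [inner_zero_left]
  revert w
  refine hF.induction (by simp) (fun u v hu hv => by rw [inner_add_right, hu, hv, add_zero])
    (fun c v hv => by rw [real_inner_smul_right, hv, mul_zero]) fun j => ?_
  have h1 := hd i j k (X l x)
  have h2 := hd l j i (X k x)
  have h3 := hd k j l (X i x)
  simp only [hmul] at h1 h2 h3
  have c1 := hF.mvfderiv_comm (hg i j) x l k
  have c2 := hF.mvfderiv_comm (hg l j) x k i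
  have c3 := hF.mvfderiv_comm (hg k j) x i l
  have s1 := hF.skew_mvfderiv_inner hD hs x i j l
  have s2 := hF.skew_mvfderiv_inner hD hs x l j k
  have s3 := hF.skew_mvfderiv_inner hD hs x k j i
  simp only [inner_add_left, real_inner_smul_left, hb]
  linear_combination -h1 - h2 - h3 + c1 + c2 + c3 - β x (X k x) * s1 - β x (X i x) * s2
    - β x (X l x) * s3

/-- Choose `i` different from `k` and `l`; the `Xᵢ`-component of the cyclic sum is the `(l, k)`
component of `dβ`. -/
theorem mvfderiv_form_comm_of_three_le (hF : IsFlatFrame D V X) (hn : 3 ≤ n)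
    (hD : ∀ (x : M) (u v : TangentSpace (𝓡 n) x), D x u v = D x v u) {β : OneForm n M}
    (hβ : ∀ i, ContMDiff (𝓡 n) 𝓘(ℝ, ℝ) ∞ fun x => β x (X i x))
    (hs : ∀ x, HasSkewPart D β x) (x : M) (k l : Fin n) :
    mvfderiv (𝓡 n) (fun y => β y (X k y)) x (X l x)
      = mvfderiv (𝓡 n) (fun y => β y (X l y)) x (X k x) := by
  by_cases hkl : k = l
  · rw [hkl]
  obtain ⟨i, hi⟩ : ∃ i, i ∉ ({k, l} : Finset (Fin n)) := by
    by_contra! hc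
    have h1 := Finset.card_le_two (a := k) (b := l)
    rw [Finset.eq_univ_iff_forall.2 hc, Finset.card_univ, Fintype.card_fin] at h1
    omega
  simp only [Finset.mem_insert, Finset.mem_singleton, not_or] at hi
  have h1 := congrArg (mvfderiv (𝓡 n) (V i) x)
    (hF.cyclic_sum_eq_zero hD hβ hs (fun _ _ _ => rfl) x i k l)
  simp only [map_add, map_smul, hF.dual, if_neg hi.1, if_neg hi.2, map_zero, smul_eq_mul,
    if_true, mul_zero, mul_one, add_zero] at h1
  linarith

/-! ### The Killing equation in a flat frame -/

theorem leviCivita_of_const (hF : IsFlatFrame D V X) {Y : VField n M} (hY : SmoothVField Y)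
    {c : Fin n → ℝ} (hc : ∀ x k, mvfderiv (𝓡 n) (V k) x (Y x) = c k) (x : M)
    (u : TangentSpace (𝓡 n) x) : leviCivita (𝓡 n) M Y x u = -D x u (Y x) := by
  refine hF.eq_of_mvfderiv_eq fun k => ?_
  have h1 := hessian_apply (V k).contMDiff (hY.mdiffAt x) u
  rw [hF.hessian_eq] at h1
  simp only [hc, mvfderiv_const, zero_apply, zero_sub] at h1
  rw [map_neg, h1, neg_neg]

theorem killing_of_const (hF : IsFlatFrame D V X) {K : EndField n M} (hK : IsKillingTensor K)
    {Y : VField n M} (hY : SmoothVField Y)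
    {c : Fin n → ℝ} (hc : ∀ x k, mvfderiv (𝓡 n) (V k) x (Y x) = c k) (x : M) :
    mvfderiv (𝓡 n) (fun y => inner ℝ (K y (Y y)) (Y y)) x (Y x)
      + 2 * inner ℝ (K x (Y x)) (D x (Y x) (Y x)) = 0 := by
  have h1 := hK.killing Y hY x
  rw [hF.leviCivita_of_const hY hc, hK.symm x (-D x (Y x) (Y x)), inner_neg_left, inner_neg_right,
    real_inner_comm] at h1
  linarith

theorem killing_pair (hF : IsFlatFrame D V X)
    (hD : ∀ (x : M) (u v : TangentSpace (𝓡 n) x), D x u v = D x v u)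
    {K : EndField n M} (hK : IsKillingTensor K) (x : M) (i j : Fin n) :
    (mvfderiv (𝓡 n) (fun y => inner ℝ (K y (X i y)) (X i y)) x (X i x)
      + 2 * inner ℝ (K x (X i x)) (D x (X i x) (X i x)) = 0) ∧
    (mvfderiv (𝓡 n) (fun y => inner ℝ (K y (X i y)) (X i y)) x (X j x)
      + 2 * mvfderiv (𝓡 n) (fun y => inner ℝ (K y (X i y)) (X j y)) x (X i x)
      + 2 * inner ℝ (K x (X j x)) (D x (X i x) (X i x))
      + 4 * inner ℝ (K x (X i x)) (D x (X i x) (X j x)) = 0) ∧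
    (mvfderiv (𝓡 n) (fun y => inner ℝ (K y (X j y)) (X j y)) x (X i x)
      + 2 * mvfderiv (𝓡 n) (fun y => inner ℝ (K y (X i y)) (X j y)) x (X j x)
      + 2 * inner ℝ (K x (X i x)) (D x (X j x) (X j x))
      + 4 * inner ℝ (K x (X j x)) (D x (X i x) (X j x)) = 0) := by
  have hm : ∀ i j, MDifferentiableAt (𝓡 n) 𝓘(ℝ, ℝ)
      (fun y => (inner ℝ (K y (X i y)) (X j y) : ℝ)) x := fun i j =>
    ((hK.smooth _ (hF.smooth i)).contMDiff_inner (hF.smooth j)).mdiffAt_real x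
  -- `Xᵢ + ε Xⱼ` has constant components, so its Killing equation is a cubic polynomial in `ε`. Its
  -- values at `0, 1, -1, 2` isolate the coefficients.
  have key : ∀ ε : ℝ, _ := fun ε => hF.killing_of_const hK
    (Y := fun y => X i y + ε • X j y) ((hF.smooth i).add ((hF.smooth j).const_smul ε))
    (c := fun k => (if k = i then 1 else 0) + ε * (if k = j then 1 else 0))
    (fun x k => by rw [map_add, map_smul, hF.dual, hF.dual, smul_eq_mul]) x
  have he : ∀ ε : ℝ, (fun y => (inner ℝ (K y (X i y + ε • X j y)) (X i y + ε • X j y) : ℝ))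
      = fun y => (inner ℝ (K y (X i y)) (X i y) + 2 * ε * inner ℝ (K y (X i y)) (X j y))
        + ε ^ 2 * inner ℝ (K y (X j y)) (X j y) := by
    intro ε
    ext y
    have := hK.symm y (X i y) (X j y)
    rw [real_inner_comm] at this
    simp only [map_add, map_smul, inner_add_left, inner_add_right, real_inner_smul_left,
      real_inner_smul_right]
    rw [hK.symm y (X j y) (X i y), real_inner_comm (X j y)]
    ring
  have hder : ∀ (ε : ℝ) (u : TangentSpace (𝓡 n) x), mvfderiv (𝓡 n)
      (fun y => (inner ℝ (K y (X i y + ε • X j y)) (X i y + ε • X j y) : ℝ)) x u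
      = mvfderiv (𝓡 n) (fun y => inner ℝ (K y (X i y)) (X i y)) x u
        + 2 * ε * mvfderiv (𝓡 n) (fun y => inner ℝ (K y (X i y)) (X j y)) x u
        + ε ^ 2 * mvfderiv (𝓡 n) (fun y => inner ℝ (K y (X j y)) (X j y)) x u := by
    intro ε u
    have h1 : MDifferentiableAt (𝓡 n) 𝓘(ℝ, ℝ)
        (fun y => 2 * ε * (inner ℝ (K y (X i y)) (X j y) : ℝ)) x :=
      mdifferentiableAt_const.mul (hm i j)
    have h2 : MDifferentiableAt (𝓡 n) 𝓘(ℝ, ℝ)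
        (fun y => ε ^ 2 * (inner ℝ (K y (X j y)) (X j y) : ℝ)) x :=
      mdifferentiableAt_const.mul (hm j j)
    have h3 : MDifferentiableAt (𝓡 n) 𝓘(ℝ, ℝ) (fun y => (inner ℝ (K y (X i y)) (X i y) : ℝ)
        + 2 * ε * (inner ℝ (K y (X i y)) (X j y) : ℝ)) x := (hm i i).add h1
    rw [he, mvfderiv_fun_add h3 h2, mvfderiv_fun_add (hm i i) h1,
      mvfderiv_fun_mul mdifferentiableAt_const (hm i j),
      mvfderiv_fun_mul mdifferentiableAt_const (hm j j), mvfderiv_const, mvfderiv_const]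
    simp
  simp only [hder] at key
  simp only [map_add, map_smul, add_apply, smul_apply, smul_add, inner_add_left,
    inner_add_right, real_inner_smul_left, real_inner_smul_right, smul_eq_mul,
    hD x (X j x) (X i x)] at key
  have k0 := key 0
  have k1 := key 1
  have k2 := key (-1)
  have k3 := key 2
  refine ⟨?_, ?_, ?_⟩ <;> linarith

end IsFlatFrame
end
end Superint
end
noncomputable section
namespace Superint

/-! ### Killing tensors of a surface in a flat frame -/

/-- The first derivatives of a Killing tensor with closed potentials in a flat frame `X₁, X₂` of a
surface. Here `(a, b, c)` is the Gram matrix, `KX₁ = p X₁ + q X₂`, `KX₂ = r X₁ + t X₂`, and `f₁`,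
`f₂` are the derivatives of `f`. -/
theorem surface_killing_deriv {a b c a₁ a₂ b₁ b₂ c₁ c₂ B₁ B₂ p q r t p₁ q₁ p₂ q₂ r₁ t₁ D₁₁₁ D₁₁₂ D₁₂₁ D₁₂₂
    D₂₂₁ D₂₂₂ : ℝ} (ha₁ : a₁ = -2 * D₁₁₁) (ha₂ : a₂ = -2 * D₁₂₁) (hb₁ : b₁ = -D₁₁₂ - D₁₂₁)
    (hb₂ : b₂ = -D₂₂₁ - D₁₂₂) (hc₁ : c₁ = -2 * D₁₂₂) (hc₂ : c₂ = -2 * D₂₂₂)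
    (h₁ : b₁ - a₂ = B₁ * b - B₂ * a)
    (hs : p * b + q * c = r * a + t * b) (hr : r₁ = p₂) (ht : t₁ = q₂)
    (hs₁ : p₁ * b + p * b₁ + (q₁ * c + q * c₁) = r₁ * a + r * a₁ + (t₁ * b + t * b₁))
    (hk₁ : p₁ * a + p * a₁ + (q₁ * b + q * b₁) + 2 * (p * D₁₁₁ + q * D₁₁₂) = 0)
    (hk₂ : p₂ * a + p * a₂ + (q₂ * b + q * b₂) + 2 * (p₁ * b + p * b₁ + (q₁ * c + q * c₁))
      + 2 * (r * D₁₁₁ + t * D₁₁₂) + 4 * (p * D₁₂₁ + q * D₁₂₂) = 0)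
    (hk₃ : r₁ * b + r * b₁ + (t₁ * c + t * c₁) + 2 * (p₂ * b + p * b₂ + (q₂ * c + q * c₂))
      + 2 * (p * D₂₂₁ + q * D₂₂₂) + 4 * (r * D₁₂₁ + t * D₁₂₂) = 0) :
    3 * a * (a * c - b ^ 2) * q₁ = (a ^ 2 * (a₂ - 3 * b₁) + 2 * a * a₁ * b) * (p - t)
      + (-a ^ 2 * (c₁ + b₂) + 2 * a * a₁ * c - 3 * a * b * (B₁ * b - B₂ * a)) * q ∧
    3 * a * (a * c - b ^ 2) * (p₁ - t₁)
      = (-2 * a * b * a₂ + 4 * a * b * b₁ - 3 * b ^ 2 * a₁ + a ^ 2 * c₁) * (p - t)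
      + (3 * a * c * (B₁ * b - B₂ * a) + a * b * (c₁ + b₂) - 3 * a₁ * b * c + a ^ 2 * c₂
        - a * c * (2 * a₂ - b₁) + a * b * (2 * c₁ - b₂)) * q := by
  -- As for Christoffel symbols, the components of `D` are determined by the first derivatives of
  -- the Gram matrix.
  have e₁ : D₁₁₁ = -a₁ / 2 := by linarith
  have e₂ : D₁₂₁ = -a₂ / 2 := by linarith
  have e₃ : D₁₁₂ = -b₁ + a₂ / 2 := by linarith
  have e₄ : D₁₂₂ = -c₁ / 2 := by linarith
  have e₅ : D₂₂₁ = -b₂ + c₁ / 2 := by linarith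
  have e₆ : D₂₂₂ = -c₂ / 2 := by linarith
  subst hr ht
  rw [hs₁] at hk₂
  rw [e₁, e₃] at hk₁ hk₂
  rw [e₂, e₄] at hk₂ hk₃
  rw [e₅, e₆] at hk₃
  -- `hA` and `hR` are two linear equations for `p₁, q₁`, while `hS` and `hS'` are two for `r₁, t₁`;
  -- the conclusions come from solving them by Cramer's rule.
  have hA : p₁ * a + q₁ * b = q * (B₁ * b - B₂ * a) := by linear_combination hk₁ + q * h₁
  have hS : 3 * (r₁ * a + t₁ * b) = p * a₂ + 2 * q * c₁ - q * b₂ - r * a₁ - t * a₂ := by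
    linear_combination hk₂
  have hS' : 3 * (r₁ * b + t₁ * c) = t * c₁ + 2 * r * a₂ - r * b₁ - q * c₂ - p * c₁ := by
    linear_combination hk₃
  have hR : 3 * (p₁ * b + q₁ * c) = (p - t) * (a₂ - 3 * b₁) - q * (c₁ + b₂) + 2 * r * a₁ := by
    linear_combination 3 * hs₁ + hS
  constructor
  · linear_combination a ^ 2 * hR - 3 * a * b * hA - 2 * a * a₁ * hs
  · linear_combination 3 * a * c * hA - a * b * hR - a ^ 2 * hS' + a * b * hS
      + (2 * b * a₁ + a * (2 * a₂ - b₁) + b * a₁) * hs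

/-- Two Killing tensors of a surface determine the form of semi-compatibility. -/
theorem surface_form_eq {a b c a₁ a₂ b₁ b₂ c₁ c₂ B₁ B₂ y q y₁ q₁ y' q' y₁' q₁' : ℝ}
    (h₁ : b₁ - a₂ = B₁ * b - B₂ * a) (h₂ : c₁ - b₂ = B₁ * c - B₂ * b)
    (hq : 3 * a * (a * c - b ^ 2) * q₁ = (a ^ 2 * (a₂ - 3 * b₁) + 2 * a * a₁ * b) * y
      + (-a ^ 2 * (c₁ + b₂) + 2 * a * a₁ * c - 3 * a * b * (B₁ * b - B₂ * a)) * q)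
    (hy : 3 * a * (a * c - b ^ 2) * y₁
      = (-2 * a * b * a₂ + 4 * a * b * b₁ - 3 * b ^ 2 * a₁ + a ^ 2 * c₁) * y
      + (3 * a * c * (B₁ * b - B₂ * a) + a * b * (c₁ + b₂) - 3 * a₁ * b * c + a ^ 2 * c₂
        - a * c * (2 * a₂ - b₁) + a * b * (2 * c₁ - b₂)) * q)
    (hq' : 3 * a * (a * c - b ^ 2) * q₁' = (a ^ 2 * (a₂ - 3 * b₁) + 2 * a * a₁ * b) * y'
      + (-a ^ 2 * (c₁ + b₂) + 2 * a * a₁ * c - 3 * a * b * (B₁ * b - B₂ * a)) * q')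
    (hy' : 3 * a * (a * c - b ^ 2) * y₁'
      = (-2 * a * b * a₂ + 4 * a * b * b₁ - 3 * b ^ 2 * a₁ + a ^ 2 * c₁) * y'
      + (3 * a * c * (B₁ * b - B₂ * a) + a * b * (c₁ + b₂) - 3 * a₁ * b * c + a ^ 2 * c₂
        - a * c * (2 * a₂ - b₁) + a * b * (2 * c₁ - b₂)) * q') :
    3 * ((q₁ * y' + q * y₁' - (y₁ * q' + y * q₁')) * a - (q * y' - y * q') * a₁)
        * (a * c - b ^ 2)
      + (q * y' - y * q') * a * (a₁ * c + a * c₁ - 2 * b * b₁)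
      = B₁ * ((q * y' - y * q') * a * (a * c - b ^ 2)) := by
  -- Liouville's formula: `(q, y)` and `(q', y')` solve the same linear system, so the derivative of
  -- `q y' - y q'` involves only the trace of the coefficient matrix, and that trace contains `B₁`.
  linear_combination y' * hq + q * hy' - q' * hy - y * hq'
    + (q * y' - y * q') * (2 * a * b * h₁ + a ^ 2 * h₂)

end Superint
end
-- Killing tensors of a surface: components and their minors
noncomputable section
namespace Superint

section
variable {n : ℕ} {M : Type*} [TopologicalSpace M] [ChartedSpace (EuclideanSpace ℝ (Fin n)) M]
  [IsManifold (𝓡 n) ∞ M] [RiemannianBundle (fun x : M => TangentSpace (𝓡 n) x)]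
  [IsContMDiffRiemannianBundle (𝓡 n) ∞ (EuclideanSpace ℝ (Fin n))
  (fun x : M => TangentSpace (𝓡 n) x)]

theorem mvfderiv_mul_add_mul {f g h k : M → ℝ} (hf : ContMDiff (𝓡 n) 𝓘(ℝ, ℝ) ∞ f)
    (hg : ContMDiff (𝓡 n) 𝓘(ℝ, ℝ) ∞ g) (hh : ContMDiff (𝓡 n) 𝓘(ℝ, ℝ) ∞ h)
    (hk : ContMDiff (𝓡 n) 𝓘(ℝ, ℝ) ∞ k) (x : M) (v : TangentSpace (𝓡 n) x) :
    mvfderiv (𝓡 n) (fun y => f y * g y + h y * k y) x v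
      = mvfderiv (𝓡 n) f x v * g x + f x * mvfderiv (𝓡 n) g x v
        + (mvfderiv (𝓡 n) h x v * k x + h x * mvfderiv (𝓡 n) k x v) := by
  have h1 : MDifferentiableAt (𝓡 n) 𝓘(ℝ, ℝ) (fun y => f y * g y) x := (hf.mul hg).mdiffAt_real x
  have h2 : MDifferentiableAt (𝓡 n) 𝓘(ℝ, ℝ) (fun y => h y * k y) x := (hh.mul hk).mdiffAt_real x
  rw [mvfderiv_fun_add h1 h2, mvfderiv_fun_mul (hf.mdiffAt_real x) (hg.mdiffAt_real x),
    mvfderiv_fun_mul (hh.mdiffAt_real x) (hk.mdiffAt_real x)]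
  simp only [add_apply, smul_apply, smul_eq_mul]
  ring

theorem mvfderiv_mul_sub_mul {f g h k : M → ℝ} (hf : ContMDiff (𝓡 n) 𝓘(ℝ, ℝ) ∞ f)
    (hg : ContMDiff (𝓡 n) 𝓘(ℝ, ℝ) ∞ g) (hh : ContMDiff (𝓡 n) 𝓘(ℝ, ℝ) ∞ h)
    (hk : ContMDiff (𝓡 n) 𝓘(ℝ, ℝ) ∞ k) (x : M) (v : TangentSpace (𝓡 n) x) :
    mvfderiv (𝓡 n) (fun y => f y * g y - h y * k y) x v
      = mvfderiv (𝓡 n) f x v * g x + f x * mvfderiv (𝓡 n) g x v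
        - (mvfderiv (𝓡 n) h x v * k x + h x * mvfderiv (𝓡 n) k x v) := by
  have h1 : MDifferentiableAt (𝓡 n) 𝓘(ℝ, ℝ) (fun y => f y * g y) x := (hf.mul hg).mdiffAt_real x
  have h2 : MDifferentiableAt (𝓡 n) 𝓘(ℝ, ℝ) (fun y => h y * k y) x := (hh.mul hk).mdiffAt_real x
  rw [mvfderiv_fun_sub h1 h2, mvfderiv_fun_mul (hf.mdiffAt_real x) (hg.mdiffAt_real x),
    mvfderiv_fun_mul (hh.mdiffAt_real x) (hk.mdiffAt_real x)]
  simp only [add_apply, sub_apply, smul_apply, smul_eq_mul]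
  ring

namespace IsFlatFrame
variable {D : BilinField n M} {V : Fin n → C^∞⟮𝓡 n, M; ℝ⟯} {X : Fin n → VField n M}
  [T2Space M]

theorem mlieBracket_eq_zero (hF : IsFlatFrame D V X)
    (hD : ∀ (x : M) (u v : TangentSpace (𝓡 n) x), D x u v = D x v u) (x : M) (i j : Fin n) :
    mlieBracket (𝓡 n) (X i) (X j) x = 0 := by
  have h := (CovariantDerivative.torsion_eq_zero_iff (leviCivita (𝓡 n) M)).1 leviCivita_torsion
    ((hF.smooth i).mdiffAt x) ((hF.smooth j).mdiffAt x)
  rw [← h, hF.leviCivita_eq, hF.leviCivita_eq, hD x (X i x), sub_self]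

/-- The components `dVₖ(KXᵢ)` of an endomorphism field. -/
def component (V : Fin n → C^∞⟮𝓡 n, M; ℝ⟯) (X : Fin n → VField n M) (K : EndField n M)
    (k i : Fin n) (x : M) : ℝ := mvfderiv (𝓡 n) (V k) x (K x (X i x))

theorem smooth_component (hF : IsFlatFrame D V X) {K : EndField n M} (hK : IsKillingTensor K)
    (k i : Fin n) : ContMDiff (𝓡 n) 𝓘(ℝ, ℝ) ∞ (component V X K k i) :=
  smooth_mvfderiv_apply (V k).contMDiff (hK.smooth _ (hF.smooth i))

theorem mvfderiv_component_comm (hF : IsFlatFrame D V X)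
    (hD : ∀ (x : M) (u v : TangentSpace (𝓡 n) x), D x u v = D x v u) {K : EndField n M}
    {k : Fin n} (hc : IsClosedOneForm fun x => (differential (n := n) (V k) x).comp (K x)) (x : M)
    (i j : Fin n) : mvfderiv (𝓡 n) (component V X K k j) x (X i x)
      = mvfderiv (𝓡 n) (component V X K k i) x (X j x) := by
  have h := hc (X i) (X j) (hF.smooth i) (hF.smooth j) x
  rw [hF.mlieBracket_eq_zero hD, map_zero, sub_zero, sub_eq_zero] at h
  exact h

section surface
variable {i j : Fin n}

theorem gram_ne_zero (hF : IsFlatFrame D V X) (hij : i ≠ j) (x : M) :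
    (inner ℝ (X i x) (X i x) : ℝ) * inner ℝ (X j x) (X j x) - (inner ℝ (X i x) (X j x) : ℝ) ^ 2
      ≠ 0 := by
  intro h
  have hw : (inner ℝ (X j x) (X j x) : ℝ) • X i x - (inner ℝ (X i x) (X j x) : ℝ) • X j x = 0 := by
    rw [← inner_self_eq_zero (𝕜 := ℝ)]
    simp only [inner_sub_left, inner_sub_right, real_inner_smul_left, real_inner_smul_right,
      real_inner_comm (X i x) (X j x)]
    linear_combination (inner ℝ (X j x) (X j x) : ℝ) * h
  have h1 := congrArg (mvfderiv (𝓡 n) (V i) x) hw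
  simp only [map_sub, map_smul, hF.dual, if_neg hij, if_true, map_zero, smul_eq_mul, mul_one,
    mul_zero, sub_zero] at h1
  exact (hF.inner_self_pos x j).ne' h1

theorem inner_apply_of_span (hspan : ∀ (x : M) (v : TangentSpace (𝓡 n) x),
      v = mvfderiv (𝓡 n) (V i) x v • X i x + mvfderiv (𝓡 n) (V j) x v • X j x)
    (K : EndField n M) (k : Fin n) (x : M) (w : TangentSpace (𝓡 n) x) :
    (inner ℝ (K x (X k x)) w : ℝ) = component V X K i k x * inner ℝ (X i x) w
      + component V X K j k x * inner ℝ (X j x) w := by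
  conv_lhs => rw [hspan x (K x (X k x))]
  rw [inner_add_left, real_inner_smul_left, real_inner_smul_left]
  rfl

/-- `q (p' - t') - (p - t) q'`, where `KX₁ = p X₁ + q X₂`, `KX₂ = r X₁ + t X₂`. -/
def minor (V : Fin n → C^∞⟮𝓡 n, M; ℝ⟯) (X : Fin n → VField n M) (i j : Fin n) (K L : EndField n M)
    (x : M) : ℝ :=
  component V X K j i x * (component V X L i i x - component V X L j j x)
    - (component V X K i i x - component V X K j j x) * component V X L j i x

theorem component_symm (hspan : ∀ (x : M) (v : TangentSpace (𝓡 n) x),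
      v = mvfderiv (𝓡 n) (V i) x v • X i x + mvfderiv (𝓡 n) (V j) x v • X j x)
    {K : EndField n M} (hK : IsKillingTensor K) (x : M) :
    component V X K i i x * inner ℝ (X i x) (X j x) + component V X K j i x * inner ℝ (X j x) (X j x)
      = component V X K i j x * inner ℝ (X i x) (X i x)
        + component V X K j j x * inner ℝ (X i x) (X j x) := by
  rw [← inner_apply_of_span hspan, hK.symm, real_inner_comm, inner_apply_of_span hspan,
    real_inner_comm (X i x) (X j x)]

/-- Self-adjointness makes `minor / gᵢᵢ` equal to `g(KXⱼ, LXᵢ) - g(KXᵢ, LXⱼ)` over the Gram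
determinant, which is odd in `i, j`. Thus a formula for the `Xᵢ`-derivative also yields the one for
`Xⱼ`. -/
theorem minor_swap (hF : IsFlatFrame D V X) (hspan : ∀ (x : M) (v : TangentSpace (𝓡 n) x),
      v = mvfderiv (𝓡 n) (V i) x v • X i x + mvfderiv (𝓡 n) (V j) x v • X j x)
    {K L : EndField n M} (hK : IsKillingTensor K) (hL : IsKillingTensor L) (x : M) :
    minor V X j i K L x / inner ℝ (X j x) (X j x) = -(minor V X i j K L x / inner ℝ (X i x) (X i x)) := by
  have h1 := component_symm hspan hK x
  have h2 := component_symm hspan hL x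
  have h3 := (hF.inner_self_pos x i).ne'
  have h4 := (hF.inner_self_pos x j).ne'
  rw [← neg_div, div_eq_div_iff h4 h3, minor, minor]
  linear_combination (component V X L i i x - component V X L j j x) * h1
    - (component V X K i i x - component V X K j j x) * h2

theorem smooth_minor (hF : IsFlatFrame D V X) {K L : EndField n M}
    (hK : IsKillingTensor K) (hL : IsKillingTensor L) :
    ContMDiff (𝓡 n) 𝓘(ℝ, ℝ) ∞ (minor V X i j K L) :=
  ((hF.smooth_component hK j i).mul
    ((hF.smooth_component hL i i).sub (hF.smooth_component hL j j))).sub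
  (((hF.smooth_component hK i i).sub (hF.smooth_component hK j j)).mul (hF.smooth_component hL j i))

/-- With `l = minor / gᵢᵢ` and `Δ` the Gram determinant, this says that the logarithmic derivative
of `l³ Δ` along `Xᵢ` is `β(Xᵢ)`, written without dividing by `l` or `Δ`. -/
theorem surface_mvfderiv (hF : IsFlatFrame D V X)
    (hD : ∀ (x : M) (u v : TangentSpace (𝓡 n) x), D x u v = D x v u)
    (hspan : ∀ (x : M) (v : TangentSpace (𝓡 n) x),
      v = mvfderiv (𝓡 n) (V i) x v • X i x + mvfderiv (𝓡 n) (V j) x v • X j x)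
    {β : OneForm n M} (hs : ∀ x, HasSkewPart D β x) {K L : EndField n M}
    (hK : IsKillingTensor K) (hL : IsKillingTensor L)
    (hKc : ∀ k, IsClosedOneForm fun x => (differential (n := n) (V k) x).comp (K x))
    (hLc : ∀ k, IsClosedOneForm fun x => (differential (n := n) (V k) x).comp (L x)) (x : M) :
    3 * mvfderiv (𝓡 n) (fun y => minor V X i j K L y / inner ℝ (X i y) (X i y)) x (X i x)
        * (inner ℝ (X i x) (X i x) * inner ℝ (X j x) (X j x) - (inner ℝ (X i x) (X j x) : ℝ) ^ 2)
      + minor V X i j K L x / inner ℝ (X i x) (X i x)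
        * mvfderiv (𝓡 n) (fun y => inner ℝ (X i y) (X i y) * inner ℝ (X j y) (X j y)
          - (inner ℝ (X i y) (X j y) : ℝ) ^ 2) x (X i x)
      = β x (X i x) * (minor V X i j K L x / inner ℝ (X i x) (X i x)
        * (inner ℝ (X i x) (X i x) * inner ℝ (X j x) (X j x)
          - (inner ℝ (X i x) (X j x) : ℝ) ^ 2)) := by
  have hg : ∀ k l, ContMDiff (𝓡 n) 𝓘(ℝ, ℝ) ∞ fun y => (inner ℝ (X k y) (X l y) : ℝ) := fun k l =>
    (hF.smooth k).contMDiff_inner (hF.smooth l)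
  have hgs : ∀ y, (inner ℝ (X j y) (X i y) : ℝ) = inner ℝ (X i y) (X j y) := fun y =>
    real_inner_comm _ _
  have g11 := hF.mvfderiv_inner x i i
  have g12 := hF.mvfderiv_inner x i j
  have g22 := hF.mvfderiv_inner x j j
  simp only [real_inner_comm _ (D x _ _)] at g11 g12 g22
  have s1 := hF.skew_mvfderiv_inner hD hs x j i i
  have s2 := hF.skew_mvfderiv_inner hD hs x j j i
  simp only [hgs] at s1 s2
  have hKilling : ∀ {K : EndField n M}, IsKillingTensor K →
      (∀ k, IsClosedOneForm fun x => (differential (n := n) (V k) x).comp (K x)) → _ :=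
    fun {K} hK hKc => by
      have hc := hF.smooth_component hK
      have e21 : (fun y => component V X K i i y * inner ℝ (X i y) (X j y)
            + component V X K j i y * inner ℝ (X j y) (X j y)) = fun y =>
          component V X K i j y * inner ℝ (X i y) (X i y)
            + component V X K j j y * inner ℝ (X i y) (X j y) := by
        ext y
        exact component_symm hspan hK y
      have hs1 := congrArg (fun f => mvfderiv (𝓡 n) f x (X i x)) e21
      simp only [mvfderiv_mul_add_mul (hc _ _) (hg _ _) (hc _ _) (hg _ _)] at hs1
      obtain ⟨k1, k2, k3⟩ := hF.killing_pair hD hK x i j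
      simp only [inner_apply_of_span hspan K, hgs,
        mvfderiv_mul_add_mul (hc _ _) (hg _ _) (hc _ _) (hg _ _)] at k1 k2 k3
      exact surface_killing_deriv (a := inner ℝ (X i x) (X i x)) (b := inner ℝ (X i x) (X j x))
        (c := inner ℝ (X j x) (X j x))
        (a₁ := mvfderiv (𝓡 n) (fun y => inner ℝ (X i y) (X i y)) x (X i x))
        (a₂ := mvfderiv (𝓡 n) (fun y => inner ℝ (X i y) (X i y)) x (X j x))
        (b₁ := mvfderiv (𝓡 n) (fun y => inner ℝ (X i y) (X j y)) x (X i x))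
        (b₂ := mvfderiv (𝓡 n) (fun y => inner ℝ (X i y) (X j y)) x (X j x))
        (c₁ := mvfderiv (𝓡 n) (fun y => inner ℝ (X j y) (X j y)) x (X i x))
        (c₂ := mvfderiv (𝓡 n) (fun y => inner ℝ (X j y) (X j y)) x (X j x))
        (D₁₁₁ := inner ℝ (X i x) (D x (X i x) (X i x)))
        (D₁₁₂ := inner ℝ (X j x) (D x (X i x) (X i x)))
        (D₁₂₁ := inner ℝ (X i x) (D x (X i x) (X j x)))
        (D₁₂₂ := inner ℝ (X j x) (D x (X i x) (X j x)))
        (D₂₂₁ := inner ℝ (X i x) (D x (X j x) (X j x)))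
        (D₂₂₂ := inner ℝ (X j x) (D x (X j x) (X j x)))
        (B₁ := β x (X i x)) (B₂ := β x (X j x))
        (by rw [g11]; ring) (by rw [g11, hD x (X j x)]; ring) (g12 i)
        (by rw [g12, hD x (X j x) (X i x)]; ring) (by rw [g22]; ring) (by rw [g22]; ring)
        (by linarith) (component_symm hspan hK x)
        (hF.mvfderiv_component_comm hD (hKc i) x i j)
        (hF.mvfderiv_component_comm hD (hKc j) x i j) hs1
        (by linarith) (by linarith) (by linarith)
  have h1 := hKilling hK hKc
  have h2 := hKilling hL hLc
  have key := surface_form_eq (by linarith) (by linarith) h1.1 h1.2 h2.1 h2.2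
  have hKc := hF.smooth_component hK
  have hLc := hF.smooth_component hL
  have hgΔ := mvfderiv_mul_sub_mul (hg i i) (hg j j) (hg i j) (hg i j) x (X i x)
  have hminor := mvfderiv_mul_sub_mul (hKc j i) ((hLc i i).sub (hLc j j))
    ((hKc i i).sub (hKc j j)) (hLc j i) x (X i x)
  have hsub := fun {f g : M → ℝ} (hf : ContMDiff (𝓡 n) 𝓘(ℝ, ℝ) ∞ f)
    (hg : ContMDiff (𝓡 n) 𝓘(ℝ, ℝ) ∞ g) => congrArg (fun L => L (X i x))
    (mvfderiv_fun_sub (hf.mdiffAt_real x) (hg.mdiffAt_real x))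
  have ha0 := fun y => (hF.inner_self_pos y i).ne'
  have hquot : ContMDiff (𝓡 n) 𝓘(ℝ, ℝ) ∞ fun y => minor V X i j K L y / inner ℝ (X i y) (X i y) :=
    (hF.smooth_minor hK hL).div₀ (hg i i) ha0
  -- The derivative of the quotient is obtained by differentiating `(minor / gᵢᵢ) * gᵢᵢ = minor`.
  have hmul := congrArg (fun f => mvfderiv (𝓡 n) f x (X i x))
    (funext fun y => (div_mul_cancel₀ (minor V X i j K L y) (ha0 y)))
  rw [mvfderiv_fun_mul (hquot.mdiffAt_real x) ((hg i i).mdiffAt_real x)] at hmul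
  change _ = mvfderiv (𝓡 n) (fun y => _ - _) x (X i x) at hmul
  simp only [add_apply, smul_apply, smul_eq_mul] at hmul
  rw [hminor, hsub (hLc i i) (hLc j j), hsub (hKc i i) (hKc j j)] at hmul
  simp only [sub_apply] at hmul
  simp only [pow_two, hgΔ]
  have ha := ha0 x
  have hN : minor V X i j K L x / inner ℝ (X i x) (X i x) * inner ℝ (X i x) (X i x)
      = component V X K j i x * (component V X L i i x - component V X L j j x)
        - (component V X K i i x - component V X K j j x) * component V X L j i x :=
    div_mul_cancel₀ _ ha
  generalize minor V X i j K L x / inner ℝ (X i x) (X i x) = l at hN hmul ⊢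
  generalize mvfderiv (𝓡 n) (fun y => minor V X i j K L y / inner ℝ (X i y) (X i y)) x (X i x)
    = l₁ at hmul ⊢
  generalize (inner ℝ (X i x) (X i x) : ℝ) = a at *
  generalize (inner ℝ (X i x) (X j x) : ℝ) = b at *
  generalize (inner ℝ (X j x) (X j x) : ℝ) = c at *
  generalize mvfderiv (𝓡 n) (fun y => inner ℝ (X i y) (X i y)) x (X i x) = a₁ at *
  generalize mvfderiv (𝓡 n) (fun y => inner ℝ (X i y) (X j y)) x (X i x) = b₁ at *
  generalize mvfderiv (𝓡 n) (fun y => inner ℝ (X j y) (X j y)) x (X i x) = c₁ at *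
  refine mul_left_cancel₀ (pow_ne_zero 2 ha) ?_
  linear_combination key + 3 * a * (a * c - b ^ 2) * hmul + (-3 * a₁ * (a * c - b ^ 2)
    + a * (a₁ * c + a * c₁ - 2 * b * b₁) - β x (X i x) * a * (a * c - b ^ 2)) * hN

end surface
end IsFlatFrame
end
end Superint
end
-- Closedness of the form in dimension two
noncomputable section
namespace Superint

section
variable {n : ℕ} {M : Type*} [TopologicalSpace M] [ChartedSpace (EuclideanSpace ℝ (Fin n)) M]
  [IsManifold (𝓡 n) ∞ M] [RiemannianBundle (fun x : M => TangentSpace (𝓡 n) x)]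
  [IsContMDiffRiemannianBundle (𝓡 n) ∞ (EuclideanSpace ℝ (Fin n))
  (fun x : M => TangentSpace (𝓡 n) x)]

namespace IsFlatFrame
variable {D : BilinField n M} {V : Fin n → C^∞⟮𝓡 n, M; ℝ⟯} {X : Fin n → VField n M}
  [T2Space M] {i j : Fin n}

/-- The function `Q = l³ Δ` satisfies `dQ = β Q`. Commuting `Xᵢ` and `Xⱼ` on `Q` gives `Q dβ = 0`,
and `Q ≠ 0` where the minor is nonzero. -/
theorem mvfderiv_form_comm_of_surface (hF : IsFlatFrame D V X)
    (hD : ∀ (x : M) (u v : TangentSpace (𝓡 n) x), D x u v = D x v u) (hij : i ≠ j)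
    (hspan : ∀ (x : M) (v : TangentSpace (𝓡 n) x),
      v = mvfderiv (𝓡 n) (V i) x v • X i x + mvfderiv (𝓡 n) (V j) x v • X j x)
    {β : OneForm n M} (hβ : ∀ i, ContMDiff (𝓡 n) 𝓘(ℝ, ℝ) ∞ fun x => β x (X i x))
    (hs : ∀ x, HasSkewPart D β x) {K L : EndField n M}
    (hK : IsKillingTensor K) (hL : IsKillingTensor L)
    (hKc : ∀ k, IsClosedOneForm fun x => (differential (n := n) (V k) x).comp (K x))
    (hLc : ∀ k, IsClosedOneForm fun x => (differential (n := n) (V k) x).comp (L x)) {x : M}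
    (hx : minor V X i j K L x ≠ 0) :
    mvfderiv (𝓡 n) (fun y => β y (X j y)) x (X i x)
      = mvfderiv (𝓡 n) (fun y => β y (X i y)) x (X j x) := by
  have hg : ∀ k l, ContMDiff (𝓡 n) 𝓘(ℝ, ℝ) ∞ fun y => (inner ℝ (X k y) (X l y) : ℝ) := fun k l =>
    (hF.smooth k).contMDiff_inner (hF.smooth l)
  let l : M → ℝ := fun y => minor V X i j K L y / inner ℝ (X i y) (X i y)
  let Δ : M → ℝ := fun y => inner ℝ (X i y) (X i y) * inner ℝ (X j y) (X j y)
    - (inner ℝ (X i y) (X j y) : ℝ) ^ 2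
  have hl : ContMDiff (𝓡 n) 𝓘(ℝ, ℝ) ∞ l :=
    (hF.smooth_minor hK hL).div₀ (hg i i) fun y => (hF.inner_self_pos y i).ne'
  have hΔ : ContMDiff (𝓡 n) 𝓘(ℝ, ℝ) ∞ Δ := ((hg i i).mul (hg j j)).sub ((hg i j).pow 2)
  have hi : ∀ y, 3 * mvfderiv (𝓡 n) l y (X i y) * Δ y + l y * mvfderiv (𝓡 n) Δ y (X i y)
      = β y (X i y) * (l y * Δ y) := hF.surface_mvfderiv hD hspan hs hK hL hKc hLc
  have hj : ∀ y, 3 * mvfderiv (𝓡 n) l y (X j y) * Δ y + l y * mvfderiv (𝓡 n) Δ y (X j y)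
      = β y (X j y) * (l y * Δ y) := by
    intro y
    have h1 := hF.surface_mvfderiv hD (i := j) (j := i)
      (fun x v => by rw [add_comm]; exact hspan x v) hs hK hL hKc hLc y
    have e1 : (fun y => minor V X j i K L y / inner ℝ (X j y) (X j y)) = fun y => (-1) * l y :=
      funext fun y => by rw [hF.minor_swap hspan hK hL]; simp [l]
    have e2 : (fun y => inner ℝ (X j y) (X j y) * inner ℝ (X i y) (X i y)
        - (inner ℝ (X j y) (X i y) : ℝ) ^ 2) = Δ :=
      funext fun y => by rw [real_inner_comm (X i y) (X j y), mul_comm]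
    rw [e1, e2, congrFun e2 y, congrFun e1 y,
      mvfderiv_fun_mul mdifferentiableAt_const (hl.mdiffAt_real y), mvfderiv_const] at h1
    simp only [smul_zero, add_zero, smul_apply, smul_eq_mul] at h1
    linear_combination -h1
  let Q : M → ℝ := fun y => l y * (l y * (l y * Δ y))
  have hQ : ContMDiff (𝓡 n) 𝓘(ℝ, ℝ) ∞ Q := hl.mul (hl.mul (hl.mul hΔ))
  have hdQ : ∀ (y : M) (v : TangentSpace (𝓡 n) y), mvfderiv (𝓡 n) Q y v
      = l y ^ 2 * (3 * mvfderiv (𝓡 n) l y v * Δ y + l y * mvfderiv (𝓡 n) Δ y v) := by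
    intro y v
    have h1 : MDifferentiableAt (𝓡 n) 𝓘(ℝ, ℝ) (fun y => l y * Δ y) y := (hl.mul hΔ).mdiffAt_real y
    have h2 : MDifferentiableAt (𝓡 n) 𝓘(ℝ, ℝ) (fun y => l y * (l y * Δ y)) y :=
      (hl.mul (hl.mul hΔ)).mdiffAt_real y
    rw [mvfderiv_fun_mul (hl.mdiffAt_real y) h2, mvfderiv_fun_mul (hl.mdiffAt_real y) h1,
      mvfderiv_fun_mul (hl.mdiffAt_real y) (hΔ.mdiffAt_real y)]
    simp only [add_apply, smul_apply, smul_eq_mul]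
    ring
  have hQi : ∀ y, mvfderiv (𝓡 n) Q y (X i y) = β y (X i y) * Q y := fun y => by
    rw [hdQ, hi]; ring
  have hQj : ∀ y, mvfderiv (𝓡 n) Q y (X j y) = β y (X j y) * Q y := fun y => by
    rw [hdQ, hj]; ring
  have hcomm := hF.mvfderiv_comm hQ x i j
  simp only [hQi, hQj] at hcomm
  rw [mvfderiv_fun_mul ((hβ j).mdiffAt_real x) (hQ.mdiffAt_real x),
    mvfderiv_fun_mul ((hβ i).mdiffAt_real x) (hQ.mdiffAt_real x)] at hcomm
  simp only [add_apply, smul_apply, smul_eq_mul, hQi, hQj] at hcomm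
  have hlx : l x ≠ 0 := div_ne_zero hx (hF.inner_self_pos x i).ne'
  have hQx : Q x ≠ 0 :=
    mul_ne_zero hlx (mul_ne_zero hlx (mul_ne_zero hlx (hF.gram_ne_zero hij x)))
  refine mul_left_cancel₀ hQx ?_
  linarith

/-- An irreducible space of Killing tensors of a surface contains two which are independent modulo
the metric. -/
theorem exists_minor_ne_zero (hF : IsFlatFrame D V X) (hij : i ≠ j)
    (hspan : ∀ (x : M) (v : TangentSpace (𝓡 n) x),
      v = mvfderiv (𝓡 n) (V i) x v • X i x + mvfderiv (𝓡 n) (V j) x v • X j x)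
    {𝒦 : Submodule ℝ (EndField n M)} {𝒱 : Submodule ℝ C^∞⟮𝓡 n, M; ℝ⟯} {N : ℕ}
    (h : IsIrreducibleSystem 𝒦 𝒱 N) (x : M) :
    ∃ K ∈ 𝒦, ∃ L ∈ 𝒦, minor V X i j K L x ≠ 0 := by
  by_contra! hc
  have ha := (hF.inner_self_pos x i).ne'
  have hnt : Nontrivial (TangentSpace (𝓡 n) x) :=
    ⟨⟨X i x, 0, fun h0 => ha (by rw [h0, inner_zero_left])⟩⟩
  have key : ∀ {φ : TangentSpace (𝓡 n) x → TangentSpace (𝓡 n) x → ℝ}, (∀ u v, φ u v = φ v u) →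
      (∀ u u' v, φ (u + u') v = φ u v + φ u' v) → (∀ (c : ℝ) u v, φ (c • u) v = c * φ u v) →
      (∀ K ∈ 𝒦, ∀ u v, φ u (K x v) = φ v (K x u)) → ∃ μ : ℝ, ∀ u v, φ u v = μ * inner ℝ u v :=
    fun hsymm hadd hsmul hcomm => exists_eq_mul_inner_of_irreducible
      (S := (fun K => K x) '' (𝒦 : Set (EndField n M)))
      (by rintro _ ⟨K, hK, rfl⟩; exact (h.killing K hK).symm x)
      (fun W hW => h.irreducible x W fun K hK => hW _ ⟨K, hK, rfl⟩) hsymm hadd hsmul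
      (by rintro _ ⟨K, hK, rfl⟩; exact hcomm K hK)
  -- If all minors vanish at `x`, the Killing tensors commute pairwise there.
  have hcommX : ∀ K ∈ 𝒦, ∀ L ∈ 𝒦, (inner ℝ (K x (X i x)) (L x (X j x)) : ℝ)
      = inner ℝ (K x (X j x)) (L x (X i x)) := by
    intro K hK L hL
    have h0 := hc K hK L hL
    have h1 := component_symm hspan (h.killing K hK) x
    have h2 := component_symm hspan (h.killing L hL) x
    rw [minor] at h0
    simp only [inner_apply_of_span hspan K, real_inner_comm (L x _),
      inner_apply_of_span hspan L, real_inner_comm (X i x) (X j x)]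
    refine mul_left_cancel₀ ha ?_
    linear_combination ((inner ℝ (X i x) (X j x) : ℝ) ^ 2
        - inner ℝ (X i x) (X i x) * inner ℝ (X j x) (X j x)) * h0
      + (inner ℝ (X i x) (X i x) * component V X L i i x
        + inner ℝ (X i x) (X j x) * component V X L j i x) * h1
      - (inner ℝ (X i x) (X i x) * component V X K i i x
        + inner ℝ (X i x) (X j x) * component V X K j i x) * h2
  -- Commuting with the irreducible family, each `K x` is itself a multiple of the identity.
  have hscalar : ∀ K ∈ 𝒦, ∃ μ : ℝ, ∀ u, K x u = μ • u := by
    intro K hK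
    obtain ⟨μ, hμ⟩ := key (φ := fun u v => inner ℝ (K x u) v)
      (fun u v => by rw [(h.killing K hK).symm, real_inner_comm])
      (fun u u' v => by rw [map_add, inner_add_left])
      (fun c u v => by rw [map_smul, real_inner_smul_left]) (fun L hL u v => by
        rw [hspan x u, hspan x v]
        simp only [map_add, map_smul, inner_add_left, inner_add_right, real_inner_smul_left,
          real_inner_smul_right]
        linear_combination (mvfderiv (𝓡 n) (V i) x u * mvfderiv (𝓡 n) (V j) x v
          - mvfderiv (𝓡 n) (V j) x u * mvfderiv (𝓡 n) (V i) x v) * hcommX K hK L hL)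
    exact ⟨μ, fun u => ext_inner_right ℝ fun v => by rw [hμ, real_inner_smul_left]⟩
  -- Against scalars every symmetric form commutes, so irreducibility would make even the rank-one
  -- form `dVᵢ ⊗ dVᵢ` a multiple of `g`; evaluating on `Xⱼ` and on `Xᵢ` gives a contradiction.
  obtain ⟨μ, hμ⟩ := key (φ := fun u v => mvfderiv (𝓡 n) (V i) x u * mvfderiv (𝓡 n) (V i) x v)
    (fun u v => mul_comm _ _) (fun u u' v => by rw [map_add, add_mul])
    (fun c u v => by rw [map_smul, smul_eq_mul, mul_assoc]) (fun K hK u v => by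
      obtain ⟨c, hc⟩ := hscalar K hK
      rw [hc, hc, map_smul, map_smul, smul_eq_mul, smul_eq_mul]
      ring)
  have h1 := hμ (X j x) (X j x)
  have h2 := hμ (X i x) (X i x)
  simp only [hF.dual, if_neg hij, if_true, mul_zero, mul_one] at h1 h2
  have h3 : μ = 0 := (mul_eq_zero.1 h1.symm).resolve_right (hF.inner_self_pos x j).ne'
  rw [h3, zero_mul] at h2
  exact one_ne_zero h2

end IsFlatFrame

section system
variable [T2Space M] {𝒦 : Submodule ℝ (EndField n M)}
  {𝒱 : Submodule ℝ C^∞⟮𝓡 n, M; ℝ⟯} {T : BilinField n M} {s : VField n M}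

theorem IsGeneralizedSemidegenerate.mvfderiv_form_comm (hn : 2 ≤ n)
    (h : IsGeneralizedSemidegenerate 𝒦 𝒱 T s) {V : Fin n → C^∞⟮𝓡 n, M; ℝ⟯} {X : Fin n → VField n M}
    (hF : IsFlatFrame (tensorD T s) V X) (hV : ∀ i, V i ∈ 𝒱)
    {β : OneForm n M} (hβ : ∀ i, ContMDiff (𝓡 n) 𝓘(ℝ, ℝ) ∞ fun x => β x (X i x))
    (hs : ∀ x, HasSkewPart (tensorD T s) β x) (x : M) (k l : Fin n) :
    mvfderiv (𝓡 n) (fun y => β y (X k y)) x (X l x)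
      = mvfderiv (𝓡 n) (fun y => β y (X l y)) x (X k x) := by
  have hD := tensorD_symm (s := s) h.structureTensor.symm
  rcases hn.lt_or_eq with hn | rfl
  · exact hF.mvfderiv_form_comm_of_three_le hn hD hβ hs x k l
  have hspan : ∀ (x : M) (v : TangentSpace (𝓡 2) x),
      v = mvfderiv (𝓡 2) (V 0) x v • X 0 x + mvfderiv (𝓡 2) (V 1) x v • X 1 x := fun x v => by
    conv_lhs => rw [hF.eq_sum v, Fin.sum_univ_two]
  obtain ⟨K, hK, L, hL, hKL⟩ := hF.exists_minor_ne_zero zero_ne_one hspan h.system x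
  have key := hF.mvfderiv_form_comm_of_surface hD zero_ne_one hspan hβ hs
    (h.system.killing K hK) (h.system.killing L hL)
    (fun k => h.system.closed K hK _ (hV k)) (fun k => h.system.closed L hL _ (hV k)) hKL
  fin_cases k <;> fin_cases l
  · rfl
  · exact key.symm
  · exact key
  · rfl

end system
end
end Superint
end
noncomputable section
namespace Superint

section
variable {n : ℕ} {M : Type*} [TopologicalSpace M] [ChartedSpace (EuclideanSpace ℝ (Fin n)) M]
  [IsManifold (𝓡 n) ∞ M]

/-! ### Construction of the additional potential -/

theorem IsClosedOneForm.add_smul_comp {V W : C^∞⟮𝓡 n, M; ℝ⟯} {K : EndField n M}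
    (hK : ∀ X : VField n M, SmoothVField X → SmoothVField fun x => K x (X x))
    (hV : IsClosedOneForm fun x => (differential (n := n) V x).comp (K x))
    (hW : IsClosedOneForm fun x => (differential (n := n) W x).comp (K x)) (c : ℝ) :
    IsClosedOneForm fun x =>
      (differential (n := n) (V + c • W : C^∞⟮𝓡 n, M; ℝ⟯) x).comp (K x) := by
  intro X Y hX hY x
  have hm : ∀ (V : C^∞⟮𝓡 n, M; ℝ⟯) {X : VField n M}, SmoothVField X →
      MDifferentiableAt (𝓡 n) 𝓘(ℝ, ℝ) (fun y => mvfderiv (𝓡 n) V y (K y (X y))) x := fun V X hX =>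
    (smooth_mvfderiv_apply V.contMDiff (hK X hX)).mdiffAt_real x
  have hd : ∀ (y : M) (v : TangentSpace (𝓡 n) y),
      ((differential (n := n) (V + c • W : C^∞⟮𝓡 n, M; ℝ⟯) y).comp (K y)) v
        = mvfderiv (𝓡 n) V y (K y v) + c * mvfderiv (𝓡 n) W y (K y v) := fun y v =>
    congrArg (fun L : TangentSpace (𝓡 n) y →L[ℝ] ℝ => L (K y v))
      (((diffAt y).map_add V (c • W)).trans (congrArg (_ + ·) ((diffAt y).map_smul c W)))
  have hder : ∀ {X : VField n M}, SmoothVField X → ∀ v : TangentSpace (𝓡 n) x,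
      mvfderiv (𝓡 n) (fun y => mvfderiv (𝓡 n) V y (K y (X y))
        + c * mvfderiv (𝓡 n) W y (K y (X y))) x v
      = mvfderiv (𝓡 n) (fun y => mvfderiv (𝓡 n) V y (K y (X y))) x v
        + c * mvfderiv (𝓡 n) (fun y => mvfderiv (𝓡 n) W y (K y (X y))) x v := by
    intro X hX v
    have h1 : MDifferentiableAt (𝓡 n) 𝓘(ℝ, ℝ)
        (fun y => c * mvfderiv (𝓡 n) W y (K y (X y))) x := mdifferentiableAt_const.mul (hm W hX)
    rw [mvfderiv_fun_add (hm V hX) h1, mvfderiv_fun_mul mdifferentiableAt_const (hm W hX),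
      mvfderiv_const]
    simp
  have h1 := hV X Y hX hY x
  have h2 := hW X Y hX hY x
  simp only [hd, hder hX, hder hY]
  simp only [ContinuousLinearMap.comp_apply, differential] at h1 h2
  linear_combination h1 + c * h2

variable [RiemannianBundle (fun x : M => TangentSpace (𝓡 n) x)]
  [IsContMDiffRiemannianBundle (𝓡 n) ∞ (EuclideanSpace ℝ (Fin n))
  (fun x : M => TangentSpace (𝓡 n) x)]

namespace IsFlatFrame
variable {D : BilinField n M} {V : Fin n → C^∞⟮𝓡 n, M; ℝ⟯} {X : Fin n → VField n M} [T2Space M]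

theorem exists_primitive [SimplyConnectedSpace M] (hF : IsFlatFrame D V X) {a : Fin n → M → ℝ}
    (ha : ∀ i, ContMDiff (𝓡 n) 𝓘(ℝ, ℝ) ∞ (a i))
    (hsymm : ∀ x i j, mvfderiv (𝓡 n) (a i) x (X j x) = mvfderiv (𝓡 n) (a j) x (X i x)) :
    ∃ h : M → ℝ, ContMDiff (𝓡 n) 𝓘(ℝ, ℝ) ∞ h ∧ ∀ x (v : TangentSpace (𝓡 n) x),
      mvfderiv (𝓡 n) h x v = ∑ i, a i x * mvfderiv (𝓡 n) (V i) x v :=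
  Superint.exists_primitive (fun i => (V i).contMDiff) ha hsymm
    fun i x v => hF.mvfderiv_eq_sum (a i) x v

/-- A potential `W` with `Xᵢ Xⱼ W = f g(Xᵢ, Xⱼ)` for a positive function `f`. -/
theorem exists_potential [SimplyConnectedSpace M] (hF : IsFlatFrame D V X)
    (hD : ∀ (x : M) (u v : TangentSpace (𝓡 n) x), D x u v = D x v u) {β : OneForm n M}
    (hβ : ∀ i, ContMDiff (𝓡 n) 𝓘(ℝ, ℝ) ∞ fun x => β x (X i x))
    (hs : ∀ x, HasSkewPart D β x) (hcl : ∀ x i j, mvfderiv (𝓡 n) (fun y => β y (X i y)) x (X j x)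
      = mvfderiv (𝓡 n) (fun y => β y (X j y)) x (X i x)) :
    ∃ (W : C^∞⟮𝓡 n, M; ℝ⟯) (P : Fin n → M → ℝ) (f : M → ℝ), (∀ x, 0 < f x) ∧
      (∀ j, ContMDiff (𝓡 n) 𝓘(ℝ, ℝ) ∞ (P j)) ∧
      (∀ j x v, mvfderiv (𝓡 n) (P j) x v = f x * inner ℝ v (X j x)) ∧
      ∀ x v, mvfderiv (𝓡 n) W x v = ∑ j, P j x * mvfderiv (𝓡 n) (V j) x v := by
  obtain ⟨h, hh, hdh⟩ := hF.exists_primitive hβ hcl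
  have hdh' : ∀ x i, mvfderiv (𝓡 n) h x (X i x) = β x (X i x) := fun x i => by
    simp [hdh, hF.dual]
  have hg : ∀ i j, ContMDiff (𝓡 n) 𝓘(ℝ, ℝ) ∞ fun y => (inner ℝ (X i y) (X j y) : ℝ) := fun i j =>
    (hF.smooth i).contMDiff_inner (hF.smooth j)
  -- The integrating factor: `df = -f β` turns the skew identity into the symmetry of `Xₖ(f gᵢⱼ)` in
  -- `i, k`.
  let f : M → ℝ := fun x => Real.exp (-h x)
  have hf : ContMDiff (𝓡 n) 𝓘(ℝ, ℝ) ∞ f := Real.contDiff_exp.contMDiff.comp hh.neg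
  have hdf : ∀ x v, mvfderiv (𝓡 n) f x v = -(f x * mvfderiv (𝓡 n) h x v) := by
    intro x v
    have h1 := (Real.hasDerivAt_exp (-h x)).hasFDerivAt.hasMFDerivAt.comp x
      (hh.neg.mdiffAt_real x).hasMFDerivAt
    have h2 : mvfderiv (𝓡 n) f x v = mvfderiv (𝓡 n) (-h) x v * Real.exp (-h x) := by
      rw [mvfderiv, ContinuousLinearMap.comp_apply]
      exact (congrArg _ (congrArg (fun L => L v) h1.mfderiv)).trans (by rfl)
    rw [h2, mvfderiv_neg, neg_apply]
    simp only [f]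
    ring
  choose P hP hdP using fun j => hF.exists_primitive (a := fun i x => f x * inner ℝ (X i x) (X j x))
    (fun i => hf.mul (hg i j)) (fun x i k => by
      rw [mvfderiv_fun_mul (hf.mdiffAt_real x) ((hg i j).mdiffAt_real x),
        mvfderiv_fun_mul (hf.mdiffAt_real x) ((hg k j).mdiffAt_real x)]
      simp only [add_apply, smul_apply, smul_eq_mul, hdf, hdh']
      linear_combination f x * hF.skew_mvfderiv_inner hD hs x i j k)
  have hdP' : ∀ j x v, mvfderiv (𝓡 n) (P j) x v = f x * inner ℝ v (X j x) := fun j x v => by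
    rw [hdP]
    conv_rhs => rw [hF.eq_sum v]
    rw [sum_inner, Finset.mul_sum]
    refine Finset.sum_congr rfl fun i _ => ?_
    rw [real_inner_smul_left]
    ring
  -- The second integration is possible because `Xⱼ Pᵢ = f gᵢⱼ` is symmetric in `i, j`.
  obtain ⟨W, hW, hdW⟩ := hF.exists_primitive hP fun x i j => by
    rw [hdP', hdP', real_inner_comm]
  exact ⟨⟨W, hW⟩, P, f, fun x => Real.exp_pos _, hP, hdP', hdW⟩

/-- Write `K(dW) = ∑ Pⱼ K(dVⱼ)`. Each `K(dVⱼ)` is closed, so only `∑ dPⱼ ∧ K(dVⱼ)` is left. On `Y,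
Z` it equals `f (g(Y, KZ) - g(Z, KY))`, which vanishes as `K` is self-adjoint. -/
theorem isClosedOneForm_of_potential (hF : IsFlatFrame D V X) {W : C^∞⟮𝓡 n, M; ℝ⟯}
    {P : Fin n → M → ℝ} {f : M → ℝ} (hP : ∀ j, ContMDiff (𝓡 n) 𝓘(ℝ, ℝ) ∞ (P j))
    (hdP : ∀ j x v, mvfderiv (𝓡 n) (P j) x v = f x * inner ℝ v (X j x))
    (hdW : ∀ x v, mvfderiv (𝓡 n) W x v = ∑ j, P j x * mvfderiv (𝓡 n) (V j) x v)
    {K : EndField n M} (hK : IsKillingTensor K)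
    (hc : ∀ j, IsClosedOneForm fun x => (differential (n := n) (V j) x).comp (K x)) :
    IsClosedOneForm fun x => (differential (n := n) W x).comp (K x) := by
  intro Y Z hY hZ x
  have hm : ∀ j {Z : VField n M}, SmoothVField Z →
      MDifferentiableAt (𝓡 n) 𝓘(ℝ, ℝ) (fun y => mvfderiv (𝓡 n) (V j) y (K y (Z y))) x :=
    fun j Z hZ => (smooth_mvfderiv_apply (V j).contMDiff (hK.smooth Z hZ)).mdiffAt_real x
  have hder : ∀ {Z : VField n M}, SmoothVField Z → ∀ v : TangentSpace (𝓡 n) x,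
      mvfderiv (𝓡 n) (fun y => ∑ j, P j y * mvfderiv (𝓡 n) (V j) y (K y (Z y))) x v
        = f x * inner ℝ v (K x (Z x)) + ∑ j, P j x *
          mvfderiv (𝓡 n) (fun y => mvfderiv (𝓡 n) (V j) y (K y (Z y))) x v := by
    intro Z hZ v
    rw [(mvfderiv_finset_sum Finset.univ
      (f := fun j y => P j y * mvfderiv (𝓡 n) (V j) y (K y (Z y)))
      fun j => ((hP j).mdiffAt_real x).mul (hm j hZ)).2]
    conv_rhs => rw [hF.eq_sum (K x (Z x))]
    rw [inner_sum, Finset.mul_sum, ← Finset.sum_add_distrib]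
    refine Finset.sum_congr rfl fun j _ => ?_
    rw [mvfderiv_fun_mul ((hP j).mdiffAt_real x) (hm j hZ)]
    simp only [add_apply, smul_apply, smul_eq_mul, hdP, real_inner_smul_right]
    ring
  have h0 : ∑ j, P j x * (mvfderiv (𝓡 n) (fun y => mvfderiv (𝓡 n) (V j) y (K y (Z y))) x (Y x)
      - mvfderiv (𝓡 n) (fun y => mvfderiv (𝓡 n) (V j) y (K y (Y y))) x (Z x)
      - mvfderiv (𝓡 n) (V j) x (K x (mlieBracket (𝓡 n) Y Z x))) = 0 :=
    Finset.sum_eq_zero fun j _ => by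
      have := hc j Y Z hY hZ x
      simp only [ContinuousLinearMap.comp_apply, differential] at this
      rw [this, mul_zero]
  simp only [mul_sub, Finset.sum_sub_distrib] at h0
  simp only [ContinuousLinearMap.comp_apply, differential, hdW, hder hY, hder hZ]
  have h1 := hK.symm x (Y x) (Z x)
  rw [real_inner_comm] at h1
  linear_combination h0 - f x * h1

end IsFlatFrame

section system
variable [T2Space M] [SimplyConnectedSpace M] {𝒦 : Submodule ℝ (EndField n M)}
  {𝒱 : Submodule ℝ C^∞⟮𝓡 n, M; ℝ⟯} {T : BilinField n M} {s : VField n M}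

theorem IsIrreducibleSystem.sup_span {N : ℕ} (h : IsIrreducibleSystem 𝒦 𝒱 N)
    {W : C^∞⟮𝓡 n, M; ℝ⟯} (hW : W ∉ 𝒱)
    (hc : ∀ K ∈ 𝒦, IsClosedOneForm fun x => (differential (n := n) W x).comp (K x)) :
    IsIrreducibleSystem 𝒦 (𝒱 ⊔ Submodule.span ℝ {W}) (N + 1) where
  killing := h.killing
  metric_mem := h.metric_mem
  le_rank := h.le_rank
  irreducible := h.irreducible
  closed K hK U hU := by
    obtain ⟨V, hV, c, rfl⟩ : ∃ V ∈ 𝒱, ∃ c : ℝ, V + c • W = U := by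
      obtain ⟨V, hV, Z, hZ, rfl⟩ := Submodule.mem_sup.1 hU
      obtain ⟨c, rfl⟩ := Submodule.mem_span_singleton.1 hZ
      exact ⟨V, hV, c, rfl⟩
    exact IsClosedOneForm.add_smul_comp (h.killing K hK).smooth (h.closed K hK V hV) (hc K hK) c
  rank_eq := by
    have hW0 : W ≠ 0 := fun h0 => hW (h0 ▸ 𝒱.zero_mem)
    have hd : 𝒱 ⊓ Submodule.span ℝ {W} = ⊥ := by
      exact disjoint_iff.1 (Submodule.disjoint_span_singleton_of_notMem hW)
    have h1 := Submodule.rank_sup_add_rank_inf_eq 𝒱 (Submodule.span ℝ {W})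
    rw [hd, rank_bot, add_zero, h.rank_eq, ← Module.finrank_eq_rank ℝ (Submodule.span ℝ {W}),
      finrank_span_singleton hW0] at h1
    rw [h1]
    norm_cast

theorem IsGeneralizedSemidegenerate.isWeak_of_hasSkewPart (hn : 2 ≤ n)
    (h : IsGeneralizedSemidegenerate 𝒦 𝒱 T s)
    (hs : ∀ x, HasSkewPart (tensorD T s) (formBeta T s) x) : IsWeak 𝒦 𝒱 := by
  obtain ⟨V, X, hV, hF⟩ := h.exists_isFlatFrame
  have hD := tensorD_symm (s := s) h.structureTensor.symm
  have hβ := fun i => hF.smooth_formBeta hn h.structureTensor.smooth h.smooth (hF.smooth i)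
  obtain ⟨W, P, f, hf, hP, hdP, hdW⟩ := hF.exists_potential hD hβ hs
    fun x i j => h.mvfderiv_form_comm hn hF hV hβ hs x i j
  -- A potential in `𝒱` has `Xᵢ Xᵢ W = 0`, whereas here `Xᵢ Xᵢ W = f gᵢᵢ > 0`.
  have hW : W ∉ 𝒱 := by
    intro hW
    obtain ⟨x⟩ : Nonempty M := inferInstance
    let i : Fin n := ⟨0, by omega⟩
    have h1 := hessian_apply W.contMDiff ((hF.smooth i).mdiffAt x) (X i x)
    have h2 : (fun y => mvfderiv (𝓡 n) W y (X i y)) = P i := by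
      ext y
      simp [hdW, hF.dual]
    rw [h.hessian_eq hW, hF.leviCivita_eq, map_neg, h2, hdP] at h1
    have h3 := mul_pos (hf x) (hF.inner_self_pos x i)
    linarith
  exact ⟨_, le_sup_left, h.system.sup_span hW fun K hK => hF.isClosedOneForm_of_potential hP hdP
    hdW (h.system.killing K hK) fun j => h.system.closed K hK _ (hV j)⟩

end system
end
end Superint
end
-- The theorem
theorem theorem2 (n : ℕ) (hn : 2 ≤ n)
    {M : Type*} [TopologicalSpace M] [T2Space M] [SecondCountableTopology M]
    [SimplyConnectedSpace M]
    [ChartedSpace (EuclideanSpace ℝ (Fin n)) M] [IsManifold (𝓡 n) ∞ M]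
    [RiemannianBundle (fun x : M => TangentSpace (𝓡 n) x)]
    [IsContMDiffRiemannianBundle (𝓡 n) ∞ (EuclideanSpace ℝ (Fin n))
      (fun x : M => TangentSpace (𝓡 n) x)]
    (𝒦 : Submodule ℝ (Superint.EndField n M)) (𝒱 : Submodule ℝ C^∞⟮𝓡 n, M; ℝ⟯)
    (T : Superint.BilinField n M) (s : Superint.VField n M)
    (hsys : Superint.IsGeneralizedSemidegenerate 𝒦 𝒱 T s) :
    (∀ 𝒱' : Submodule ℝ C^∞⟮𝓡 n, M; ℝ⟯, 𝒱 ≤ 𝒱' → Superint.IsNondegenerate 𝒦 𝒱' →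
      (∃! T' : Superint.BilinField n M, Superint.IsStructureTensor 𝒱' T') ∧
      ∀ T' : Superint.BilinField n M, Superint.IsStructureTensor 𝒱' T' →
        Superint.ShareDualGeodesics
          (Superint.inducedConnection (Superint.tensorD T s)) (Superint.inducedConnection T') ∧
        Superint.ShareDualGeodesics
          (Superint.inducedConnection (-Superint.tensorD T s)) (Superint.inducedConnection (-T'))) ∧
    (Superint.SemiCompatible (Superint.inducedConnection (Superint.tensorD T s))
        ((1 / (n : ℝ)) • (Superint.flat s - ((n : ℝ) + 2) • Superint.formT T)) ↔
      Superint.IsWeak 𝒦 𝒱) ∧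
    (Superint.SemiCompatible (Superint.inducedConnection (-Superint.tensorD T s))
        (-((1 / (n : ℝ)) • (Superint.flat s - ((n : ℝ) + 2) • Superint.formT T))) ↔
      Superint.IsWeak 𝒦 𝒱) := by
  obtain ⟨x₀⟩ : Nonempty M := inferInstance
  have hD := Superint.tensorD_symm (s := s) hsys.structureTensor.symm
  have hD' : ∀ (x : M) (u v : TangentSpace (𝓡 n) x),
      (-Superint.tensorD T s) x u v = (-Superint.tensorD T s) x v u := fun x u v =>
    congrArg Neg.neg (hD x u v)
  have hweak : (∀ x, Superint.HasSkewPart (Superint.tensorD T s) (Superint.formBeta T s) x) ↔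
      Superint.IsWeak 𝒦 𝒱 :=
    ⟨hsys.isWeak_of_hasSkewPart hn, fun h x => hsys.hasSkewPart_of_isWeak hn h x⟩
  refine ⟨fun 𝒱' hle h' => ⟨⟨T, hsys.isStructureTensor_of_le (by omega) hle h',
    fun T' hT' => hsys.eq_of_isStructureTensor hle hT'⟩, fun T' hT' => ?_⟩, ?_, ?_⟩
  · rw [hsys.eq_of_isStructureTensor hle hT']
    constructor
    · refine Superint.shareDualGeodesics_of_eq_add (w := fun x => (1 / (n : ℝ)) • s x)
        fun x u v => ?_
      rw [Superint.tensorD_apply, smul_smul, mul_comm]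
    · refine Superint.shareDualGeodesics_of_eq_add (w := fun x => -((1 / (n : ℝ)) • s x))
        fun x u v => ?_
      change -(Superint.tensorD T s x u v) = -(T x u v) + _
      rw [Superint.tensorD_apply, smul_neg, smul_smul, mul_comm, neg_add]
  · exact (Superint.semiCompatible_inducedConnection_iff hD).trans hweak
  · refine (Superint.semiCompatible_inducedConnection_iff hD').trans (Iff.trans ?_ hweak)
    exact forall_congr' fun x => Superint.hasSkewPart_neg_iff
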